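/- Let $n,m\ge 0$ be integers and let $G_{n,m}$ be the Grassmann manifold of oriented linear $n$-subspaces of $\mathbb R^{n+m}$. For $P,Q\in G_{n,m}$ with oriented orthonormal bases $(e_i)$, $(f_j)$ put $w(P,Q)=\det(\langle e_i,f_j\rangle)$. Let $P,Q\in G_{n,m}$ be S-orthogonal, i.e. $\dim(P\cap Q)=n-1$ and $w(P,Q)=0$, let $\mathscr S\colon G_{n,m}\to\mathbb R^2$, $\mathscr S(S)=(w(S,P),w(S,Q))$, whose values lie in the closed unit disk $\overline{\mathbb D}$, and for $c\in[0,1)$ put $$\mathbb W_c=\mathscr S^{-1}\Big(\overline{\mathbb D}\setminus\big(\{x_1^2+x_2^2\le c^2\}\cup\{(a,0):a\le 0\}\big)\Big).$$ (1) For every compact $K\subset\mathbb W_{1/3}$ there are constants $K_0>0$ and $C$, depending only on $K$, such that for every oriented smooth $n$-dimensional immersed submanifold $M$ of $\mathbb R^{n+m}$ with parallel mean curvature whose Gauss image is contained in $K$ there is a smooth function $f$ on $M$ with $0<f\le C$ and $$\Delta f\ \ge\ K_0\,|B|^2\quad\text{on } M.$$ Here the Gauss map sends $x\in M$ to the oriented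 tangent space $T_xM\in G_{n,m}$, $B$ is the second fundamental form, the mean curvature $H=\operatorname{tr}B$ is parallel in the normal bundle ($\nabla H=0$), and $\Delta$ is the Laplace--Beltrami operator of the induced metric. (2) For every compact $K\subset\mathbb W_0$ there are constants $K_0>0$ and $C$, depending only on $K$, such that for every oriented smooth $n$-dimensional immersed minimal ($H=0$) submanifold $M$ of $\mathbb R^{n+m}$ whose Gauss map has rank at most $2$ at every point and whose Gauss image is contained in $K$ there is a smooth function $f$ on $M$ with $0<f\le C$ and $\Delta f\ge K_0|B|^2$ on $M$. -/

import Mathlib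

open scoped Manifold ContDiff

noncomputable section

namespace GaussImage

/-! ### The Grassmannian of oriented `n`-planes in `ℝ^(n+m)` -/

/-- The ambient Euclidean space `ℝ^(n+m)`. -/
abbrev Ambient (n m : ℕ) : Type := EuclideanSpace ℝ (Fin (n + m))

/-- The model space `ℝ^n` of the submanifolds. -/
abbrev Model (n : ℕ) : Type := EuclideanSpace ℝ (Fin n)

/-- Orthonormal `n`-frames in `ℝ^(n+m)` (the Stiefel manifold, with the subspace topology). -/
abbrev Frame (n m : ℕ) : Type := {e : Fin n → Ambient n m // Orthonormal ℝ e}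

/-- The `W`-matrix `(⟨e_i, f_j⟩)` of two `n`-tuples of vectors. -/
def wMatrix {n m : ℕ} (e f : Fin n → Ambient n m) : Matrix (Fin n) (Fin n) ℝ :=
  Matrix.of fun i j => inner ℝ (e i) (f j)

/-- Two orthonormal frames span the same oriented `n`-plane iff they differ by a rotation. -/
def SameOrientedSpan {n m : ℕ} (e f : Frame n m) : Prop :=
  ∃ A ∈ Matrix.specialOrthogonalGroup (Fin n) ℝ, ∀ i, f.1 i = ∑ k, A i k • e.1 k

theorem sameOrientedSpan_equivalence (n m : ℕ) :
    Equivalence (SameOrientedSpan (n := n) (m := m)) := by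
  refine ⟨fun e => ⟨1, one_mem _, fun i => by simp [Matrix.one_apply]⟩, ?_, ?_⟩
  · rintro e f ⟨A, hA, h⟩
    obtain ⟨hA1, hA2⟩ := Matrix.mem_specialUnitaryGroup_iff.1 hA
    have hAA : star A * A = 1 := Matrix.mem_unitaryGroup_iff'.1 hA1
    refine ⟨star A, Matrix.mem_specialUnitaryGroup_iff.2 ⟨Unitary.star_mem hA1, ?_⟩, fun i => ?_⟩
    · rw [Matrix.star_eq_conjTranspose, Matrix.det_conjTranspose, hA2, star_one]
    simp only [h, Finset.smul_sum, smul_smul]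
    rw [Finset.sum_comm]
    have key : ∀ k, ∑ j, (star A i j * A j k) • e.1 k = (if i = k then (1 : ℝ) else 0) • e.1 k := by
      intro k
      rw [← Finset.sum_smul, ← Matrix.mul_apply, hAA, Matrix.one_apply]
    simp only [key]
    simp
  · rintro e f g ⟨A, hA, h⟩ ⟨B, hB, h'⟩
    refine ⟨B * A, mul_mem hB hA, fun i => ?_⟩
    simp only [h', h, Finset.smul_sum, smul_smul]
    rw [Finset.sum_comm]
    refine Finset.sum_congr rfl fun k _ => ?_
    rw [← Finset.sum_smul, ← Matrix.mul_apply]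

/-- The setoid of orthonormal frames spanning the same oriented plane. -/
def frameSetoid (n m : ℕ) : Setoid (Frame n m) :=
  ⟨SameOrientedSpan, sameOrientedSpan_equivalence n m⟩

/-- The Grassmann manifold of oriented linear `n`-subspaces of `ℝ^(n+m)`: orthonormal `n`-frames
modulo `SO(n)`. -/
def OrientedGrassmannian (n m : ℕ) : Type := Quotient (frameSetoid n m)

/-- The quotient topology. -/
instance (n m : ℕ) : TopologicalSpace (OrientedGrassmannian n m) :=
  inferInstanceAs (TopologicalSpace (Quotient (frameSetoid n m)))

/-- The oriented plane with oriented orthonormal basis `e`. -/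
def OrientedGrassmannian.mk {n m : ℕ} (e : Frame n m) : OrientedGrassmannian n m :=
  Quotient.mk (frameSetoid n m) e

/-- The underlying linear subspace of an oriented plane. -/
def OrientedGrassmannian.toSubmodule {n m : ℕ} :
    OrientedGrassmannian n m → Submodule ℝ (Ambient n m) :=
  Quotient.lift (fun e => Submodule.span ℝ (Set.range e.1)) (by
    have key : ∀ e f : Frame n m, SameOrientedSpan e f →
        Submodule.span ℝ (Set.range f.1) ≤ Submodule.span ℝ (Set.range e.1) := by
      rintro e f ⟨A, -, h⟩
      rw [Submodule.span_le]
      rintro _ ⟨i, rfl⟩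
      rw [h i]
      exact Submodule.sum_mem _ fun k _ =>
        Submodule.smul_mem _ _ (Submodule.subset_span ⟨k, rfl⟩)
    exact fun e f h => le_antisymm
      (key f e ((sameOrientedSpan_equivalence n m).symm h)) (key e f h))

theorem det_wMatrix_congr {n m : ℕ} {e e' f f' : Frame n m}
    (he : SameOrientedSpan e e') (hf : SameOrientedSpan f f') :
    (wMatrix e.1 f.1).det = (wMatrix e'.1 f'.1).det := by
  obtain ⟨A, hA, h⟩ := he
  obtain ⟨B, hB, h'⟩ := hf
  have hW : wMatrix e'.1 f'.1 = A * wMatrix e.1 f.1 * B.transpose := by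
    ext i j
    simp only [wMatrix, Matrix.of_apply, h, h', Matrix.mul_apply, sum_inner, inner_sum,
      real_inner_smul_left, real_inner_smul_right, Matrix.transpose_apply, Finset.sum_mul]
    exact Finset.sum_congr rfl fun _ _ => Finset.sum_congr rfl fun _ _ => by ring
  rw [hW, Matrix.det_mul, Matrix.det_mul, Matrix.det_transpose,
    (Matrix.mem_specialUnitaryGroup_iff.1 hA).2, (Matrix.mem_specialUnitaryGroup_iff.1 hB).2]
  ring

/-- `w(P, Q) = ⟨e_1 ∧ ⋯ ∧ e_n, f_1 ∧ ⋯ ∧ f_n⟩ = det (⟨e_i, f_j⟩)` for oriented orthonormal bases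
`e` of `P` and `f` of `Q`. -/
def w {n m : ℕ} : OrientedGrassmannian n m → OrientedGrassmannian n m → ℝ :=
  Quotient.lift₂ (fun e f => (wMatrix e.1 f.1).det)
    fun _ _ _ _ he hf => det_wMatrix_congr he hf

/-- The oriented plane with orthonormal basis `ε_{I 1}, …, ε_{I n}`, for `I 1 < ⋯ < I n`. -/
def coordPlane {n m : ℕ} (I : Fin n ↪o Fin (n + m)) : OrientedGrassmannian n m :=
  .mk ⟨fun i => EuclideanSpace.single (I i) 1,
    (EuclideanSpace.orthonormal_single (𝕜 := ℝ)).comp I I.injective⟩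

/-- The Plücker embedding `P ↦ e_1 ∧ ⋯ ∧ e_n`, written in the orthonormal basis
`ε_{I 1} ∧ ⋯ ∧ ε_{I n}`, `I 1 < ⋯ < I n`, of `Λ^n(ℝ^(n+m))`. -/
def plucker {n m : ℕ} (P : OrientedGrassmannian n m) : (Fin n ↪o Fin (n + m)) → ℝ :=
  fun I => w P (coordPlane I)

/-- `P` and `Q` are S-orthogonal: `dim (P ∩ Q) = n - 1` and `w(P, Q) = 0`. -/
def SOrthogonal {n m : ℕ} (P Q : OrientedGrassmannian n m) : Prop :=
  Module.finrank ℝ ↥(P.toSubmodule ⊓ Q.toSubmodule) + 1 = n ∧ w P Q = 0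

/-- The S-map relative to `P` and `Q`. -/
def sMap {n m : ℕ} (P Q S : OrientedGrassmannian n m) : ℝ × ℝ := (w S P, w S Q)

/-- The closed disk of radius `c` about the origin of `ℝ²`. -/
def closedDisk (c : ℝ) : Set (ℝ × ℝ) := {x | x.1 ^ 2 + x.2 ^ 2 ≤ c ^ 2}

/-- The set `𝕎_c` (relative to `P` and `Q`), for `c ≥ 0`. -/
def regionW {n m : ℕ} (P Q : OrientedGrassmannian n m) (c : ℝ) :
    Set (OrientedGrassmannian n m) :=
  sMap P Q ⁻¹' (closedDisk 1 \ (closedDisk c ∪ {x | x.1 ≤ 0 ∧ x.2 = 0}))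

/-! ### Extrinsic geometry of a parametrized immersion `u : ℝ^n ⊇ U → ℝ^(n+m)` -/

section Local

variable {n m : ℕ}

/-- The partial derivative `∂_i u`. -/
def pd {G : Type*} [NormedAddCommGroup G] [NormedSpace ℝ G] (i : Fin n) (u : Model n → G)
    (y : Model n) : G :=
  fderiv ℝ u y (EuclideanSpace.single i 1)

/-- The induced metric `g_ij = ⟨∂_i u, ∂_j u⟩`. -/
def metric (u : Model n → Ambient n m) (y : Model n) : Matrix (Fin n) (Fin n) ℝ :=
  Matrix.of fun i j => inner ℝ (pd i u y) (pd j u y)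

/-- The inverse metric `g^ij`. -/
def invMetric (u : Model n → Ambient n m) (y : Model n) : Matrix (Fin n) (Fin n) ℝ :=
  (metric u y)⁻¹

/-- The coefficients `c^k = ∑_l g^kl ⟨v, ∂_l u⟩` of the tangential part `∑_k c^k ∂_k u` of `v`. -/
def tangentCoeff (u : Model n → Ambient n m) (y : Model n) (v : Ambient n m) (k : Fin n) : ℝ :=
  ∑ l, invMetric u y k l * inner ℝ v (pd l u y)

/-- The orthogonal projection of `v` to the normal space at `u(y)`. -/
def normalPart (u : Model n → Ambient n m) (y : Model n) (v : Ambient n m) : Ambient n m :=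
  v - ∑ k, tangentCoeff u y v k • pd k u y

/-- The coefficients `Γ^k_ij` of the induced connection: `(∂_i ∂_j u)^T = ∑_k Γ^k_ij ∂_k u`. -/
def christoffel (u : Model n → Ambient n m) (y : Model n) (i j k : Fin n) : ℝ :=
  tangentCoeff u y (pd i (pd j u) y) k

/-- The second fundamental form `B(∂_i, ∂_j) = (∂_i ∂_j u)^⊥`. -/
def secondFF (u : Model n → Ambient n m) (y : Model n) (i j : Fin n) : Ambient n m :=
  normalPart u y (pd i (pd j u) y)

/-- `|B|² = ∑ g^ik g^jl ⟨B_ij, B_kl⟩`. -/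
def secondFFNormSq (u : Model n → Ambient n m) (y : Model n) : ℝ :=
  ∑ i, ∑ j, ∑ k, ∑ l, invMetric u y i k * invMetric u y j l *
    inner ℝ (secondFF u y i j) (secondFF u y k l)

/-- The mean curvature vector `H = ∑ g^ij B_ij`. -/
def meanCurvature (u : Model n → Ambient n m) (y : Model n) : Ambient n m :=
  ∑ i, ∑ j, invMetric u y i j • secondFF u y i j

/-- The Laplace–Beltrami operator of the induced metric (the trace of the Hessian),
`Δφ = ∑ g^ij (∂_i ∂_j φ - ∑_k Γ^k_ij ∂_k φ)`. -/
def localLaplacian (u : Model n → Ambient n m) (φ : Model n → ℝ) (y : Model n) : ℝ :=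
  ∑ i, ∑ j, invMetric u y i j * (pd i (pd j φ) y - ∑ k, christoffel u y i j k * pd k φ y)

end Local

/-! ### Oriented immersed submanifolds of `ℝ^(n+m)` -/

/-- The atlas of `M` is oriented: all coordinate changes have positive Jacobian determinant. -/
class OrientedAtlas (n : ℕ) (M : Type*) [TopologicalSpace M] [ChartedSpace (Model n) M] :
    Prop where
  det_pos : ∀ φ ∈ atlas (Model n) M, ∀ ψ ∈ atlas (Model n) M,
    ∀ y ∈ (φ.symm.trans ψ).source, 0 < (fderiv ℝ (φ.symm.trans ψ) y).det

section Global

variable {n m : ℕ} {M : Type*} [TopologicalSpace M] [ChartedSpace (Model n) M]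

/-- `F : M → ℝ^(n+m)` is a smooth immersion. The manifold `M` carries the induced metric. -/
structure SmoothImmersion (F : M → Ambient n m) : Prop where
  contMDiff : ContMDiff (𝓡 n) 𝓘(ℝ, Ambient n m) ∞ F
  injective_mfderiv : ∀ x, Function.Injective (mfderiv (𝓡 n) 𝓘(ℝ, Ambient n m) F x)

/-- A map on `M` written in the preferred chart at `x`. -/
def inChart {G : Type*} (F : M → G) (x : M) : Model n → G := F ∘ (extChartAt (𝓡 n) x).symm

/-- The coordinate vectors `∂_i u (x)` of the preferred chart at `x`, where `u` is `F` written in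
this chart: a positively oriented basis of the tangent space `dF(T_x M)` if the atlas is
oriented. -/
def coordVector (F : M → Ambient n m) (x : M) (i : Fin n) : Ambient n m :=
  pd i (inChart F x) (extChartAt (𝓡 n) x x)

theorem SmoothImmersion.linearIndependent {F : M → Ambient n m} (hF : SmoothImmersion F)
    (x : M) : LinearIndependent ℝ (coordVector F x) := by
  have hd : fderiv ℝ (inChart F x) (extChartAt (𝓡 n) x x) =
      mfderiv (𝓡 n) 𝓘(ℝ, Ambient n m) F x := by
    rw [((hF.contMDiff.mdifferentiable (by simp)) x).mfderiv]
    simp [inChart, writtenInExtChartAt, Function.comp_def, fderivWithin_univ]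
    rfl
  have hi : Function.Injective (fderiv ℝ (inChart F x) (extChartAt (𝓡 n) x x)) := by
    rw [hd]; exact hF.injective_mfderiv x
  have hb := (EuclideanSpace.orthonormal_single (𝕜 := ℝ) (ι := Fin n)).linearIndependent
  exact hb.map' (fderiv ℝ (inChart F x) (extChartAt (𝓡 n) x x)).toLinearMap
    (LinearMap.ker_eq_bot.2 hi)

/-- The Gauss map of an immersion of a manifold with oriented atlas: `x` is sent to its tangent
space in `ℝ^(n+m)`, oriented by the chart at `x`. Gram–Schmidt turns the coordinate vectors into an
orthonormal basis of the same oriented plane. -/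
def gaussMap {F : M → Ambient n m} (hF : SmoothImmersion F) (x : M) : OrientedGrassmannian n m :=
  .mk ⟨InnerProductSpace.gramSchmidtNormed ℝ (coordVector F x),
    InnerProductSpace.gramSchmidtNormed_orthonormal (hF.linearIndependent x)⟩

/-- The rank of the Gauss map at `x`: the rank of its differential, the Grassmannian being a
submanifold of `Λ^n(ℝ^(n+m))` via the Plücker embedding. -/
def gaussRank {F : M → Ambient n m} (hF : SmoothImmersion F) (x : M) : ℕ :=
  Module.finrank ℝ (LinearMap.range
    (mfderiv (𝓡 n) 𝓘(ℝ, (Fin n ↪o Fin (n + m)) → ℝ)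
      (fun y => plucker (gaussMap hF y)) x).toLinearMap)

/-- The mean curvature is parallel in the normal bundle: `(∂_i H)^⊥ = 0`. -/
def HasParallelMeanCurvature (F : M → Ambient n m) : Prop :=
  ∀ (x : M) (i : Fin n), normalPart (inChart F x) (extChartAt (𝓡 n) x x)
    (pd i (meanCurvature (inChart F x)) (extChartAt (𝓡 n) x x)) = 0

/-- The submanifold is minimal: `H = 0`. -/
def IsMinimal (F : M → Ambient n m) : Prop :=
  ∀ x : M, meanCurvature (inChart F x) (extChartAt (𝓡 n) x x) = 0

/-- The squared norm `|B|²` of the second fundamental form at `x`. -/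
def normSqB (F : M → Ambient n m) (x : M) : ℝ :=
  secondFFNormSq (inChart F x) (extChartAt (𝓡 n) x x)

/-- The Laplace–Beltrami operator of `M` with the metric induced by `F`. -/
def laplaceBeltrami (F : M → Ambient n m) (f : M → ℝ) (x : M) : ℝ :=
  localLaplacian (inChart F x) (inChart f x) (extChartAt (𝓡 n) x x)

end Global

end GaussImage

end

universe u

open GaussImage

/-! ### Elementary inequalities under a product bound by 9. -/

namespace GaussImage

/-! S-orthogonal planes have oriented orthonormal bases `p`, `q` that differ in a single vector.
Rotating that vector from `p j` to `q j` gives a circle of planes `P_θ` with `w(·, P_θ) = x₁ cos θ +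
x₂ sin θ`, where `(x₁, x₂)` is the S-map. A compact `K` in `𝕎_c` stays outside a disk of radius `r >
c`. Fix `c < c' < r`. Through each point outside the disk of radius `c'` passes a tangent line to
its boundary circle, `x₁ cos T + x₂ sin T = c'`, and on the slit plane the angle `T` is a smooth
bounded function. The required function is `f = exp (k T)` with `k` large.

To compute `ΔT` at a point, freeze `θ = T` there and put `W = w(·, P_θ)`, `V = w(·, P_{θ+π/2})`.
Differentiating the tangent line equation twice gives `∇W = -V ∇T` and `V ΔT = -ΔW - 2⟨∇V, ∇T⟩ +
c'|∇T|²`. Since `|∇V|² ≤ |B|²`, the cross term is absorbed by a fraction of `|B|²` and a multiple of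
`|∇T|²`, and `k |∇T|²` pays for all gradient terms (`localLaplacian_exp_angle`). What remains is an
estimate `ΔW ≤ -κ|B|² + Λ|∇W|²`, needed only where `W = c'`.

For parallel mean curvature, `Δw = w (|∇ log w|² - |B|² - crossTrace)` (`localLaplacian_wLocal`),
where the cross trace involves the vectors `v_a` normal to `M` such that the fixed plane is spanned
by the `e_a + v_a`. In an adapted frame the `v_a` are orthogonal, their lengths `λ_a` are the
tangents of the Jordan angles, and `∏ (1 + λ_a²) = w⁻²`. So `w > 1/3` means that this product is
less than 9, and then `|B|² + crossTrace` is positive definite on the subspace `∇w = 0`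
(`gaussForm_pos`). Compactness makes this coercive modulo `|∇w|²` (`exists_gaussForm_bound`).

For minimal submanifolds whose Gauss map has rank at most 2, the second fundamental form is a
traceless form in at most two variables, and its cross trace is a sum of squares
(`crossTrace_nonneg_of_rank_le_two`). The estimate then holds for every `w > 0`, which is why the
disk may shrink to a point. -/

theorem sum_mul_lt_of_prod_lt_nine {X Y Z : ℝ} (hX : 0 ≤ X) (hY : 0 ≤ Y) (hZ : 0 ≤ Z)
    (h : (1 + X) * (1 + Y) * (1 + Z) < 9) : X * Y + Y * Z + Z * X < 4 + X * Y * Z := by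
  by_contra! hq
  have hr : 0 ≤ X * Y * Z := by positivity
  -- Schur's inequality of degree one, in the elementary symmetric functions `p`, `q`, `r`
  -- introduced below.
  have schur : 0 ≤ (X + Y + Z) ^ 3 - 4 * (X + Y + Z) * (X * Y + Y * Z + Z * X)
      + 9 * (X * Y * Z) := by
    wlog hXY : X ≤ Y generalizing X Y
    · have := this hY hX (by linarith) (by linarith) (by linarith) (by linarith)
      linarith
    rcases le_total Z X with hZX | hZX
    · nlinarith [mul_nonneg (sub_nonneg.2 hXY) (sq_nonneg (Y - X)),
        mul_nonneg hZ (mul_nonneg (sub_nonneg.2 hZX) (sub_nonneg.2 (hZX.trans hXY))),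
        mul_nonneg hX (sq_nonneg (Y - X)),
        mul_nonneg (sub_nonneg.2 hXY) (mul_nonneg (sub_nonneg.2 hXY)
          (by linarith : 0 ≤ X + Y - Z))]
    · rcases le_total Z Y with hZY | hZY
      · nlinarith [mul_nonneg hX (mul_nonneg (sub_nonneg.2 hXY) (sub_nonneg.2 hZX)),
          mul_nonneg (sub_nonneg.2 hZY) (mul_nonneg (sub_nonneg.2 hZY)
            (by linarith : 0 ≤ Y + Z - X))]
      · nlinarith [mul_nonneg hX (mul_nonneg (sub_nonneg.2 hXY) (sub_nonneg.2 hZX)),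
          mul_nonneg (sub_nonneg.2 hZY) (mul_nonneg (sub_nonneg.2 hZY)
            (by linarith : 0 ≤ Y + Z - X))]
  obtain ⟨p, hp⟩ : ∃ p, p = X + Y + Z := ⟨_, rfl⟩
  obtain ⟨q, hq'⟩ : ∃ q, q = X * Y + Y * Z + Z * X := ⟨_, rfl⟩
  obtain ⟨r, hr'⟩ : ∃ r, r = X * Y * Z := ⟨_, rfl⟩
  have h3 : 3 * q ≤ p ^ 2 := by
    rw [hp, hq']; nlinarith [sq_nonneg (X - Y), sq_nonneg (Y - Z), sq_nonneg (Z - X)]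
  have h1 : 1 + p + q + r < 9 := by rw [hp, hq', hr']; linarith
  rw [← hp, ← hq', ← hr'] at schur
  rw [← hq', ← hr'] at hq
  rw [← hr'] at hr
  have hp0 : 0 ≤ p := by rw [hp]; positivity
  have hp4 : p < 4 := by linarith
  -- The negated claim is `q ≥ 4 + r`. For small `p` it contradicts `3 q ≤ p²`; for `p ≥ 9/4` Schur
  -- gives `p³ ≥ 16 p + (4 p - 9) r ≥ 16 p`, against `p < 4`. The point `X = Y = 2`, `Z = 0` shows
  -- that 9 is sharp here.
  rcases le_total p (9 / 4) with hc | hc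
  · nlinarith
  · nlinarith [mul_nonneg hp0 (sub_nonneg.2 hq), mul_nonneg hr (sub_nonneg.2 hc),
      mul_pos (by linarith : 0 < p) (mul_pos (sub_pos.2 hp4) (by linarith : 0 < 4 + p))]

/-- The quadratic form attached to three distinct indices. -/
theorem triple_form_nonneg {x y z : ℝ} (h : (1 + x ^ 2) * (1 + y ^ 2) * (1 + z ^ 2) < 9)
    (a b c : ℝ) :
    0 ≤ a ^ 2 + b ^ 2 + c ^ 2 + x * y * a * b + y * z * b * c + x * z * a * c ∧
    (a ^ 2 + b ^ 2 + c ^ 2 + x * y * a * b + y * z * b * c + x * z * a * c = 0 →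
      c = 0) := by
  have key := sum_mul_lt_of_prod_lt_nine (sq_nonneg x) (sq_nonneg y) (sq_nonneg z) h
  have hxy : x ^ 2 * y ^ 2 < 4 := by
    have : (1 + x ^ 2) * (1 + y ^ 2) * (1 + 0) < 9 :=
      lt_of_le_of_lt (by gcongr; exact sq_nonneg z) h
    have := sum_mul_lt_of_prod_lt_nine (sq_nonneg x) (sq_nonneg y) le_rfl this
    linarith
  -- Sylvester's criterion by completing squares: `d` is the second leading minor of the form and
  -- the coefficient of `c ^ 2` in `e` is its determinant, positive by `key`.
  obtain ⟨d, hd⟩ : ∃ d, d = 1 - (x * y / 2) ^ 2 := ⟨_, rfl⟩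
  have hd0 : 0 < d := by rw [hd]; nlinarith
  have e : d * (a ^ 2 + b ^ 2 + c ^ 2 + x * y * a * b + y * z * b * c + x * z * a * c) =
      d * (a + x * y / 2 * b + x * z / 2 * c) ^ 2 +
      (d * b + (y * z / 2 - x * y / 2 * (x * z / 2)) * c) ^ 2 +
      (4 + x ^ 2 * y ^ 2 * z ^ 2 - (x ^ 2 * y ^ 2 + y ^ 2 * z ^ 2 + z ^ 2 * x ^ 2)) / 4 * c ^ 2 := by
    rw [hd]; ring
  have hD : 0 < (4 + x ^ 2 * y ^ 2 * z ^ 2 -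
    (x ^ 2 * y ^ 2 + y ^ 2 * z ^ 2 + z ^ 2 * x ^ 2)) / 4 := by linarith
  have t1 := mul_nonneg hd0.le (sq_nonneg (a + x * y / 2 * b + x * z / 2 * c))
  have t2 := sq_nonneg (d * b + (y * z / 2 - x * y / 2 * (x * z / 2)) * c)
  refine ⟨nonneg_of_mul_nonneg_right (by rw [e]; positivity) hd0, fun h0 => ?_⟩
  rw [h0, mul_zero] at e
  by_contra hc
  have : 0 < c ^ 2 := by positivity
  nlinarith [mul_pos hD this]

/-- Here `x = l_i²` for an index whose coefficient `2 + x - x b` in `group_form_nonneg` fails to be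
positive, `b = μ²`, and `Y` is the sum of the other `l²`. The hypothesis gives `(1 + x)(b - 1) ≥ b +
1`, hence `(1 + b)² (1 + Y) < 9 (b - 1)`. With `Y = 0` this reads `(b - 2)(b - 5) < 0`, and the
maximum of `9 (b - 1) / (b + 1)²`, at `b = 3`, is `9/8`. The constant 0.55 is small enough for the
final estimate there. -/
theorem bad_index_bounds {x b Y : ℝ} (hx0 : 0 ≤ x) (hb0 : 0 ≤ b) (hY0 : 0 ≤ Y)
    (hS1' : 2 + x - x * b ≤ 0) (hpr : (1 + b) * (1 + x) * (1 + Y) < 9) :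
    0 < x ∧ 2 < b ∧ b < 5 ∧ x * b - 2 - x ≤ 0.55 * x ∧ Y ≤ 1 / 8 := by
  have hpr2 : (1 + b) * (1 + x) < 9 := by
    refine lt_of_le_of_lt ?_ hpr
    nlinarith [mul_nonneg hb0 hx0, mul_nonneg (by positivity : 0 ≤ (1 + b) * (1 + x)) hY0]
  have hxpos : 0 < x := by
    rcases hx0.lt_or_eq with h | h
    · exact h
    · rw [← h] at hS1'; linarith
  have hb1 : 2 < b := by nlinarith
  have hb5 : b < 5 := by nlinarith
  have hxb : x * b - 2 - x ≤ 0.55 * x := by nlinarith [sq_nonneg (b - 3.75)]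
  have hx1 : b + 1 ≤ (1 + x) * (b - 1) := by nlinarith
  have hY8 : Y ≤ 1 / 8 := by
    have : (1 + b) * (b + 1) * (1 + Y) ≤ 9 * (b - 1) := by
      calc (1 + b) * (b + 1) * (1 + Y) ≤ (1 + b) * ((1 + x) * (b - 1)) * (1 + Y) := by gcongr
        _ = (1 + b) * (1 + x) * (1 + Y) * (b - 1) := by ring
        _ ≤ _ := by gcongr; linarith
    nlinarith [sq_nonneg (b - 3)]
  exact ⟨hxpos, hb1, hb5, hxb, hY8⟩

theorem one_add_sum_le_prod {ι : Type*} [DecidableEq ι] (s : Finset ι) (f : ι → ℝ)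
    (hf : ∀ i ∈ s, 0 ≤ f i) : 1 + ∑ i ∈ s, f i ≤ ∏ i ∈ s, (1 + f i) := by
  induction s using Finset.induction_on with
  | empty => simp
  | insert a s ha ih =>
    rw [Finset.sum_insert ha, Finset.prod_insert ha]
    have h1 := ih fun i hi => hf i (Finset.mem_insert_of_mem hi)
    have h2 := hf a (Finset.mem_insert_self _ _)
    have h3 : 0 ≤ ∑ i ∈ s, f i :=
      Finset.sum_nonneg fun i hi => hf i (Finset.mem_insert_of_mem hi)
    nlinarith [mul_nonneg h2 h3]

/-- The quadratic form attached to a fixed normal index `k`. -/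
theorem group_form_nonneg {ι : Type*} [DecidableEq ι] (s : Finset ι) (l p q : ι → ℝ) (μ h : ℝ)
    (hprod : (1 + μ ^ 2) * ∏ i ∈ s, (1 + l i ^ 2) < 9) (hD : μ * h + ∑ i ∈ s, l i * q i = 0) :
    0 ≤ (1 + μ ^ 2) * h ^ 2 + ∑ i ∈ s,
      (p i ^ 2 + (2 + l i ^ 2) * q i ^ 2 + 2 * (l i * μ * p i * q i)) ∧
    ((1 + μ ^ 2) * h ^ 2 + ∑ i ∈ s,
      (p i ^ 2 + (2 + l i ^ 2) * q i ^ 2 + 2 * (l i * μ * p i * q i)) = 0 →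
      h = 0 ∧ ∀ i ∈ s, p i = 0 ∧ q i = 0) := by
  -- `S i` is the coefficient left on `q i ^ 2` after the square in `p i` is completed.
  set S : ι → ℝ := fun i => 2 + l i ^ 2 - l i ^ 2 * μ ^ 2 with hS
  have e : (1 + μ ^ 2) * h ^ 2 + ∑ i ∈ s,
      (p i ^ 2 + (2 + l i ^ 2) * q i ^ 2 + 2 * (l i * μ * p i * q i)) =
      ((1 + μ ^ 2) * h ^ 2 + ∑ i ∈ s, S i * q i ^ 2) + ∑ i ∈ s, (p i + l i * μ * q i) ^ 2 := by
    rw [add_assoc, ← Finset.sum_add_distrib]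
    congr 1
    refine Finset.sum_congr rfl fun i _ => ?_
    simp only [hS]; ring
  have hP : 0 ≤ ∑ i ∈ s, (p i + l i * μ * q i) ^ 2 := Finset.sum_nonneg fun i _ => sq_nonneg _
  suffices hF : 0 ≤ (1 + μ ^ 2) * h ^ 2 + ∑ i ∈ s, S i * q i ^ 2 ∧
      ((1 + μ ^ 2) * h ^ 2 + ∑ i ∈ s, S i * q i ^ 2 ≤ 0 → h = 0 ∧ ∀ i ∈ s, q i = 0) by
    rw [e]
    refine ⟨add_nonneg hF.1 hP, fun h0 => ?_⟩
    obtain ⟨a, b⟩ := hF.2 (by linarith)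
    refine ⟨a, fun i hi => ⟨?_, b i hi⟩⟩
    have := (Finset.sum_eq_zero_iff_of_nonneg fun i _ => sq_nonneg (p i + l i * μ * q i)).1
      (le_antisymm (by linarith [hF.1]) hP) i hi
    simpa [b i hi] using this
  by_cases hall : ∀ i ∈ s, 0 < S i
  · have hn : ∀ i ∈ s, 0 ≤ S i * q i ^ 2 := fun i hi => mul_nonneg (hall i hi).le (sq_nonneg _)
    have hs := Finset.sum_nonneg hn
    have hh : 0 ≤ (1 + μ ^ 2) * h ^ 2 := by positivity
    refine ⟨by positivity, fun h0 => ⟨?_, fun i hi => ?_⟩⟩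
    · have h1 : (1 + μ ^ 2) * h ^ 2 = 0 := by linarith
      have : 1 + μ ^ 2 ≠ 0 := by positivity
      simpa [this] using h1
    · have := (Finset.sum_eq_zero_iff_of_nonneg hn).1 (by linarith) i hi
      simpa [(hall i hi).ne'] using this
  -- One coefficient may be nonpositive. Then `bad_index_bounds` keeps all the others at least
  -- `3/2`, and the linear constraint `hD` expresses the bad variable through `h` and the remaining
  -- `q i`.
  · push Not at hall
    obtain ⟨i₁, hi₁, hS1⟩ := hall
    rw [← Finset.mul_prod_erase s _ hi₁] at hprod
    rw [← Finset.add_sum_erase s _ hi₁] at hD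
    rw [← Finset.add_sum_erase s _ hi₁]
    set s' := s.erase i₁
    obtain ⟨x, hx⟩ : ∃ x, x = l i₁ ^ 2 := ⟨_, rfl⟩
    obtain ⟨b, hb⟩ : ∃ b, b = μ ^ 2 := ⟨_, rfl⟩
    have hx0 : 0 ≤ x := hx ▸ sq_nonneg _
    have hb0 : 0 ≤ b := hb ▸ sq_nonneg _
    have hS1' : 2 + x - x * b ≤ 0 := by simpa only [hS, ← hx, ← hb] using hS1
    obtain ⟨Y, hY⟩ : ∃ Y, Y = ∑ i ∈ s', l i ^ 2 := ⟨_, rfl⟩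
    have hY0 : 0 ≤ Y := hY ▸ Finset.sum_nonneg fun i _ => sq_nonneg _
    have hYp : 1 + Y ≤ ∏ i ∈ s', (1 + l i ^ 2) := by
      rw [hY]; exact one_add_sum_le_prod _ _ fun i _ => sq_nonneg _
    have hpr : (1 + b) * (1 + x) * (1 + Y) < 9 := by
      refine lt_of_le_of_lt ?_ hprod
      rw [← hx, ← hb, ← mul_assoc]
      gcongr
    obtain ⟨hxpos, hb1, hb5, hxb, hY8⟩ := bad_index_bounds hx0 hb0 hY0 hS1' hpr
    obtain ⟨Z, hZ⟩ : ∃ Z, Z = ∑ i ∈ s', l i * q i := ⟨_, rfl⟩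
    obtain ⟨A, hA⟩ : ∃ A, A = ∑ i ∈ s', q i ^ 2 := ⟨_, rfl⟩
    have hA0 : 0 ≤ A := hA ▸ Finset.sum_nonneg fun i _ => sq_nonneg _
    have hcs : Z ^ 2 ≤ Y * A := by
      rw [hZ, hY, hA]; exact Finset.sum_mul_sq_le_sq_mul_sq _ _ _
    have hSA : 3 / 2 * A ≤ ∑ i ∈ s', S i * q i ^ 2 := by
      rw [hA, Finset.mul_sum]
      refine Finset.sum_le_sum fun i hi => ?_
      have hi8 : l i ^ 2 ≤ 1 / 8 :=
        (Finset.single_le_sum (f := fun i => l i ^ 2) (fun i _ => sq_nonneg _) hi).trans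
          (hY ▸ hY8)
      gcongr
      simp only [hS, ← hb]
      nlinarith [sq_nonneg (l i)]
    rw [← hZ] at hD
    have hq1 : x * q i₁ ^ 2 = (μ * h + Z) ^ 2 := by
      rw [show μ * h + Z = -(l i₁ * q i₁) by linarith, hx]; ring
    have hSi : -(0.55 * (x * q i₁ ^ 2)) ≤ S i₁ * q i₁ ^ 2 := by
      have : S i₁ = 2 + x - x * b := by simp only [hS, hx, hb]
      rw [this]
      nlinarith [mul_nonneg (by linarith : 0 ≤ 0.55 * x + (2 + x - x * b)) (sq_nonneg (q i₁))]
    have hmu : (μ * h + Z) ^ 2 ≤ 2 * (b * h ^ 2) + 2 * Z ^ 2 := by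
      rw [hb]; nlinarith [sq_nonneg (μ * h - Z)]
    have hYA : Y * A ≤ 1 / 8 * A := by gcongr
    have hbh : b * h ^ 2 ≤ 5 * h ^ 2 := by gcongr
    -- The bad term costs at most `0.55 (2 b h² + 2 Z²)`. Against `(1 + b) h²` this leaves `(1 - 0.1
    -- b) h² ≥ h²/2` because `b < 5`, and `Z² ≤ A/8` is paid from `3A/2`.
    have hlow : 1 / 2 * h ^ 2 + A ≤
        (1 + μ ^ 2) * h ^ 2 + (S i₁ * q i₁ ^ 2 + ∑ i ∈ s', S i * q i ^ 2) := by
      rw [← hb]; linarith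
    have hh := sq_nonneg h
    refine ⟨by linarith, fun h0 => ?_⟩
    have hh0 : h = 0 := by
      have : h ^ 2 = 0 := by linarith
      simpa using this
    have hA00 : A = 0 := by linarith
    have hq : ∀ i ∈ s', q i = 0 := fun i hi => by
      rw [hA, Finset.sum_eq_zero_iff_of_nonneg fun i _ => sq_nonneg _] at hA00
      simpa using hA00 i hi
    refine ⟨hh0, fun i hi => ?_⟩
    by_cases hii : i = i₁
    · have : Z = 0 := by rw [hZ]; exact Finset.sum_eq_zero fun i hi => by rw [hq i hi, mul_zero]
      rw [this, hh0] at hq1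
      simp [hxpos.ne'] at hq1
      rw [hii, hq1]
    · exact hq i (Finset.mem_erase.2 ⟨hii, hi⟩)

end GaussImage

/-! ### Positivity and coercivity of the quadratic form on the constrained subspace. -/

namespace GaussImage

/-- Triples are sorted by their coincidences; those with exactly two equal entries are grouped by
the entry `k` that occurs once. This grouping decouples the quadratic form into the blocks treated
by `group_form_nonneg` and `triple_form_nonneg`. -/
theorem sum_triple_split {ι : Type*} [Fintype ι] [DecidableEq ι] (T : ι → ι → ι → ℝ) :
    ∑ i, ∑ j, ∑ k, T i j k =
      ∑ k, (T k k k + ∑ i ∈ Finset.univ.erase k, (T i i k + T i k i + T k i i)) +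
      ∑ i, ∑ j, ∑ k, if i ≠ j ∧ j ≠ k ∧ i ≠ k then T i j k else 0 := by
  have hsplit : ∀ i j k, T i j k = (if i = j ∧ j = k then T i j k else 0) +
      (if i = j ∧ j ≠ k then T i j k else 0) + (if i = k ∧ j ≠ k then T i j k else 0) +
      (if j = k ∧ i ≠ k then T i j k else 0) +
      (if i ≠ j ∧ j ≠ k ∧ i ≠ k then T i j k else 0) := by
    intro i j k
    by_cases h1 : i = j <;> by_cases h2 : j = k <;> by_cases h3 : i = k <;> simp_all
  have e1 : ∑ i, ∑ j, ∑ k, (if i = j ∧ j = k then T i j k else 0) = ∑ k, T k k k := by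
    simp [ite_and]
  have e2 : ∑ i, ∑ j, ∑ k, (if i = j ∧ j ≠ k then T i j k else 0) =
      ∑ k, ∑ i, if i ≠ k then T i i k else 0 := by
    conv_rhs => rw [Finset.sum_comm]
    refine Finset.sum_congr rfl fun i _ => ?_
    rw [Finset.sum_comm]
    simp [ite_and]
  have e3 : ∑ i, ∑ j, ∑ k, (if i = k ∧ j ≠ k then T i j k else 0) =
      ∑ k, ∑ i, if i ≠ k then T k i k else 0 := by
    refine Finset.sum_congr rfl fun i _ => ?_
    refine Finset.sum_congr rfl fun j _ => ?_
    simp [ite_and]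
  have e4 : ∑ i, ∑ j, ∑ k, (if j = k ∧ i ≠ k then T i j k else 0) =
      ∑ k, ∑ i, if i ≠ k then T i k k else 0 := by
    rw [Finset.sum_comm]
    refine Finset.sum_congr rfl fun j _ => ?_
    refine Finset.sum_congr rfl fun i _ => ?_
    simp [ite_and]
  have e5 : ∀ f : ι → ι → ℝ, ∑ k, ∑ i ∈ Finset.univ.erase k, f k i =
      ∑ k, ∑ i, if i ≠ k then f k i else 0 := by
    intro f
    refine Finset.sum_congr rfl fun k _ => ?_
    rw [← Finset.sum_filter, Finset.filter_ne']
  have e6 : ∑ k, ∑ i, (if i ≠ k then T i k i else 0) = ∑ k, ∑ i, if i ≠ k then T k i k else 0 := by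
    rw [Finset.sum_comm]
    simp only [ne_comm]
  have e7 : ∑ k, ∑ i, (if i ≠ k then T k i i else 0) = ∑ k, ∑ i, if i ≠ k then T i k k else 0 := by
    rw [Finset.sum_comm]
    simp only [ne_comm]
  calc _ = _ := Finset.sum_congr rfl fun i _ => Finset.sum_congr rfl fun j _ =>
        Finset.sum_congr rfl fun k _ => hsplit i j k
    _ = _ := by
      simp only [Finset.sum_add_distrib]
      rw [e1, e2, e3, e4, e5 (fun k i => T i i k), e5 (fun k i => T i k i),
        e5 (fun k i => T k i i), e6, e7]
      ring

section

variable {n : ℕ}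

/-- The quadratic form `∑ (H_kij² + l_j l_k H_kij H_jik)`. -/
def gaussForm (l : Fin n → ℝ) (H : Fin n → Fin n → Fin n → ℝ) : ℝ :=
  ∑ i, ∑ j, ∑ k, (H k i j ^ 2 + l j * l k * H k i j * H j i k)

/-- The form is block diagonal. The block of `k` contains `H k k k`, `H k i i`, `H i i k` and is
tied to exactly one constraint, `hD k`; three distinct indices give an unconstrained block in three
variables. Each block is definite. -/
theorem gaussForm_pos {l : Fin n → ℝ} {H : Fin n → Fin n → Fin n → ℝ}
    (hl : ∏ i, (1 + l i ^ 2) < 9) (hH : ∀ k i j, H k i j = H k j i)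
    (hD : ∀ i, ∑ j, l j * H j i j = 0) (h0 : H ≠ 0) : 0 < gaussForm l H := by
  obtain ⟨T, hT⟩ : ∃ T : Fin n → Fin n → Fin n → ℝ,
    T = fun i j k => H k i j ^ 2 + l j * l k * H k i j * H j i k := ⟨_, rfl⟩
  have hTa : ∀ i j k, T i j k = H k i j ^ 2 + l j * l k * H k i j * H j i k := fun i j k => by
    rw [hT]
  have hprod3 : ∀ i j k, i ≠ j → j ≠ k → i ≠ k →
      (1 + l i ^ 2) * (1 + l j ^ 2) * (1 + l k ^ 2) < 9 := by
    intro i j k hij hjk hik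
    refine lt_of_le_of_lt ?_ hl
    rw [← Finset.prod_mul_prod_compl {i, j, k}, Finset.prod_insert (by simp [hij, hik]),
      Finset.prod_insert (by simp [hjk]), Finset.prod_singleton, ← mul_assoc]
    refine le_mul_of_one_le_right (by positivity) ?_
    refine le_trans ?_ (one_add_sum_le_prod _ _ fun i _ => sq_nonneg (l i))
    exact le_add_of_nonneg_right (Finset.sum_nonneg fun i _ => sq_nonneg _)
  have hcyc : ∀ F : Fin n → Fin n → Fin n → ℝ,
      ∑ i, ∑ j, ∑ k, F j k i = ∑ i, ∑ j, ∑ k, F i j k := by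
    intro F
    rw [Finset.sum_comm]
    exact Finset.sum_congr rfl fun j _ => Finset.sum_comm
  obtain ⟨U, hU⟩ : ∃ U : Fin n → Fin n → Fin n → ℝ,
    ∀ i j k, U i j k = if i ≠ j ∧ j ≠ k ∧ i ≠ k then T i j k else 0 :=
    ⟨fun i j k => if i ≠ j ∧ j ≠ k ∧ i ≠ k then T i j k else 0, fun _ _ _ => rfl⟩
  -- Averaging over cyclic rotations brings together the three components `H i j k`, `H j i k`, `H k
  -- i j` that interact.
  have hU3 : 3 * ∑ i, ∑ j, ∑ k, U i j k =
      ∑ i, ∑ j, ∑ k, (U i j k + U j k i + U k i j) := by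
    simp only [Finset.sum_add_distrib]
    rw [hcyc U, hcyc (fun i j k => U j k i), hcyc U]
    ring
  have hUpos : ∀ i j k, 0 ≤ U i j k + U j k i + U k i j ∧
      (U i j k + U j k i + U k i j = 0 → i ≠ j ∧ j ≠ k ∧ i ≠ k → H k i j = 0) := by
    intro i j k
    by_cases hd : i ≠ j ∧ j ≠ k ∧ i ≠ k
    · have e : U i j k + U j k i + U k i j = H i j k ^ 2 + H j i k ^ 2 + H k i j ^ 2 +
          l i * l j * H i j k * H j i k + l j * l k * H j i k * H k i j +
          l i * l k * H i j k * H k i j := by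
        rw [hU, hU, hU, if_pos hd, if_pos ⟨hd.2.1, hd.2.2.symm, hd.1.symm⟩,
          if_pos ⟨hd.2.2.symm, hd.1, hd.2.1.symm⟩, hTa, hTa, hTa, hH k j i, hH j k i, hH i k j]
        ring
      rw [e]
      have := triple_form_nonneg (hprod3 i j k hd.1 hd.2.1 hd.2.2) (H i j k) (H j i k) (H k i j)
      exact ⟨this.1, fun h _ => this.2 h⟩
    · refine ⟨?_, fun _ h => absurd h hd⟩
      rw [hU, hU, hU, if_neg hd, if_neg (by tauto), if_neg (by tauto)]
      simp
  have hG : ∀ k, 0 ≤ T k k k + ∑ i ∈ Finset.univ.erase k, (T i i k + T i k i + T k i i) ∧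
      (T k k k + ∑ i ∈ Finset.univ.erase k, (T i i k + T i k i + T k i i) = 0 →
        H k k k = 0 ∧ ∀ i ∈ Finset.univ.erase k, H k i i = 0 ∧ H i i k = 0) := by
    intro k
    have e : T k k k + ∑ i ∈ Finset.univ.erase k, (T i i k + T i k i + T k i i) =
        (1 + l k ^ 2) * H k k k ^ 2 + ∑ i ∈ Finset.univ.erase k, (H k i i ^ 2 +
          (2 + l i ^ 2) * H i i k ^ 2 + 2 * (l i * l k * H k i i * H i i k)) := by
      congr 1
      · rw [hTa]; ring
      · refine Finset.sum_congr rfl fun i _ => ?_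
        rw [hTa, hTa, hTa, hH i k i]; ring
    rw [e]
    refine group_form_nonneg _ l (fun i => H k i i) (fun i => H i i k) (l k) (H k k k) ?_ ?_
    · rwa [Finset.mul_prod_erase Finset.univ (fun i => 1 + l i ^ 2) (Finset.mem_univ k)]
    · rw [← hD k, ← Finset.add_sum_erase Finset.univ _ (Finset.mem_univ k)]
      congr 1
      exact Finset.sum_congr rfl fun i _ => by rw [hH i k i]
  have hsum : gaussForm l H = ∑ k, (T k k k +
      ∑ i ∈ Finset.univ.erase k, (T i i k + T i k i + T k i i)) + ∑ i, ∑ j, ∑ k, U i j k := by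
    rw [show gaussForm l H = ∑ i, ∑ j, ∑ k, T i j k by simp only [gaussForm, hTa],
      sum_triple_split T]
    simp only [hU]
  have n1 := Finset.sum_nonneg fun k (_ : k ∈ Finset.univ) => (hG k).1
  have n4 : ∀ i j, 0 ≤ ∑ k, (U i j k + U j k i + U k i j) := fun i j =>
    Finset.sum_nonneg fun k _ => (hUpos i j k).1
  have n3 : ∀ i, 0 ≤ ∑ j, ∑ k, (U i j k + U j k i + U k i j) := fun i =>
    Finset.sum_nonneg fun j _ => n4 i j
  have n2 := Finset.sum_nonneg fun i (_ : i ∈ Finset.univ) => n3 i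
  by_contra! hle
  have z1 := (Finset.sum_eq_zero_iff_of_nonneg fun k (_ : k ∈ Finset.univ) => (hG k).1).1
    (by linarith)
  have z2 := (Finset.sum_eq_zero_iff_of_nonneg fun i (_ : i ∈ Finset.univ) => n3 i).1
    (by linarith)
  apply h0
  funext k i j
  by_cases hij : i = j
  · subst hij
    by_cases hik : i = k
    · subst hik
      exact ((hG i).2 (z1 i (Finset.mem_univ _))).1
    · exact (((hG k).2 (z1 k (Finset.mem_univ _))).2 i (by simp [hik])).1
  · by_cases hik : i = k
    · subst hik
      exact (((hG j).2 (z1 j (Finset.mem_univ _))).2 i (by simp [hij])).2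
    · by_cases hjk : j = k
      · subst hjk
        rw [hH]
        exact (((hG i).2 (z1 i (Finset.mem_univ _))).2 j (by simp [Ne.symm hij])).2
      · have z3 := (Finset.sum_eq_zero_iff_of_nonneg fun j _ => n4 i j).1
          (z2 i (Finset.mem_univ _)) j (Finset.mem_univ _)
        have z4 := (Finset.sum_eq_zero_iff_of_nonneg fun k _ => (hUpos i j k).1).1 z3 k
          (Finset.mem_univ _)
        exact (hUpos i j k).2 z4 ⟨hij, hjk, hik⟩

/-- Uniform coercivity of `gaussForm` modulo its linear constraint. -/
theorem exists_gaussForm_bound (n : ℕ) {R : ℝ} (hR : R < 9) :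
    ∃ c C : ℝ, 0 < c ∧ c ≤ 1 ∧ 0 ≤ C ∧ ∀ (l : Fin n → ℝ) (H : Fin n → Fin n → Fin n → ℝ),
      ∏ i, (1 + l i ^ 2) ≤ R → (∀ k i j, H k i j = H k j i) →
      c * ∑ i, ∑ j, ∑ k, H k i j ^ 2 ≤
        gaussForm l H + C * ∑ i, (∑ j, l j * H j i j) ^ 2 := by
  let N : (Fin n → ℝ) × (Fin n → Fin n → Fin n → ℝ) → ℝ := fun x => ∑ i, ∑ j, ∑ k, x.2 k i j ^ 2
  let D : (Fin n → ℝ) × (Fin n → Fin n → Fin n → ℝ) → ℝ := fun x => ∑ i, (∑ j, x.1 j * x.2 j i j) ^ 2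
  let G : (Fin n → ℝ) × (Fin n → Fin n → Fin n → ℝ) → ℝ := fun x => gaussForm x.1 x.2
  have cN : Continuous N := by fun_prop
  have cD : Continuous D := by fun_prop
  have cG : Continuous G := by unfold G gaussForm; fun_prop
  let S : Set ((Fin n → ℝ) × (Fin n → Fin n → Fin n → ℝ)) := {x | ∏ i, (1 + x.1 i ^ 2) ≤ R ∧ (∀ k i j, x.2 k i j = x.2 k j i) ∧ N x = 1}
  have hS : IsCompact S := by
    have hclosed : IsClosed S := by
      have c0 : Continuous fun x : (Fin n → ℝ) × (Fin n → Fin n → Fin n → ℝ) =>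
        ∏ i, (1 + x.1 i ^ 2) := by fun_prop
      have e : S = {x | ∏ i, (1 + x.1 i ^ 2) ≤ R} ∩
          ((⋂ k, ⋂ i, ⋂ j, {x | x.2 k i j = x.2 k j i}) ∩ {x | N x = 1}) := by
        ext x; simp [S]
      rw [e]
      exact (isClosed_le c0 continuous_const).inter (IsClosed.inter
        (isClosed_iInter fun k => isClosed_iInter fun i => isClosed_iInter fun j =>
          isClosed_eq (by fun_prop) (by fun_prop)) (isClosed_eq cN continuous_const))
    refine IsCompact.of_isClosed_subset ((isCompact_univ_pi fun _ : Fin n =>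
      isCompact_Icc (a := -3) (b := (3 : ℝ))).prod
      (isCompact_univ_pi fun _ : Fin n => isCompact_univ_pi fun _ : Fin n =>
        isCompact_univ_pi fun _ : Fin n => isCompact_Icc (a := -1) (b := (1 : ℝ)))) hclosed ?_
    rintro ⟨l, H⟩ ⟨h1, -, h3⟩
    simp only [Set.mem_prod, Set.mem_pi, Set.mem_univ, true_imp_iff, Set.mem_Icc]
    refine ⟨fun i => abs_le.1 ?_, fun k i j => abs_le.1 ?_⟩
    · have : l i ^ 2 ≤ 9 := by
        have := one_add_sum_le_prod Finset.univ (fun i => l i ^ 2) fun i _ => sq_nonneg _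
        have h' := Finset.single_le_sum (f := fun i => l i ^ 2) (fun i _ => sq_nonneg _)
          (Finset.mem_univ i)
        simp only at h1 this h'
        linarith
      exact abs_le_of_sq_le_sq (by linarith) (by norm_num)
    · have : H k i j ^ 2 ≤ 1 := by
        rw [← h3]
        calc H k i j ^ 2 ≤ ∑ k, H k i j ^ 2 :=
              Finset.single_le_sum (f := fun k => H k i j ^ 2) (fun _ _ => sq_nonneg _)
                (Finset.mem_univ k)
          _ ≤ ∑ j, ∑ k, H k i j ^ 2 :=
              Finset.single_le_sum (f := fun j => ∑ k, H k i j ^ 2)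
                (fun _ _ => Finset.sum_nonneg fun _ _ => sq_nonneg _) (Finset.mem_univ j)
          _ ≤ _ := Finset.single_le_sum (f := fun i => ∑ j, ∑ k, H k i j ^ 2)
                (fun _ _ => Finset.sum_nonneg fun _ _ => Finset.sum_nonneg fun _ _ => sq_nonneg _)
                (Finset.mem_univ i)
      exact abs_le_of_sq_le_sq (by linarith) (by norm_num)
  have hDn : ∀ x, 0 ≤ D x := fun x => Finset.sum_nonneg fun _ _ => sq_nonneg _
  have hpos : ∀ x ∈ S, D x = 0 → 0 < G x := by
    rintro ⟨l, H⟩ ⟨h1, h2, h3⟩ hd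
    refine gaussForm_pos (h1.trans_lt hR) h2 (fun i => ?_) ?_
    · have := (Finset.sum_eq_zero_iff_of_nonneg fun i _ => sq_nonneg _).1 hd i (Finset.mem_univ i)
      simpa using this
    · rintro rfl
      simp [N] at h3
  obtain ⟨C, hC0, hC⟩ : ∃ C : ℝ, 0 ≤ C ∧ ∀ x ∈ S, 0 < G x + C * D x := by
    -- On this compact set `D` is positive by `hpos`, so it has a positive minimum, and a large
    -- multiple of it outweighs the minimum of `G`.
    have hS' : IsCompact (S ∩ {x | G x ≤ 0}) :=
      hS.inter_right (isClosed_le cG continuous_const)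
    rcases (S ∩ {x | G x ≤ 0}).eq_empty_or_nonempty with he | hne
    · refine ⟨0, le_rfl, fun x hx => ?_⟩
      by_contra! h
      have : x ∈ S ∩ {x | G x ≤ 0} := ⟨hx, by simpa using h⟩
      rw [he] at this
      exact this
    obtain ⟨x₀, hx₀, hmin⟩ := hS'.exists_isMinOn hne cD.continuousOn
    obtain ⟨x₁, hx₁, hmin'⟩ := hS'.exists_isMinOn hne cG.continuousOn
    have hd : 0 < D x₀ := lt_of_le_of_ne (hDn _) fun h =>
      absurd (hpos x₀ hx₀.1 h.symm) (not_lt.2 hx₀.2)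
    have hg : G x₁ ≤ 0 := hx₁.2
    refine ⟨(1 - G x₁) / D x₀, div_nonneg (by linarith) hd.le, fun x hx => ?_⟩
    by_cases h : G x ≤ 0
    · have a1 : D x₀ ≤ D x := hmin ⟨hx, h⟩
      have a2 : G x₁ ≤ G x := hmin' ⟨hx, h⟩
      have : 1 - G x₁ ≤ (1 - G x₁) / D x₀ * D x := by
        rw [div_mul_eq_mul_div, le_div_iff₀ hd]
        gcongr
        linarith
      linarith
    · have : 0 ≤ (1 - G x₁) / D x₀ * D x := mul_nonneg (div_nonneg (by linarith) hd.le) (hDn x)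
      push Not at h
      linarith
  obtain ⟨c, hc0, hc1, hc⟩ : ∃ c : ℝ, 0 < c ∧ c ≤ 1 ∧ ∀ x ∈ S, c ≤ G x + C * D x := by
    rcases S.eq_empty_or_nonempty with he | hne
    · exact ⟨1, one_pos, le_rfl, by simp [he]⟩
    obtain ⟨x₀, hx₀, hmin⟩ := hS.exists_isMinOn hne
      (f := fun x => G x + C * D x) (cG.add (continuous_const.mul cD)).continuousOn
    exact ⟨min 1 (G x₀ + C * D x₀), lt_min one_pos (hC x₀ hx₀), min_le_left _ _,
      fun x hx => (min_le_right _ _).trans (hmin hx)⟩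
  refine ⟨c, C, hc0, hc1, hC0, fun l H h1 h2 => ?_⟩
  have hN0 : 0 ≤ N (l, H) := Finset.sum_nonneg fun _ _ => Finset.sum_nonneg fun _ _ =>
    Finset.sum_nonneg fun _ _ => sq_nonneg _
  rcases hN0.eq_or_lt with hN | hN
  · have hH0 : ∀ k i j, H k i j = 0 := by
      intro k i j
      have := (Finset.sum_eq_zero_iff_of_nonneg (fun _ _ => Finset.sum_nonneg fun _ _ =>
        Finset.sum_nonneg fun _ _ => sq_nonneg _)).1 hN.symm i (Finset.mem_univ i)
      have := (Finset.sum_eq_zero_iff_of_nonneg (fun _ _ =>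
        Finset.sum_nonneg fun _ _ => sq_nonneg _)).1 this j (Finset.mem_univ j)
      have := (Finset.sum_eq_zero_iff_of_nonneg (fun _ _ => sq_nonneg _)).1 this k
        (Finset.mem_univ k)
      simpa using this
    simp [gaussForm, hH0]
  -- All three functions are quadratic in `H` for fixed `l`, so normalizing to `N = 1` loses
  -- nothing.
  · have hr : 0 < Real.sqrt (N (l, H)) := Real.sqrt_pos.2 hN
    obtain ⟨r, hr'⟩ : ∃ r, r = (Real.sqrt (N (l, H)))⁻¹ := ⟨_, rfl⟩
    have hr2 : r ^ 2 * N (l, H) = 1 := by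
      rw [hr', inv_pow, Real.sq_sqrt hN0]; exact inv_mul_cancel₀ hN.ne'
    have eN : N (l, r • H) = r ^ 2 * N (l, H) := by
      simp only [N, Pi.smul_apply, smul_eq_mul, mul_pow, Finset.mul_sum]
    have eD : D (l, r • H) = r ^ 2 * D (l, H) := by
      simp only [D, Pi.smul_apply, smul_eq_mul]
      rw [Finset.mul_sum]
      refine Finset.sum_congr rfl fun i _ => ?_
      rw [← mul_pow, Finset.mul_sum]
      congr 1
      exact Finset.sum_congr rfl fun j _ => by ring
    have eG : G (l, r • H) = r ^ 2 * G (l, H) := by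
      simp only [G, gaussForm, Pi.smul_apply, smul_eq_mul, Finset.mul_sum]
      exact Finset.sum_congr rfl fun i _ => Finset.sum_congr rfl fun j _ =>
        Finset.sum_congr rfl fun k _ => by ring
    have := hc (l, r • H) ⟨h1, fun k i j => by simp [h2 k i j], by rw [eN, hr2]⟩
    rw [eD, eG] at this
    have h3 : c * N (l, H) * r ^ 2 ≤ (G (l, H) + C * D (l, H)) * r ^ 2 := by
      calc c * N (l, H) * r ^ 2 = c * (r ^ 2 * N (l, H)) := by ring
        _ = c := by rw [hr2, mul_one]
        _ ≤ _ := this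
        _ = _ := by ring
    exact le_of_mul_le_mul_right h3 (by rw [hr']; positivity)

end

end GaussImage

/-! ### The cross trace of a vector-valued second fundamental form. -/

namespace GaussImage

section

variable {n : ℕ} {V : Type*} [NormedAddCommGroup V] [InnerProductSpace ℝ V]

/-- The cubic trace `∑ ⟨h_ca, v_b⟩ ⟨h_cb, v_a⟩`. -/
def crossTrace (h : Fin n → Fin n → V) (v : Fin n → V) : ℝ :=
  ∑ c, ∑ a, ∑ b, inner ℝ (h c a) (v b) * inner ℝ (h c b) (v a)

/-- Bessel's inequality in a form that admits zero vectors, which occur when a Jordan angle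
vanishes. -/
theorem sum_sq_inner_le {ι : Type*} [Fintype ι] {ν : ι → V} (h1 : ∀ k, ‖ν k‖ ≤ 1)
    (h2 : Pairwise fun i j => inner ℝ (ν i) (ν j) = 0) (x : V) :
    ∑ k, inner ℝ x (ν k) ^ 2 ≤ ‖x‖ ^ 2 := by
  classical
  have hy : ‖∑ k, inner ℝ x (ν k) • ν k‖ ^ 2 = ∑ k, inner ℝ x (ν k) ^ 2 * ‖ν k‖ ^ 2 := by
    rw [← real_inner_self_eq_norm_sq, sum_inner]
    refine Finset.sum_congr rfl fun k _ => ?_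
    rw [inner_sum, Finset.sum_eq_single k]
    · rw [inner_smul_left, inner_smul_right, real_inner_self_eq_norm_sq]
      simp only [conj_trivial]; ring
    · intro j _ hj
      rw [inner_smul_left, inner_smul_right, h2 hj.symm, mul_zero, mul_zero]
    · simp
  have hle : ∑ k, inner ℝ x (ν k) ^ 2 * ‖ν k‖ ^ 2 ≤ ∑ k, inner ℝ x (ν k) ^ 2 :=
    Finset.sum_le_sum fun k _ => mul_le_of_le_one_right (sq_nonneg _)
      (pow_le_one₀ (norm_nonneg _) (h1 k))
  have h0 := sq_nonneg ‖x - ∑ k, inner ℝ x (ν k) • ν k‖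
  rw [norm_sub_sq_real, hy, inner_sum] at h0
  simp only [inner_smul_right, ← sq] at h0
  linarith

/-- The cross trace and the constraint only see the components of `h` along the directions of the `v
i`, to which `exists_gaussForm_bound` applies with `l i = ‖v i‖`. The remaining part of `‖h‖²`
enters with coefficient one, and `c ≤ 1` allows it to be added back. -/
theorem exists_crossTrace_bound (n : ℕ) {R : ℝ} (hR : R < 9) :
    ∃ c C : ℝ, 0 < c ∧ 0 ≤ C ∧ ∀ {V : Type} [NormedAddCommGroup V] [InnerProductSpace ℝ V]
      (v : Fin n → V) (h : Fin n → Fin n → V),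
      (Pairwise fun i j => inner ℝ (v i) (v j) = 0) → ∏ i, (1 + ‖v i‖ ^ 2) ≤ R →
      (∀ i j, h i j = h j i) →
      c * ∑ i, ∑ j, ‖h i j‖ ^ 2 ≤ ∑ i, ∑ j, ‖h i j‖ ^ 2 + crossTrace h v +
        C * ∑ i, (∑ j, inner ℝ (h i j) (v j)) ^ 2 := by
  obtain ⟨c, C, hc, hc1, hC, key⟩ := exists_gaussForm_bound n hR
  refine ⟨c, C, hc, hC, ?_⟩
  intro V _ _ v h hv hp hh
  -- As `0⁻¹ = 0`, the direction of a zero vector is the zero vector.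
  obtain ⟨ν, hν⟩ : ∃ ν : Fin n → V, ∀ k, ν k = (‖v k‖)⁻¹ • v k := ⟨_, fun _ => rfl⟩
  have hlν : ∀ k, v k = ‖v k‖ • ν k := by
    intro k
    rcases eq_or_ne (v k) 0 with h0 | h0
    · simp [h0]
    · rw [hν, smul_smul, mul_inv_cancel₀ (norm_ne_zero_iff.2 h0), one_smul]
  have hν1 : ∀ k, ‖ν k‖ ≤ 1 := by
    intro k
    rw [hν, norm_smul, norm_inv, norm_norm]
    exact inv_mul_le_one
  have hν2 : Pairwise fun i j => inner ℝ (ν i) (ν j) = 0 := by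
    intro i j hij
    simp only [hν, inner_smul_left, inner_smul_right, hv hij, mul_zero]
  have hk := key (fun i => ‖v i‖) (fun k i j => inner ℝ (h i j) (ν k)) hp
    (fun k i j => by rw [hh])
  have hin : ∀ x k, inner ℝ x (v k) = ‖v k‖ * inner ℝ x (ν k) := fun x k => by
    conv_lhs => rw [hlν k, inner_smul_right]
  have e1 : gaussForm (fun i => ‖v i‖) (fun k i j => inner ℝ (h i j) (ν k)) =
      ∑ i, ∑ j, ∑ k, inner ℝ (h i j) (ν k) ^ 2 + crossTrace h v := by
    simp only [gaussForm, crossTrace, hin, ← Finset.sum_add_distrib]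
    exact Finset.sum_congr rfl fun i _ => Finset.sum_congr rfl fun j _ =>
      Finset.sum_congr rfl fun k _ => by ring
  have e2 : ∑ i, ∑ j, ∑ k, inner ℝ (h i j) (ν k) ^ 2 ≤ ∑ i, ∑ j, ‖h i j‖ ^ 2 :=
    Finset.sum_le_sum fun i _ => Finset.sum_le_sum fun j _ => sum_sq_inner_le hν1 hν2 _
  rw [e1] at hk
  simp only [← hin] at hk
  nlinarith [mul_nonneg (sub_nonneg.2 hc1) (sub_nonneg.2 e2)]

/-- Since the rows of `f` are orthonormal, the cross trace equals that of the small form `U` against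
the vectors `A k = ∑ f k b • v b`; this leaves an identity in dimension at most two. -/
theorem crossTrace_nonneg_of_decomp {d : ℕ} (hd : d ≤ 2) (f : Fin d → Fin n → ℝ)
    (hf : ∀ i j, ∑ c, f i c * f j c = if i = j then 1 else 0) (U : Fin d → Fin d → V)
    (hU : ∀ i j, U i j = U j i) (hU0 : ∑ i, U i i = 0) (v : Fin n → V) :
    0 ≤ crossTrace (fun a b => ∑ i, ∑ j, (f i a * f j b) • U i j) v := by
  obtain ⟨A, hA⟩ : ∃ A : Fin d → V, ∀ k, A k = ∑ b, f k b • v b := ⟨_, fun _ => rfl⟩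
  have e : crossTrace (fun a b => ∑ i, ∑ j, (f i a * f j b) • U i j) v = crossTrace U A := by
    have e1 : ∀ c a b, inner ℝ (∑ i, ∑ j, (f i c * f j a) • U i j) (v b) *
        inner ℝ (∑ i, ∑ j, (f i c * f j b) • U i j) (v a) =
        ∑ i, ∑ i', f i c * f i' c * ∑ j, ∑ j', (f j a * inner ℝ (U i' j') (v a)) *
          (f j' b * inner ℝ (U i j) (v b)) := by
      intro c a b
      rw [mul_comm]
      simp only [sum_inner, real_inner_smul_left, Finset.mul_sum]
      simp only [Finset.sum_mul]
      refine Finset.sum_congr rfl fun i _ => ?_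
      rw [Finset.sum_comm]
      refine Finset.sum_congr rfl fun i' _ => ?_
      refine Finset.sum_congr rfl fun j _ => ?_
      refine Finset.sum_congr rfl fun j' _ => ?_
      ring
    have e2 : ∀ i i', ∑ a, ∑ b, ∑ j, ∑ j', (f j a * inner ℝ (U i' j') (v a)) *
          (f j' b * inner ℝ (U i j) (v b)) =
        ∑ j, ∑ j', inner ℝ (U i' j') (A j) * inner ℝ (U i j) (A j') := by
      intro i i'
      have : ∀ a, ∑ b, ∑ j, ∑ j', (f j a * inner ℝ (U i' j') (v a)) *
          (f j' b * inner ℝ (U i j) (v b)) = ∑ j, ∑ j', ∑ b, (f j a * inner ℝ (U i' j') (v a)) *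
          (f j' b * inner ℝ (U i j) (v b)) := by
        intro a
        rw [Finset.sum_comm]
        exact Finset.sum_congr rfl fun j _ => Finset.sum_comm
      simp only [this]
      rw [Finset.sum_comm]
      refine Finset.sum_congr rfl fun j _ => ?_
      rw [Finset.sum_comm]
      refine Finset.sum_congr rfl fun j' _ => ?_
      rw [← Finset.sum_mul_sum, hA, hA]
      simp only [inner_sum, inner_smul_right]
    unfold crossTrace
    simp only [e1]
    calc _ = ∑ i, ∑ i', ∑ c, f i c * f i' c * ∑ a, ∑ b, ∑ j, ∑ j',
          (f j a * inner ℝ (U i' j') (v a)) * (f j' b * inner ℝ (U i j) (v b)) := by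
          have : ∀ c, ∑ a, ∑ b, ∑ i, ∑ i', f i c * f i' c * ∑ j, ∑ j',
              (f j a * inner ℝ (U i' j') (v a)) * (f j' b * inner ℝ (U i j) (v b)) =
              ∑ i, ∑ i', ∑ a, ∑ b, f i c * f i' c * ∑ j, ∑ j',
              (f j a * inner ℝ (U i' j') (v a)) * (f j' b * inner ℝ (U i j) (v b)) := by
            intro c
            have : ∀ a, ∑ b, ∑ i, ∑ i', f i c * f i' c * ∑ j, ∑ j',
              (f j a * inner ℝ (U i' j') (v a)) * (f j' b * inner ℝ (U i j) (v b)) =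
              ∑ i, ∑ i', ∑ b, f i c * f i' c * ∑ j, ∑ j',
              (f j a * inner ℝ (U i' j') (v a)) * (f j' b * inner ℝ (U i j) (v b)) := by
              intro a
              rw [Finset.sum_comm]
              exact Finset.sum_congr rfl fun j _ => Finset.sum_comm
            simp only [this]
            rw [Finset.sum_comm]
            exact Finset.sum_congr rfl fun j _ => Finset.sum_comm
          simp only [this]
          rw [Finset.sum_comm]
          refine Finset.sum_congr rfl fun i _ => ?_
          rw [Finset.sum_comm]
          refine Finset.sum_congr rfl fun i' _ => ?_
          refine Finset.sum_congr rfl fun c _ => ?_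
          simp only [← Finset.mul_sum]
      _ = ∑ i, ∑ i', (if i = i' then 1 else 0) *
            ∑ j, ∑ j', inner ℝ (U i' j') (A j) * inner ℝ (U i j) (A j') := by
          simp only [← Finset.sum_mul, hf, e2]
      _ = _ := by
          simp only [ite_mul, one_mul, zero_mul, Finset.sum_ite_eq, Finset.mem_univ, if_true]
          refine Finset.sum_congr rfl fun i _ => Finset.sum_congr rfl fun j _ =>
            Finset.sum_congr rfl fun j' _ => mul_comm _ _
  rw [e]
  unfold crossTrace
  interval_cases d
  · simp
  · simp only [Fin.sum_univ_one] at hU0 ⊢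
    simp [hU0]
  · simp only [Fin.sum_univ_two] at hU0 ⊢
    rw [hU 1 0, eq_neg_of_add_eq_zero_right hU0]
    simp only [inner_neg_left]
    -- With `U 1 1 = -U 0 0` the cross trace is exactly the sum of these two squares.
    nlinarith [sq_nonneg (inner ℝ (U 0 0) (A 0) - inner ℝ (U 0 1) (A 1)),
      sq_nonneg (inner ℝ (U 0 0) (A 1) + inner ℝ (U 0 1) (A 0))]

/-- The linear map `x ↦ (∑_a x_a h_ab)_b`. -/
def contractLeft (h : Fin n → Fin n → V) : EuclideanSpace ℝ (Fin n) →ₗ[ℝ] (Fin n → V) where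
  toFun x b := ∑ a, x a • h a b
  map_add' x y := by ext b; simp [add_smul, Finset.sum_add_distrib]
  map_smul' r x := by ext b; simp [mul_smul, Finset.smul_sum]

/-- By symmetry `h` vanishes as soon as either argument lies in the kernel of `contractLeft h`, so
it is pulled back from the orthogonal complement of that kernel, whose dimension is the rank. The
pulled-back form keeps trace zero. -/
theorem crossTrace_nonneg_of_rank_le_two {h : Fin n → Fin n → V} (hs : ∀ i j, h i j = h j i)
    (h0 : ∑ i, h i i = 0)
    (hr : Module.finrank ℝ (LinearMap.range (contractLeft h)) ≤ 2) (v : Fin n → V) :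
    0 ≤ crossTrace h v := by
  set L := contractLeft h with hL
  set W := (LinearMap.ker L)ᗮ with hW
  have hd : Module.finrank ℝ W ≤ 2 := by
    have h1 := L.finrank_range_add_finrank_ker
    have h2 := (LinearMap.ker L).finrank_add_finrank_orthogonal
    rw [hW]
    omega
  let o := stdOrthonormalBasis ℝ W
  have hLx : ∀ x, L x = ∑ i, inner ℝ (o i : EuclideanSpace ℝ (Fin n)) x • L (o i) := by
    intro x
    have hWo : Wᗮ = LinearMap.ker L := by rw [hW, Submodule.orthogonal_orthogonal]
    have h1 := W.sub_starProjection_mem_orthogonal x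
    rw [hWo, LinearMap.sub_mem_ker_iff] at h1
    have h2 : ∀ y : W, L y = ∑ i, o.repr y i • L (o i) := by
      intro y
      conv_lhs => rw [← o.sum_repr y]
      simp only [Submodule.coe_sum, Submodule.coe_smul, map_sum, map_smul]
    rw [h1, Submodule.starProjection_apply, h2]
    refine Finset.sum_congr rfl fun i _ => ?_
    rw [o.repr_apply_apply]
    congr 1
    exact Submodule.inner_orthogonalProjectionOnto_eq_of_mem_left (o i) x
  obtain ⟨f, hf⟩ : ∃ f : Fin (Module.finrank ℝ W) → Fin n → ℝ,
    ∀ i a, f i a = (o i : EuclideanSpace ℝ (Fin n)) a := ⟨_, fun _ _ => rfl⟩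
  have hLb : ∀ x b, L x b = ∑ a, x a • h a b := fun x b => rfl
  obtain ⟨U, hU⟩ : ∃ U : Fin (Module.finrank ℝ W) → Fin (Module.finrank ℝ W) → V,
    ∀ i j, U i j = ∑ c, ∑ b, (f i c * f j b) • h c b := ⟨_, fun _ _ => rfl⟩
  have h1 : ∀ a b, h a b = ∑ i, f i a • L (o i) b := by
    intro a b
    have := congrFun (hLx (EuclideanSpace.single a 1)) b
    rw [hLb] at this
    simpa [EuclideanSpace.inner_single_right, hf] using this
  have h2 : ∀ i b, L (o i) b = ∑ j, f j b • U i j := by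
    intro i b
    rw [hLb]
    simp only [← hf]
    calc ∑ a, f i a • h a b = ∑ a, f i a • ∑ j, f j b • L (o j) a :=
          Finset.sum_congr rfl fun a _ => by rw [hs, h1]
      _ = ∑ j, f j b • ∑ a, f i a • L (o j) a := by
          simp only [Finset.smul_sum]
          rw [Finset.sum_comm]
          exact Finset.sum_congr rfl fun j _ => Finset.sum_congr rfl fun a _ => smul_comm _ _ _
      _ = _ := by
          refine Finset.sum_congr rfl fun j _ => ?_
          rw [hU]
          congr 1
          refine Finset.sum_congr rfl fun a _ => ?_
          rw [hLb, Finset.smul_sum]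
          refine Finset.sum_congr rfl fun b _ => ?_
          rw [hs a b, smul_smul, hf j b]
  have h3 : h = fun a b => ∑ i, ∑ j, (f i a * f j b) • U i j := by
    funext a b
    rw [h1]
    refine Finset.sum_congr rfl fun i _ => ?_
    rw [h2, Finset.smul_sum]
    exact Finset.sum_congr rfl fun j _ => smul_smul _ _ _
  have hff : ∀ i j, ∑ c, f i c * f j c = if i = j then 1 else 0 := by
    intro i j
    have := orthonormal_iff_ite.1 o.orthonormal j i
    rw [Submodule.coe_inner, PiLp.inner_apply] at this
    simpa [hf, eq_comm] using this
  have hUs : ∀ i j, U i j = U j i := by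
    intro i j
    rw [hU, hU, Finset.sum_comm]
    refine Finset.sum_congr rfl fun a _ => Finset.sum_congr rfl fun b _ => ?_
    rw [hs, mul_comm]
  have hU0 : ∑ i, U i i = 0 := by
    rw [← h0]
    conv_rhs => rw [h3]
    simp only
    rw [Finset.sum_comm]
    refine Finset.sum_congr rfl fun i _ => ?_
    rw [Finset.sum_comm]
    simp only [← Finset.sum_smul, hff]
    simp
  rw [h3]
  exact crossTrace_nonneg_of_decomp hd f hff U hUs hU0 v

end

end GaussImage

/-! ### Derivatives of determinants, inverses and log-determinants. -/

namespace GaussImage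

section

variable {ι : Type*} [Fintype ι] [DecidableEq ι]

/-- The determinant as a continuous multilinear map of the rows. -/
def detContinuousMultilinear (ι : Type*) [Fintype ι] [DecidableEq ι] :
    ContinuousMultilinearMap ℝ (fun _ : ι => ι → ℝ) ℝ where
  toMultilinearMap := (Matrix.detRowAlternating (n := ι) (R := ℝ)).toMultilinearMap
  cont := by
    change Continuous fun M : ι → ι → ℝ => Matrix.det (Matrix.of M)
    exact Continuous.matrix_det continuous_id

theorem hasDerivAt_det {X : ℝ → Matrix ι ι ℝ} {X' : Matrix ι ι ℝ} {s : ℝ}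
    (h : ∀ a b, HasDerivAt (fun s => X s a b) (X' a b) s) :
    HasDerivAt (fun s => (X s).det) (∑ a, ((X s).updateRow a (X' a)).det) s := by
  have h1 : ∀ a, HasDerivAt (fun s => X s a) (X' a) s := fun a => hasDerivAt_pi.2 (h a)
  have h2 := (HasFDerivAt.multilinear_comp (f := detContinuousMultilinear ι)
    (g := fun a s => X s a) (fun a => (h1 a).hasFDerivAt)).hasDerivAt
  refine h2.congr_deriv ?_
  simp
  rfl

theorem sum_det_updateRow (X Y : Matrix ι ι ℝ) :
    ∑ a, (X.updateRow a (Y a)).det = (Y * X.adjugate).trace := by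
  rw [Matrix.trace]
  refine Finset.sum_congr rfl fun a _ => ?_
  rw [← Matrix.cramer_transpose_apply, Matrix.cramer_eq_adjugate_mulVec,
    ← Matrix.adjugate_transpose, Matrix.diag_apply, Matrix.mul_apply]
  exact Finset.sum_congr rfl fun b _ => mul_comm _ _

/-- Cramer's rule gives differentiability of the inverse; differentiating `X⁻¹ X = 1` then
identifies the derivative. -/
theorem hasDerivAt_inv_of_eq_one {X : ℝ → Matrix ι ι ℝ} {X' : Matrix ι ι ℝ} (h0 : X 0 = 1)
    (h : ∀ a b, HasDerivAt (fun s => X s a b) (X' a b) 0) (a b : ι) :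
    HasDerivAt (fun s => (X s)⁻¹ a b) ((-X') a b) 0 := by
  have hdet := hasDerivAt_det h
  have hne : ∀ᶠ s in nhds 0, (X s).det ≠ 0 :=
    hdet.continuousAt.eventually_ne (by simp [h0])
  obtain ⟨Z', hZ'⟩ : ∃ Z' : Matrix ι ι ℝ, ∀ a b, HasDerivAt (fun s => (X s)⁻¹ a b) (Z' a b) 0 := by
    have : ∀ a b, ∃ z, HasDerivAt (fun s => (X s)⁻¹ a b) z 0 := by
      intro a b
      simp only [Matrix.inv_def, Ring.inverse_eq_inv', Matrix.smul_apply, smul_eq_mul,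
        Matrix.adjugate_apply]
      refine ⟨_, (hdet.inv (by simp [h0])).mul (hasDerivAt_det
        (X := fun s => (X s).updateRow b (Pi.single a 1))
        (X' := X'.updateRow b 0) fun i j => ?_)⟩
      by_cases hib : i = b
      · subst hib; simpa using hasDerivAt_const _ _
      · simpa [Matrix.updateRow_ne hib] using h i j
    choose Z' hZ' using this
    exact ⟨Matrix.of Z', hZ'⟩
  suffices hZ : Z' = -X' from hZ ▸ hZ' a b
  ext a b
  have e1 : HasDerivAt (fun s => ((X s)⁻¹ * X s) a b)
      (∑ c, (Z' a c * X 0 c b + (X 0)⁻¹ a c * X' c b)) 0 := by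
    simp only [Matrix.mul_apply]
    exact HasDerivAt.fun_sum fun c _ => (hZ' a c).mul (h c b)
  have e2 : HasDerivAt (fun s => ((X s)⁻¹ * X s) a b) 0 0 := by
    refine (hasDerivAt_const (0 : ℝ) ((1 : Matrix ι ι ℝ) a b)).congr_of_eventuallyEq ?_
    filter_upwards [hne] with s hs
    rw [Matrix.nonsing_inv_mul _ (isUnit_iff_ne_zero.2 hs)]
  have := e1.unique e2
  simp only [h0, inv_one, Finset.sum_add_distrib, ← Matrix.mul_apply, mul_one, one_mul] at this
  simpa using eq_neg_of_add_eq_zero_left this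

/-- Jacobi's formula gives `(log det X)' = tr (X' X⁻¹)` near 0, and differentiating once more where
`X = 1` yields `tr X'' - tr (X'²)`. The logarithm removes the mixed products that differentiating
the determinant twice would produce. -/
theorem hasDerivAt_log_det {X X1 : ℝ → Matrix ι ι ℝ} {X2 : Matrix ι ι ℝ} (h0 : X 0 = 1)
    (h1 : ∀ᶠ s in nhds 0, ∀ a b, HasDerivAt (fun s => X s a b) (X1 s a b) s)
    (h2 : ∀ a b, HasDerivAt (fun s => X1 s a b) (X2 a b) 0) :
    ∃ l : ℝ → ℝ, (∀ᶠ s in nhds 0, HasDerivAt (fun s => Real.log (X s).det) (l s) s) ∧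
      l 0 = (X1 0).trace ∧ HasDerivAt l (X2.trace - (X1 0 * X1 0).trace) 0 := by
  have hX1 := h1.self_of_nhds
  have hdet := hasDerivAt_det hX1
  have hne : ∀ᶠ s in nhds 0, (X s).det ≠ 0 :=
    hdet.continuousAt.eventually_ne (by simp [h0])
  refine ⟨fun s => (X1 s * (X s)⁻¹).trace, ?_, by simp [h0], ?_⟩
  · filter_upwards [h1, hne] with s hs hs0
    refine ((hasDerivAt_det hs).log hs0).congr_deriv ?_
    rw [sum_det_updateRow, Matrix.inv_def, Matrix.mul_smul, Matrix.trace_smul,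
      Ring.inverse_eq_inv', smul_eq_mul, div_eq_inv_mul]
  · have hZ' := hasDerivAt_inv_of_eq_one h0 hX1
    have : HasDerivAt (fun s => (X1 s * (X s)⁻¹).trace)
        (∑ a, ∑ b, (X2 a b * (X 0)⁻¹ b a + X1 0 a b * (-X1 0) b a)) 0 := by
      simp only [Matrix.trace, Matrix.diag_apply, Matrix.mul_apply]
      exact HasDerivAt.fun_sum fun a _ => HasDerivAt.fun_sum fun b _ => (h2 a b).mul (hZ' b a)
    refine this.congr_deriv ?_
    simp only [Finset.sum_add_distrib, ← Matrix.mul_apply, h0, inv_one, mul_one]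
    simp only [Matrix.neg_apply, mul_neg, Finset.sum_neg_distrib, ← sub_eq_add_neg]
    rfl

end

end GaussImage

/-! ### Directional derivatives and constant frames in parameter space. -/

namespace GaussImage

section

variable {E G : Type*} [NormedAddCommGroup E] [NormedSpace ℝ E]
  [NormedAddCommGroup G] [NormedSpace ℝ G]

/-- The directional derivative `∂_v f`. -/
noncomputable def dd (v : E) (f : E → G) (y : E) : G := fderiv ℝ f y v

theorem contDiffAt_dd {f : E → G} {y : E} (hf : ContDiffAt ℝ ∞ f y) (v : E) :
    ContDiffAt ℝ ∞ (dd v f) y :=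
  (hf.fderiv_right (m := ∞) (by simp)).clm_apply contDiffAt_const

theorem differentiableAt_of_top {f : E → G} {y : E} (hf : ContDiffAt ℝ ∞ f y) :
    DifferentiableAt ℝ f y := hf.differentiableAt (by simp)

theorem eventually_contDiffAt {f : E → G} {y : E} (hf : ContDiffAt ℝ ∞ f y) (k : ℕ) :
    ∀ᶠ z in nhds y, ContDiffAt ℝ k f z :=
  (hf.of_le (by exact_mod_cast le_top)).eventually (by simp)

theorem dd_dd_eq {f : E → G} {y : E} (hf : ContDiffAt ℝ 2 f y) (v w : E) :
    dd v (dd w f) y = fderiv ℝ (fderiv ℝ f) y v w := by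
  have h : DifferentiableAt ℝ (fderiv ℝ f) y :=
    (hf.fderiv_right (m := 1) (by norm_num)).differentiableAt (by simp)
  unfold dd
  rw [fderiv_clm_apply h (differentiableAt_const w)]
  simp

theorem dd_comm {f : E → G} {y : E} (hf : ContDiffAt ℝ 2 f y) (v w : E) :
    dd v (dd w f) y = dd w (dd v f) y := by
  rw [dd_dd_eq hf, dd_dd_eq hf]
  exact (hf.isSymmSndFDerivAt (by simp)) v w

theorem dd_congr {f f' : E → G} {y : E} (h : f =ᶠ[nhds y] f') (v : E) :
    dd v f =ᶠ[nhds y] dd v f' := by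
  filter_upwards [h.fderiv (𝕜 := ℝ)] with z hz
  simp [dd, hz]

theorem hasDerivAt_line {f : E → G} {y v : E} {s : ℝ} (hf : DifferentiableAt ℝ f (y + s • v)) :
    HasDerivAt (fun s : ℝ => f (y + s • v)) (dd v f (y + s • v)) s := by
  have h : HasDerivAt (fun s : ℝ => y + s • v) v s := by
    simpa using (((hasDerivAt_id s).smul_const v).const_add y : HasDerivAt (fun s : ℝ => y + id s • v) _ s)
  exact hf.hasFDerivAt.comp_hasDerivAt s h

theorem tendsto_line (y v : E) : Filter.Tendsto (fun s : ℝ => y + s • v) (nhds 0) (nhds y) := by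
  have : Continuous fun s : ℝ => y + s • v := by fun_prop
  simpa using this.tendsto 0

theorem hasDerivAt_line_zero {f : E → G} {y v : E} (hf : DifferentiableAt ℝ f y) :
    HasDerivAt (fun s : ℝ => f (y + s • v)) (dd v f y) 0 := by
  have := hasDerivAt_line (f := f) (y := y) (v := v) (s := 0) (by simpa using hf)
  simpa using this

theorem eventually_hasDerivAt_line {f : E → G} {y v : E} (hf : ContDiffAt ℝ ∞ f y) :
    ∀ᶠ s : ℝ in nhds 0, HasDerivAt (fun s : ℝ => f (y + s • v)) (dd v f (y + s • v)) s := by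
  filter_upwards [(tendsto_line y v).eventually (eventually_contDiffAt hf 1)] with s hs
  exact hasDerivAt_line (hs.differentiableAt (by simp))

/-- Reduces first and second directional derivatives to one-variable calculus along a line: `l` is a
formula for the first derivative near 0. -/
theorem dd_of_line {f : E → G} {y v : E} (hf : ContDiffAt ℝ ∞ f y) {l : ℝ → G} {c : G}
    (h1 : ∀ᶠ s : ℝ in nhds 0, HasDerivAt (fun s : ℝ => f (y + s • v)) (l s) s)
    (h2 : HasDerivAt l c 0) : dd v f y = l 0 ∧ dd v (dd v f) y = c := by
  have h : (fun s : ℝ => dd v f (y + s • v)) =ᶠ[nhds 0] l := by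
    filter_upwards [h1, eventually_hasDerivAt_line hf] with s hs hs'
    exact hs'.unique hs
  refine ⟨by simpa using h.self_of_nhds, ?_⟩
  exact (hasDerivAt_line_zero (differentiableAt_of_top
    (contDiffAt_dd hf v))).unique (h2.congr_of_eventuallyEq h)

end

section

variable {n m : ℕ}

theorem pd_eq_dd {G : Type*} [NormedAddCommGroup G] [NormedSpace ℝ G] (i : Fin n)
    (f : Model n → G) : pd i f = dd (EuclideanSpace.single i 1) f := rfl

/-- The metric in the basis `ℓ`. -/
noncomputable def frameMetric (u : Model n → Ambient n m) (ℓ : Fin n → Model n) (y : Model n) :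
    Matrix (Fin n) (Fin n) ℝ :=
  Matrix.of fun a b => inner ℝ (dd (ℓ a) u y) (dd (ℓ b) u y)

theorem sum_single_smul (v : Model n) : ∑ i, v i • EuclideanSpace.single i (1 : ℝ) = v := by
  ext j; simp [Pi.single_apply]

theorem dd_eq_sum_pd {G : Type*} [NormedAddCommGroup G] [NormedSpace ℝ G] (v : Model n)
    (f : Model n → G) (y : Model n) : dd v f y = ∑ i, v i • pd i f y := by
  conv_lhs => rw [← sum_single_smul v]
  simp [dd, pd]

/-- The coordinate matrix of `ℓ`. -/
noncomputable def frameMatrix (ℓ : Fin n → Model n) : Matrix (Fin n) (Fin n) ℝ := Matrix.of fun a i => ℓ a i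

theorem frameMetric_eq (u : Model n → Ambient n m) (ℓ : Fin n → Model n) (y : Model n) :
    frameMetric u ℓ y = frameMatrix ℓ * metric u y * (frameMatrix ℓ).transpose := by
  ext a b
  simp only [frameMetric, frameMatrix, metric, Matrix.of_apply, Matrix.mul_apply,
    Matrix.transpose_apply, dd_eq_sum_pd (ℓ _), sum_inner, inner_sum, real_inner_smul_left,
    real_inner_smul_right, Finset.sum_mul]
  exact Finset.sum_congr rfl fun _ _ => Finset.sum_congr rfl fun _ _ => by ring

theorem invMetric_eq {u : Model n → Ambient n m} {ℓ : Fin n → Model n} {y : Model n}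
    (h : (frameMetric u ℓ y).det ≠ 0) :
    invMetric u y = (frameMatrix ℓ).transpose * (frameMetric u ℓ y)⁻¹ * frameMatrix ℓ := by
  have hA : IsUnit (frameMatrix ℓ).det := by
    rw [isUnit_iff_ne_zero]
    intro h0
    apply h
    rw [frameMetric_eq, Matrix.det_mul, Matrix.det_mul, h0]
    ring
  have hA' : IsUnit (frameMatrix ℓ).transpose.det := by rwa [Matrix.det_transpose]
  rw [frameMetric_eq, Matrix.mul_inv_rev, Matrix.mul_inv_rev, ← mul_assoc, ← mul_assoc,
    Matrix.mul_nonsing_inv _ hA', one_mul, mul_assoc, Matrix.nonsing_inv_mul _ hA, mul_one]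
  rfl

/-- A metric trace does not depend on the basis. The frames `ℓ` are constant in parameter space and
orthonormal only at the point of interest, so every traced quantity can be computed there with `g =
1` and no moving frame. -/
theorem sum_invMetric {G : Type*} [AddCommGroup G] [Module ℝ G]
    {u : Model n → Ambient n m} {ℓ : Fin n → Model n} {y : Model n}
    (h : (frameMetric u ℓ y).det ≠ 0) (B : Model n →ₗ[ℝ] Model n →ₗ[ℝ] G) :
    ∑ i, ∑ j, invMetric u y i j • B (EuclideanSpace.single i 1) (EuclideanSpace.single j 1) =
      ∑ a, ∑ b, (frameMetric u ℓ y)⁻¹ a b • B (ℓ a) (ℓ b) := by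
  have hB : ∀ a b, B (ℓ a) (ℓ b) = ∑ i, ∑ j, (ℓ a i * ℓ b j) •
      B (EuclideanSpace.single i 1) (EuclideanSpace.single j 1) := by
    intro a b
    conv_lhs => rw [← sum_single_smul (ℓ a), ← sum_single_smul (ℓ b)]
    simp only [map_sum, map_smul, LinearMap.sum_apply, LinearMap.smul_apply, Finset.smul_sum,
      smul_smul]
    rw [Finset.sum_comm]
    exact Finset.sum_congr rfl fun _ _ => Finset.sum_congr rfl fun _ _ => by rw [mul_comm]
  simp only [hB, invMetric_eq h, Matrix.mul_apply, Matrix.transpose_apply, frameMatrix,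
    Matrix.of_apply, Finset.sum_smul, Finset.smul_sum, smul_smul, Finset.sum_mul]
  have e : ∀ F : Fin n → Fin n → Fin n → Fin n → G,
      ∑ i, ∑ j, ∑ b, ∑ a, F i j a b = ∑ a, ∑ b, ∑ i, ∑ j, F i j a b := by
    intro F
    calc _ = ∑ i, ∑ b, ∑ j, ∑ a, F i j a b := Finset.sum_congr rfl fun i _ => Finset.sum_comm
      _ = ∑ b, ∑ i, ∑ j, ∑ a, F i j a b := Finset.sum_comm
      _ = ∑ b, ∑ i, ∑ a, ∑ j, F i j a b := Finset.sum_congr rfl fun b _ =>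
          Finset.sum_congr rfl fun i _ => Finset.sum_comm
      _ = ∑ b, ∑ a, ∑ i, ∑ j, F i j a b := Finset.sum_congr rfl fun b _ => Finset.sum_comm
      _ = _ := Finset.sum_comm
  rw [e fun i j a b => (ℓ a i * (frameMetric u ℓ y)⁻¹ a b * ℓ b j) •
    B (EuclideanSpace.single i 1) (EuclideanSpace.single j 1)]
  exact Finset.sum_congr rfl fun _ _ => Finset.sum_congr rfl fun _ _ =>
    Finset.sum_congr rfl fun _ _ => Finset.sum_congr rfl fun _ _ => by
      congr 1; ring

/-- `D²u(y)` as a bilinear map. -/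
noncomputable def hessianBilin {G : Type*} [NormedAddCommGroup G] [NormedSpace ℝ G] (f : Model n → G)
    (y : Model n) : Model n →ₗ[ℝ] Model n →ₗ[ℝ] G :=
  LinearMap.mk₂ ℝ (fun v w => fderiv ℝ (fderiv ℝ f) y v w) (by simp) (by simp) (by simp) (by simp)

theorem hessianBilin_apply {G : Type*} [NormedAddCommGroup G] [NormedSpace ℝ G] {f : Model n → G}
    {y : Model n} (hf : ContDiffAt ℝ 2 f y) (v w : Model n) :
    hessianBilin f y v w = dd v (dd w f) y := (dd_dd_eq hf v w).symm

/-- The sum `∑ c^k ε_k` of the tangential coefficients. -/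
noncomputable def tangentVector (u : Model n → Ambient n m) (y : Model n) : Ambient n m →ₗ[ℝ] Model n where
  toFun v := ∑ k, tangentCoeff u y v k • EuclideanSpace.single k 1
  map_add' v w := by
    simp only [tangentCoeff, inner_add_left, mul_add, Finset.sum_add_distrib, add_smul]
  map_smul' r v := by
    simp only [tangentCoeff, real_inner_smul_left, RingHom.id_apply, Finset.smul_sum, smul_smul,
      Finset.mul_sum]
    refine Finset.sum_congr rfl fun k _ => ?_
    congr 1
    exact Finset.sum_congr rfl fun l _ => by ring

theorem tangentVector_apply (u : Model n → Ambient n m) (y : Model n) (v : Ambient n m) :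
    tangentVector u y v = ∑ k, tangentCoeff u y v k • EuclideanSpace.single k 1 := rfl

theorem normalPart_eq (u : Model n → Ambient n m) (y : Model n) (v : Ambient n m) :
    normalPart u y v = v - fderiv ℝ u y (tangentVector u y v) := by
  simp [normalPart, tangentVector_apply, pd]

/-- `normalPart` as a linear map. -/
noncomputable def normalPartLin (u : Model n → Ambient n m) (y : Model n) : Ambient n m →ₗ[ℝ] Ambient n m :=
  LinearMap.id - (fderiv ℝ u y).toLinearMap ∘ₗ tangentVector u y

theorem normalPartLin_apply (u : Model n → Ambient n m) (y : Model n) (v : Ambient n m) :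
    normalPartLin u y v = normalPart u y v := (normalPart_eq u y v).symm

theorem tangentVector_eq {u : Model n → Ambient n m} {ℓ : Fin n → Model n} {y : Model n}
    (h : (frameMetric u ℓ y).det ≠ 0) (v : Ambient n m) :
    tangentVector u y v = ∑ a, ∑ b, ((frameMetric u ℓ y)⁻¹ a b * inner ℝ v (dd (ℓ b) u y)) • ℓ a := by
  have := sum_invMetric h (LinearMap.mk₂ ℝ (fun x w : Model n => (inner ℝ v (fderiv ℝ u y w)) • x)
    (by simp) (by intros; simp only [smul_smul, mul_comm])
    (by intros; rw [map_add, inner_add_right, add_smul])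
    (by intros; rw [map_smul, inner_smul_right, mul_smul]))
  simp only [LinearMap.mk₂_apply, smul_smul] at this
  rw [show (∑ a, ∑ b, ((frameMetric u ℓ y)⁻¹ a b * inner ℝ v (dd (ℓ b) u y)) • ℓ a) = _ from
    this.symm]
  simp only [tangentVector_apply, tangentCoeff, Finset.sum_smul]
  rfl

theorem localLaplacian_eq_sum {u : Model n → Ambient n m} {φ : Model n → ℝ} {ℓ : Fin n → Model n}
    {y : Model n} (h : (frameMetric u ℓ y).det ≠ 0) (hu : ContDiffAt ℝ 2 u y)
    (hφ : ContDiffAt ℝ 2 φ y) :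
    localLaplacian u φ y = ∑ a, ∑ b, (frameMetric u ℓ y)⁻¹ a b *
      (dd (ℓ a) (dd (ℓ b) φ) y - dd (tangentVector u y (dd (ℓ a) (dd (ℓ b) u) y)) φ y) := by
  have := sum_invMetric h (hessianBilin φ y - (hessianBilin u y).compr₂
    ((fderiv ℝ φ y).toLinearMap ∘ₗ tangentVector u y))
  simp only [LinearMap.sub_apply, LinearMap.compr₂_apply, hessianBilin_apply hφ,
    hessianBilin_apply hu, smul_eq_mul] at this
  refine Eq.trans ?_ this
  simp only [localLaplacian, christoffel]
  refine Finset.sum_congr rfl fun i _ => Finset.sum_congr rfl fun j _ => ?_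
  congr 1
  simp only [LinearMap.comp_apply, tangentVector_apply, ContinuousLinearMap.coe_coe, map_sum,
    map_smul, smul_eq_mul]
  rfl

end

end GaussImage

/-! ### Extrinsic geometry at a point where the frame is orthonormal. -/

namespace GaussImage

section

variable {E : Type*} [NormedAddCommGroup E] [NormedSpace ℝ E]
  {ι : Type*} [Fintype ι] [DecidableEq ι]

theorem contDiffAt_two {G : Type*} [NormedAddCommGroup G] [NormedSpace ℝ G] {f : E → G} {y : E}
    (hf : ContDiffAt ℝ ∞ f y) : ContDiffAt ℝ 2 f y :=
  (eventually_contDiffAt hf 2).self_of_nhds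

theorem contDiffAt_det {X : E → Matrix ι ι ℝ} {y : E}
    (h : ∀ a b, ContDiffAt ℝ ∞ (fun y => X y a b) y) : ContDiffAt ℝ ∞ (fun y => (X y).det) y := by
  simp only [Matrix.det_apply]
  exact ContDiffAt.sum fun σ _ => (contDiffAt_prod fun i _ => h _ _).const_smul _

theorem contDiffAt_inv_apply {X : E → Matrix ι ι ℝ} {y : E}
    (h : ∀ a b, ContDiffAt ℝ ∞ (fun y => X y a b) y) (h0 : (X y).det ≠ 0) (a b : ι) :
    ContDiffAt ℝ ∞ (fun y => (X y)⁻¹ a b) y := by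
  simp only [Matrix.inv_def, Ring.inverse_eq_inv', Matrix.smul_apply, smul_eq_mul,
    Matrix.adjugate_apply]
  refine ((contDiffAt_det h).inv h0).mul (contDiffAt_det fun i j => ?_)
  by_cases hib : i = b
  · subst hib; simpa using contDiffAt_const
  · simpa [Matrix.updateRow_ne hib] using h i j

end

section

variable {n m : ℕ} {u : Model n → Ambient n m} {ℓ : Fin n → Model n} {y : Model n}

/-- The second fundamental form in the basis `ℓ`. -/
noncomputable def frameB (u : Model n → Ambient n m) (ℓ : Fin n → Model n) (y : Model n)
    (a b : Fin n) : Ambient n m :=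
  normalPart u y (dd (ℓ a) (dd (ℓ b) u) y)

theorem contDiffAt_frameMetric (hu : ContDiffAt ℝ ∞ u y) (a b : Fin n) :
    ContDiffAt ℝ ∞ (fun y => frameMetric u ℓ y a b) y :=
  (contDiffAt_dd hu _).inner ℝ (contDiffAt_dd hu _)

theorem frameB_comm (hu : ContDiffAt ℝ ∞ u y) (a b : Fin n) :
    frameB u ℓ y a b = frameB u ℓ y b a := by
  rw [frameB, dd_comm (contDiffAt_two hu)]; rfl

theorem meanCurvature_eq_sum (h : (frameMetric u ℓ y).det ≠ 0) (hu : ContDiffAt ℝ 2 u y) :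
    meanCurvature u y = ∑ a, ∑ b, (frameMetric u ℓ y)⁻¹ a b • frameB u ℓ y a b := by
  have := sum_invMetric h ((hessianBilin u y).compr₂ (normalPartLin u y))
  simp only [LinearMap.compr₂_apply, hessianBilin_apply hu, normalPartLin_apply] at this
  exact this

theorem normalPart_eq_sum (h : (frameMetric u ℓ y).det ≠ 0) (v : Ambient n m) :
    normalPart u y v = v - ∑ a, ∑ b,
      ((frameMetric u ℓ y)⁻¹ a b * inner ℝ v (dd (ℓ b) u y)) • dd (ℓ a) u y := by
  rw [normalPart_eq, tangentVector_eq h]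
  simp only [map_sum, map_smul]
  rfl

theorem eventually_det_frameMetric_ne (hu : ContDiffAt ℝ ∞ u y)
    (h : (frameMetric u ℓ y).det ≠ 0) : ∀ᶠ z in nhds y, (frameMetric u ℓ z).det ≠ 0 :=
  (contDiffAt_det (contDiffAt_frameMetric hu)).continuousAt.eventually_ne h

theorem contDiffAt_meanCurvature (hu : ContDiffAt ℝ ∞ u y) (h : (frameMetric u ℓ y).det ≠ 0) :
    ContDiffAt ℝ ∞ (meanCurvature u) y := by
  have e : meanCurvature u =ᶠ[nhds y] fun y => ∑ a, ∑ b, (frameMetric u ℓ y)⁻¹ a b •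
      (dd (ℓ a) (dd (ℓ b) u) y - ∑ c, ∑ d, ((frameMetric u ℓ y)⁻¹ c d *
        inner ℝ (dd (ℓ a) (dd (ℓ b) u) y) (dd (ℓ d) u y)) • dd (ℓ c) u y) := by
    filter_upwards [eventually_det_frameMetric_ne hu h, eventually_contDiffAt hu 2] with z hz hz2
    rw [meanCurvature_eq_sum hz hz2]
    simp only [frameB, normalPart_eq_sum hz]
  refine ContDiffAt.congr_of_eventuallyEq ?_ e
  have hi := contDiffAt_inv_apply (contDiffAt_frameMetric (ℓ := ℓ) hu) h
  refine ContDiffAt.sum fun a _ => ContDiffAt.sum fun b _ => (hi a b).smul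
    ((contDiffAt_dd (contDiffAt_dd hu _) _).sub (ContDiffAt.sum fun c _ => ContDiffAt.sum fun d _ =>
      ((hi c d).mul ((contDiffAt_dd (contDiffAt_dd hu _) _).inner ℝ (contDiffAt_dd hu _))).smul
        (contDiffAt_dd hu _)))

variable (hℓ : Orthonormal ℝ fun a => dd (ℓ a) u y)
include hℓ

theorem frameMetric_eq_one : frameMetric u ℓ y = 1 := by
  ext a b
  rw [frameMetric, Matrix.of_apply, orthonormal_iff_ite.1 hℓ, Matrix.one_apply]

theorem det_frameMetric_ne_zero : (frameMetric u ℓ y).det ≠ 0 := by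
  rw [frameMetric_eq_one hℓ]; simp

theorem tangentVector_frame (v : Ambient n m) :
    tangentVector u y v = ∑ a, inner ℝ v (dd (ℓ a) u y) • ℓ a := by
  rw [tangentVector_eq (det_frameMetric_ne_zero hℓ), frameMetric_eq_one hℓ, inv_one]
  simp [Matrix.one_apply, ite_smul]

theorem normalPart_frame (v : Ambient n m) :
    normalPart u y v = v - ∑ a, inner ℝ v (dd (ℓ a) u y) • dd (ℓ a) u y := by
  rw [normalPart_eq, tangentVector_frame hℓ]
  simp only [map_sum, map_smul]
  rfl

theorem inner_normalPart_frame (v : Ambient n m) (b : Fin n) :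
    inner ℝ (normalPart u y v) (dd (ℓ b) u y) = 0 := by
  rw [normalPart_frame hℓ, inner_sub_left, sum_inner]
  simp only [real_inner_smul_left, orthonormal_iff_ite.1 hℓ]
  simp

theorem normalPart_eq_zero_iff (v : Ambient n m) :
    normalPart u y v = 0 ↔ ∀ β, (∀ b, inner ℝ (dd (ℓ b) u y) β = 0) → inner ℝ v β = 0 := by
  constructor
  · intro h β hβ
    rw [normalPart_frame hℓ, sub_eq_zero] at h
    rw [h, sum_inner]
    simp [real_inner_smul_left, hβ]
  · intro h
    have h0 : ∀ b, inner ℝ (dd (ℓ b) u y) (normalPart u y v) = 0 := fun b => by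
      rw [real_inner_comm, inner_normalPart_frame hℓ]
    have h1 := h (normalPart u y v) h0
    have h2 : inner ℝ (normalPart u y v) (normalPart u y v) = 0 := by
      conv_lhs => enter [2]; rw [normalPart_frame hℓ]
      rw [inner_sub_left, h1, sum_inner]
      simp [real_inner_smul_left, h0]
    exact inner_self_eq_zero.1 h2

theorem secondFFNormSq_frame (hu : ContDiffAt ℝ ∞ u y) :
    secondFFNormSq u y = ∑ a, ∑ b, ‖frameB u ℓ y a b‖ ^ 2 := by
  have h2 : ContDiffAt ℝ 2 u y := contDiffAt_two hu
  have hne := det_frameMetric_ne_zero hℓ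
  set B := (hessianBilin u y).compr₂ (normalPartLin u y) with hB
  have hBe : ∀ v w, B v w = normalPart u y (dd v (dd w u) y) := fun v w => by
    simp only [hB, LinearMap.compr₂_apply, hessianBilin_apply h2, normalPartLin_apply]
  have hin : ∀ v w : Model n, ∑ j, ∑ l, invMetric u y j l •
      inner ℝ (B v (EuclideanSpace.single j 1)) (B w (EuclideanSpace.single l 1)) =
      ∑ b, inner ℝ (B v (ℓ b)) (B w (ℓ b)) := by
    intro v w
    have := sum_invMetric hne (LinearMap.mk₂ ℝ (fun x z : Model n => inner ℝ (B v x) (B w z))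
      (by intros; simp [inner_add_left]) (by intros; simp [real_inner_smul_left])
      (by intros; simp [inner_add_right]) (by intros; simp [real_inner_smul_right]))
    rw [frameMetric_eq_one hℓ, inv_one] at this
    simpa [Matrix.one_apply] using this
  have hout := sum_invMetric hne (LinearMap.mk₂ ℝ
    (fun v w : Model n => ∑ b, inner ℝ (B v (ℓ b)) (B w (ℓ b)))
      (by intros; simp [inner_add_left, Finset.sum_add_distrib])
      (by intros; simp [real_inner_smul_left, Finset.mul_sum])
      (by intros; simp [inner_add_right, Finset.sum_add_distrib])
      (by intros; simp [real_inner_smul_right, Finset.mul_sum]))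
  simp only [LinearMap.mk₂_apply, ← hin] at hout
  rw [frameMetric_eq_one hℓ, inv_one] at hout
  calc secondFFNormSq u y = ∑ i, ∑ k, invMetric u y i k • ∑ j, ∑ l, invMetric u y j l •
        inner ℝ (B (EuclideanSpace.single i 1) (EuclideanSpace.single j 1))
          (B (EuclideanSpace.single k 1) (EuclideanSpace.single l 1)) := by
        unfold secondFFNormSq
        refine Finset.sum_congr rfl fun i _ => ?_
        rw [Finset.sum_comm]
        refine Finset.sum_congr rfl fun k _ => ?_
        simp only [smul_eq_mul, hBe, Finset.mul_sum]
        refine Finset.sum_congr rfl fun j _ => Finset.sum_congr rfl fun l _ => ?_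
        rw [mul_assoc]; rfl
    _ = _ := hout
    _ = _ := by
        simp only [hin]
        simp [Matrix.one_apply, frameB, hBe]

theorem meanCurvature_frame (hu : ContDiffAt ℝ 2 u y) :
    meanCurvature u y = ∑ a, frameB u ℓ y a a := by
  rw [meanCurvature_eq_sum (det_frameMetric_ne_zero hℓ) hu, frameMetric_eq_one hℓ, inv_one]
  simp [Matrix.one_apply, ite_smul]

theorem localLaplacian_frame {φ : Model n → ℝ} (hu : ContDiffAt ℝ ∞ u y)
    (hφ : ContDiffAt ℝ ∞ φ y) :
    localLaplacian u φ y = ∑ a, (dd (ℓ a) (dd (ℓ a) φ) y -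
      ∑ b, inner ℝ (dd (ℓ a) (dd (ℓ a) u) y) (dd (ℓ b) u y) * dd (ℓ b) φ y) := by
  rw [localLaplacian_eq_sum (det_frameMetric_ne_zero hℓ) (contDiffAt_two hu)
    (contDiffAt_two hφ), frameMetric_eq_one hℓ, inv_one]
  have : ∀ v : Ambient n m, dd (tangentVector u y v) φ y =
      ∑ b, inner ℝ v (dd (ℓ b) u y) * dd (ℓ b) φ y := by
    intro v
    rw [tangentVector_frame hℓ]
    simp [dd]
  simp [Matrix.one_apply, this]

/-- Pairing `H = g^{cd} (∂_c ∂_d u)^⊥` with a fixed vector `β`, normal at `y`, and differentiating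
at `y` gives zero. This trades the traced third derivatives of `u` for products of second
derivatives: the first sum comes from differentiating `g⁻¹`, the second from the normal projection.
-/
theorem parallel_frame (hu : ContDiffAt ℝ ∞ u y)
    (hpar : ∀ i, normalPart u y (pd i (meanCurvature u) y) = 0) {β : Ambient n m}
    (hβ : ∀ b, inner ℝ (dd (ℓ b) u y) β = 0) (v : Model n) :
    ∑ c, inner ℝ (dd v (dd (ℓ c) (dd (ℓ c) u)) y) β =
      ∑ c, ∑ d, (inner ℝ (dd v (dd (ℓ c) u) y) (dd (ℓ d) u y) +
          inner ℝ (dd (ℓ c) u y) (dd v (dd (ℓ d) u) y)) *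
            inner ℝ (dd (ℓ c) (dd (ℓ d) u) y) β +
      ∑ c, ∑ b, inner ℝ (dd (ℓ c) (dd (ℓ c) u) y) (dd (ℓ b) u y) *
        inner ℝ (dd v (dd (ℓ b) u) y) β := by
  have hne := det_frameMetric_ne_zero hℓ
  have hH : inner ℝ (dd v (meanCurvature u) y) β = 0 := by
    rw [dd_eq_sum_pd, sum_inner]
    refine Finset.sum_eq_zero fun i _ => ?_
    rw [real_inner_smul_left, (normalPart_eq_zero_iff hℓ _).1 (hpar i) β hβ, mul_zero]
  have hd1 : HasDerivAt (fun s : ℝ => inner ℝ (meanCurvature u (y + s • v)) β) 0 0 := by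
    have := (hasDerivAt_line_zero (v := v) (differentiableAt_of_top
      (contDiffAt_meanCurvature hu hne))).inner ℝ (hasDerivAt_const (0 : ℝ) β)
    simpa [hH] using this
  have hf : ∀ a, HasDerivAt (fun s : ℝ => dd (ℓ a) u (y + s • v)) (dd v (dd (ℓ a) u) y) 0 :=
    fun a => hasDerivAt_line_zero (differentiableAt_of_top (contDiffAt_dd hu _))
  have hS : ∀ a b, HasDerivAt (fun s : ℝ => dd (ℓ a) (dd (ℓ b) u) (y + s • v))
      (dd v (dd (ℓ a) (dd (ℓ b) u)) y) 0 :=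
    fun a b => hasDerivAt_line_zero (differentiableAt_of_top
      (contDiffAt_dd (contDiffAt_dd hu _) _))
  obtain ⟨g', hg'⟩ : ∃ g' : Matrix (Fin n) (Fin n) ℝ, ∀ c d, g' c d =
      inner ℝ (dd v (dd (ℓ c) u) y) (dd (ℓ d) u y) +
        inner ℝ (dd (ℓ c) u y) (dd v (dd (ℓ d) u) y) :=
    ⟨Matrix.of fun c d => _, fun c d => rfl⟩
  have hg : ∀ c d, HasDerivAt (fun s : ℝ => frameMetric u ℓ (y + s • v) c d) (g' c d) 0 := by
    intro c d
    rw [hg']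
    have := (hf c).inner ℝ (hf d)
    simpa [add_comm, frameMetric] using this
  have hγ := hasDerivAt_inv_of_eq_one (X := fun s : ℝ => frameMetric u ℓ (y + s • v))
    (by simpa using frameMetric_eq_one hℓ) hg
  have hfβ : ∀ a, HasDerivAt (fun s : ℝ => inner ℝ (dd (ℓ a) u (y + s • v)) β)
      (inner ℝ (dd v (dd (ℓ a) u) y) β) 0 := fun a => by
    simpa using (hf a).inner ℝ (hasDerivAt_const (0 : ℝ) β)
  have hSβ : ∀ a b, HasDerivAt (fun s : ℝ => inner ℝ (dd (ℓ a) (dd (ℓ b) u) (y + s • v)) β)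
      (inner ℝ (dd v (dd (ℓ a) (dd (ℓ b) u)) y) β) 0 := fun a b => by
    simpa using (hS a b).inner ℝ (hasDerivAt_const (0 : ℝ) β)
  -- Because `β` is normal at `y`, only the derivative of the last factor survives.
  have hT : ∀ c d a b, HasDerivAt (fun s : ℝ => (frameMetric u ℓ (y + s • v))⁻¹ a b *
      inner ℝ (dd (ℓ c) (dd (ℓ d) u) (y + s • v)) (dd (ℓ b) u (y + s • v)) *
      inner ℝ (dd (ℓ a) u (y + s • v)) β)
      ((1 : Matrix (Fin n) (Fin n) ℝ) a b * inner ℝ (dd (ℓ c) (dd (ℓ d) u) y) (dd (ℓ b) u y) *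
        inner ℝ (dd v (dd (ℓ a) u) y) β) 0 := by
    intro c d a b
    refine (((hγ a b).mul ((hS c d).inner ℝ (hf b))).mul (hfβ a)).congr_deriv ?_
    simp [hβ, frameMetric_eq_one hℓ]
  have hd2 : HasDerivAt (fun s : ℝ => inner ℝ (meanCurvature u (y + s • v)) β)
      (∑ c, ∑ d, ((-g') c d * inner ℝ (dd (ℓ c) (dd (ℓ d) u) y) β +
        (1 : Matrix (Fin n) (Fin n) ℝ) c d * (inner ℝ (dd v (dd (ℓ c) (dd (ℓ d) u)) y) β -
          ∑ a, ∑ b, (1 : Matrix (Fin n) (Fin n) ℝ) a b *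
            inner ℝ (dd (ℓ c) (dd (ℓ d) u) y) (dd (ℓ b) u y) *
              inner ℝ (dd v (dd (ℓ a) u) y) β))) 0 := by
    have e : (fun s : ℝ => inner ℝ (meanCurvature u (y + s • v)) β) =ᶠ[nhds 0]
        fun s => ∑ c, ∑ d, (frameMetric u ℓ (y + s • v))⁻¹ c d *
          (inner ℝ (dd (ℓ c) (dd (ℓ d) u) (y + s • v)) β -
            ∑ a, ∑ b, (frameMetric u ℓ (y + s • v))⁻¹ a b *
              inner ℝ (dd (ℓ c) (dd (ℓ d) u) (y + s • v)) (dd (ℓ b) u (y + s • v)) *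
              inner ℝ (dd (ℓ a) u (y + s • v)) β) := by
      filter_upwards [(tendsto_line y v).eventually (eventually_det_frameMetric_ne hu hne),
        (tendsto_line y v).eventually (eventually_contDiffAt hu 2)] with s h1 h2
      rw [meanCurvature_eq_sum h1 h2]
      simp only [frameB, normalPart_eq_sum h1, sum_inner, real_inner_smul_left, inner_sub_left]
    refine HasDerivAt.congr_of_eventuallyEq ?_ e
    refine HasDerivAt.fun_sum fun c _ => HasDerivAt.fun_sum fun d _ => ?_
    refine ((hγ c d).mul ((hSβ c d).sub (HasDerivAt.fun_sum fun a _ =>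
      HasDerivAt.fun_sum fun b _ => hT c d a b))).congr_deriv ?_
    simp [hβ, frameMetric_eq_one hℓ]
  have := hd2.unique hd1
  simp only [Matrix.one_apply, ite_mul, one_mul, zero_mul, Finset.sum_add_distrib,
    Finset.sum_ite_eq, Finset.mem_univ, if_true, Finset.sum_sub_distrib, Matrix.neg_apply,
    neg_mul, Finset.sum_neg_distrib, hg'] at this
  linarith

end

end GaussImage

/-! ### The function `w` on a submanifold: its two-jet and its Laplacian. -/

namespace GaussImage

section

variable {n m : ℕ} {u : Model n → Ambient n m} {ℓ : Fin n → Model n} {y : Model n}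

/-- `w` of the tangent plane of `u` (oriented by the coordinates) and the plane with frame `p`. -/
noncomputable def wLocal (u : Model n → Ambient n m) (p : Fin n → Ambient n m) (y : Model n) : ℝ :=
  (wMatrix (fun i => pd i u y) p).det / √(metric u y).det

/-- The pairing matrix of the frame `ℓ` with `p`. -/
noncomputable def frameW (u : Model n → Ambient n m) (ℓ : Fin n → Model n)
    (p : Fin n → Ambient n m) (y : Model n) : Matrix (Fin n) (Fin n) ℝ :=
  wMatrix (fun a => dd (ℓ a) u y) p

theorem frameW_eq (p : Fin n → Ambient n m) :
    frameW u ℓ p y = frameMatrix ℓ * wMatrix (fun i => pd i u y) p := by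
  ext a b
  simp only [frameW, wMatrix, frameMatrix, Matrix.of_apply, Matrix.mul_apply, dd_eq_sum_pd (ℓ a),
    sum_inner, real_inner_smul_left]

/-- The frame may reverse orientation; the sign `σ` is that of `det ℓ` and does not vary with the
point, so it does not affect differentiation. -/
theorem exists_sign_wLocal (h : (frameMatrix ℓ).det ≠ 0) (u : Model n → Ambient n m)
    (p : Fin n → Ambient n m) : ∃ σ : ℝ, σ ^ 2 = 1 ∧ ∀ y, wLocal u p y =
      σ * ((frameW u ℓ p y).det / √(frameMetric u ℓ y).det) := by
  have h2 : |(frameMatrix ℓ).det| ≠ 0 := abs_ne_zero.2 h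
  have h3 : ((frameMatrix ℓ).det / |(frameMatrix ℓ).det|) ^ 2 = 1 := by
    rw [div_pow, sq_abs, div_self (pow_ne_zero 2 h)]
  refine ⟨(frameMatrix ℓ).det / |(frameMatrix ℓ).det|, h3, fun y => ?_⟩
  rw [frameW_eq, frameMetric_eq, Matrix.det_mul, Matrix.det_mul, Matrix.det_mul,
    Matrix.det_transpose, show (frameMatrix ℓ).det * (metric u y).det * (frameMatrix ℓ).det =
      (frameMatrix ℓ).det ^ 2 * (metric u y).det by ring, Real.sqrt_mul (sq_nonneg _),
    Real.sqrt_sq_eq_abs, mul_div_mul_comm, ← mul_assoc, ← sq, h3, one_mul, wLocal]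

theorem contDiffAt_wLocal (hu : ContDiffAt ℝ ∞ u y) (h : 0 < (metric u y).det)
    (p : Fin n → Ambient n m) : ContDiffAt ℝ ∞ (wLocal u p) y := by
  refine ContDiffAt.div (contDiffAt_det fun i j => ?_) (ContDiffAt.sqrt
    (contDiffAt_det fun i j => ?_) h.ne') (Real.sqrt_ne_zero'.2 h)
  · exact (contDiffAt_dd hu _).inner ℝ contDiffAt_const
  · exact (contDiffAt_dd hu _).inner ℝ (contDiffAt_dd hu _)

theorem det_frameMatrix_ne_zero (hℓ : Orthonormal ℝ fun a => dd (ℓ a) u y) :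
    (frameMatrix ℓ).det ≠ 0 := by
  intro h
  apply det_frameMetric_ne_zero hℓ
  rw [frameMetric_eq, Matrix.det_mul, Matrix.det_mul, h]
  ring

theorem det_metric_pos (hℓ : Orthonormal ℝ fun a => dd (ℓ a) u y) : 0 < (metric u y).det := by
  have h := frameMetric_eq_one hℓ
  rw [frameMetric_eq] at h
  have h1 := congrArg Matrix.det h
  rw [Matrix.det_mul, Matrix.det_mul, Matrix.det_transpose, Matrix.det_one] at h1
  have := det_frameMatrix_ne_zero hℓ
  have h2 : 0 < (frameMatrix ℓ).det ^ 2 := by positivity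
  by_contra! h3
  nlinarith

/-- The normal parts of the basis `∑_c M_ca p_c` of the plane `p` dual to the frame `ℓ`. -/
noncomputable def dualNormal (u : Model n → Ambient n m) (ℓ : Fin n → Model n)
    (p : Fin n → Ambient n m) (M : Matrix (Fin n) (Fin n) ℝ) (y : Model n) (a : Fin n) :
    Ambient n m :=
  ∑ c, M c a • p c - dd (ℓ a) u y

section

variable {p : Fin n → Ambient n m} {M : Matrix (Fin n) (Fin n) ℝ}

theorem inner_dual (hM : frameW u ℓ p y * M = 1) (a b : Fin n) :
    inner ℝ (dd (ℓ a) u y) (∑ c, M c b • p c) = (1 : Matrix (Fin n) (Fin n) ℝ) a b := by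
  rw [← hM, Matrix.mul_apply, inner_sum]
  refine Finset.sum_congr rfl fun c _ => ?_
  rw [real_inner_smul_right, mul_comm]
  rfl

theorem inner_dualNormal (hℓ : Orthonormal ℝ fun a => dd (ℓ a) u y)
    (hM : frameW u ℓ p y * M = 1) (a b : Fin n) :
    inner ℝ (dd (ℓ a) u y) (dualNormal u ℓ p M y b) = 0 := by
  rw [dualNormal, inner_sub_right, inner_dual hM, orthonormal_iff_ite.1 hℓ, Matrix.one_apply,
    sub_self]

theorem inner_frameB_dualNormal (hℓ : Orthonormal ℝ fun a => dd (ℓ a) u y)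
    (hM : frameW u ℓ p y * M = 1) (a b c : Fin n) :
    inner ℝ (frameB u ℓ y a b) (dualNormal u ℓ p M y c) =
      inner ℝ (dd (ℓ a) (dd (ℓ b) u) y) (dualNormal u ℓ p M y c) := by
  rw [frameB, normalPart_frame hℓ, inner_sub_left, sum_inner]
  simp [real_inner_smul_left, inner_dualNormal hℓ hM]

theorem norm_sq_eq_frame (hℓ : Orthonormal ℝ fun a => dd (ℓ a) u y) (v : Ambient n m) :
    ‖v‖ ^ 2 = ∑ b, inner ℝ v (dd (ℓ b) u y) ^ 2 + ‖normalPart u y v‖ ^ 2 := by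
  have h1 : v = normalPart u y v + ∑ a, inner ℝ v (dd (ℓ a) u y) • dd (ℓ a) u y := by
    rw [normalPart_frame hℓ]; simp
  have h2 : inner ℝ (normalPart u y v) (∑ a, inner ℝ v (dd (ℓ a) u y) • dd (ℓ a) u y) = 0 := by
    simp [inner_sum, real_inner_smul_right, inner_normalPart_frame hℓ]
  have h3 : ‖∑ a, inner ℝ v (dd (ℓ a) u y) • dd (ℓ a) u y‖ ^ 2 =
      ∑ b, inner ℝ v (dd (ℓ b) u y) ^ 2 := by
    rw [← real_inner_self_eq_norm_sq, hℓ.inner_sum]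
    simp [sq]
  conv_lhs => rw [h1]
  rw [norm_add_sq_real, h2, h3]
  ring

/-- Bookkeeping for `tr X'' - tr (X'²)` minus half the same quantity for the metric. `Γ` holds
tangential and `K` normal components of second derivatives, `A` and `S` components of third
derivatives, and `N` the norms `|B|²`; the terms in `S` and those quadratic in `Γ` cancel. -/
theorem jet_algebra (A S N : Fin n → ℝ) (Γ K : Fin n → Fin n → ℝ) :
    ∑ i, (A i + S i) - ∑ i, ∑ j, (K i j + Γ i j) * (K j i + Γ j i) -
      1 / 2 * (∑ x, (S x + (∑ b, Γ x b ^ 2 + N x) + (∑ b, Γ x b ^ 2 + N x + S x)) -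
        ∑ x, ∑ z, (Γ z x + Γ x z) * (Γ x z + Γ z x)) =
    ∑ a, A a - 2 * ∑ x, ∑ z, Γ x z * K z x - ∑ x, ∑ z, K x z * K z x - ∑ a, N a := by
  have h1 : ∑ i, ∑ j, K i j * Γ j i = ∑ i, ∑ j, Γ i j * K j i := by
    rw [Finset.sum_comm]
    exact Finset.sum_congr rfl fun _ _ => Finset.sum_congr rfl fun _ _ => mul_comm _ _
  have h2 : ∑ i, ∑ j, Γ j i * Γ j i = ∑ i, ∑ j, Γ i j ^ 2 := by
    rw [Finset.sum_comm]
    exact Finset.sum_congr rfl fun _ _ => Finset.sum_congr rfl fun _ _ => (sq _).symm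
  have h3 : ∑ i, ∑ j, Γ j i * Γ i j = ∑ i, ∑ j, Γ i j * Γ j i :=
    Finset.sum_congr rfl fun _ _ => Finset.sum_congr rfl fun _ _ => mul_comm _ _
  simp only [add_mul, mul_add, Finset.sum_add_distrib, h1, h2, h3]
  simp only [← sq]
  ring

/-- The first two derivatives of `wLocal` along the frame direction `ℓ c`. -/
theorem wLocal_jet (hu : ContDiffAt ℝ ∞ u y) (hℓ : Orthonormal ℝ fun a => dd (ℓ a) u y)
    (hM : frameW u ℓ p y * M = 1) (c : Fin n) :
    dd (ℓ c) (wLocal u p) y =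
      wLocal u p y * ∑ a, inner ℝ (frameB u ℓ y c a) (dualNormal u ℓ p M y a) ∧
    dd (ℓ c) (dd (ℓ c) (wLocal u p)) y = wLocal u p y *
      ((∑ a, inner ℝ (frameB u ℓ y c a) (dualNormal u ℓ p M y a)) ^ 2 +
      (∑ a, inner ℝ (dd (ℓ c) (dd (ℓ c) (dd (ℓ a) u)) y) (dualNormal u ℓ p M y a) -
        2 * ∑ a, ∑ b, inner ℝ (dd (ℓ c) (dd (ℓ a) u) y) (dd (ℓ b) u y) *
          inner ℝ (frameB u ℓ y c b) (dualNormal u ℓ p M y a) -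
        ∑ a, ∑ b, inner ℝ (frameB u ℓ y c a) (dualNormal u ℓ p M y b) *
          inner ℝ (frameB u ℓ y c b) (dualNormal u ℓ p M y a) -
        ∑ a, ‖frameB u ℓ y c a‖ ^ 2)) := by
  have hdet := det_frameMatrix_ne_zero hℓ
  obtain ⟨σ, -, hσ⟩ := exists_sign_wLocal hdet u p
  obtain ⟨q, hq⟩ : ∃ q : Fin n → Ambient n m, ∀ b, q b = ∑ c, M c b • p c := ⟨_, fun _ => rfl⟩
  obtain ⟨X, hX⟩ : ∃ X : ℝ → Matrix (Fin n) (Fin n) ℝ,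
    X = fun s => frameW u ℓ p (y + s • ℓ c) * M := ⟨_, rfl⟩
  have hXe : ∀ s a b, X s a b = inner ℝ (dd (ℓ a) u (y + s • ℓ c)) (q b) := by
    intro s a b
    rw [hX, hq, inner_sum]
    simp only [Matrix.mul_apply]
    refine Finset.sum_congr rfl fun d _ => ?_
    rw [real_inner_smul_right, mul_comm]
    rfl
  have hX0 : X 0 = 1 := by rw [hX]; simpa using hM
  have hf : ∀ a, ∀ᶠ s : ℝ in nhds 0, HasDerivAt (fun s : ℝ => dd (ℓ a) u (y + s • ℓ c))
      (dd (ℓ c) (dd (ℓ a) u) (y + s • ℓ c)) s :=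
    fun a => eventually_hasDerivAt_line (contDiffAt_dd hu _)
  have hS : ∀ a, HasDerivAt (fun s : ℝ => dd (ℓ c) (dd (ℓ a) u) (y + s • ℓ c))
      (dd (ℓ c) (dd (ℓ c) (dd (ℓ a) u)) y) 0 :=
    fun a => hasDerivAt_line_zero (differentiableAt_of_top
      (contDiffAt_dd (contDiffAt_dd hu _) _))
  have hf' := Filter.eventually_all.2 hf
  obtain ⟨lX, hlX1, hlX0, hlX2⟩ := hasDerivAt_log_det (X := X)
    (X1 := fun s => Matrix.of fun a b => inner ℝ (dd (ℓ c) (dd (ℓ a) u) (y + s • ℓ c)) (q b))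
    (X2 := Matrix.of fun a b => inner ℝ (dd (ℓ c) (dd (ℓ c) (dd (ℓ a) u)) y) (q b)) hX0
    (by
      filter_upwards [hf'] with s hs a b
      simp only [hXe, Matrix.of_apply]
      simpa using (hs a).inner ℝ (hasDerivAt_const s (q b)))
    (fun a b => by simpa using (hS a).inner ℝ (hasDerivAt_const (0 : ℝ) (q b)))
  obtain ⟨lg, hlg1, hlg0, hlg2⟩ := hasDerivAt_log_det
    (X := fun s : ℝ => frameMetric u ℓ (y + s • ℓ c))
    (X1 := fun s => Matrix.of fun a b =>
      inner ℝ (dd (ℓ a) u (y + s • ℓ c)) (dd (ℓ c) (dd (ℓ b) u) (y + s • ℓ c)) +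
        inner ℝ (dd (ℓ c) (dd (ℓ a) u) (y + s • ℓ c)) (dd (ℓ b) u (y + s • ℓ c)))
    (X2 := Matrix.of fun a b =>
      (inner ℝ (dd (ℓ a) u y) (dd (ℓ c) (dd (ℓ c) (dd (ℓ b) u)) y) +
        inner ℝ (dd (ℓ c) (dd (ℓ a) u) y) (dd (ℓ c) (dd (ℓ b) u) y)) +
      (inner ℝ (dd (ℓ c) (dd (ℓ a) u) y) (dd (ℓ c) (dd (ℓ b) u) y) +
        inner ℝ (dd (ℓ c) (dd (ℓ c) (dd (ℓ a) u)) y) (dd (ℓ b) u y)))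
    (by simpa using frameMetric_eq_one hℓ)
    (by
      filter_upwards [hf'] with s hs a b
      exact (hs a).inner ℝ (hs b))
    (fun a b => by
      have h1 := ((hf a).self_of_nhds.inner ℝ (hS b)).add
        ((hS a).inner ℝ (hf b).self_of_nhds)
      refine h1.congr_deriv ?_
      simp)
  have hcX : ContinuousAt (fun s => (X s).det) 0 := (hasDerivAt_det (X := X) (fun a b => by
    simp only [hXe]
    exact (hf a).self_of_nhds.inner ℝ (hasDerivAt_const (0 : ℝ) (q b)))).continuousAt
  have hXpos : ∀ᶠ s in nhds 0, 0 < (X s).det :=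
    hcX.eventually_const_lt (by simp [hX0])
  have hgpos : ∀ᶠ s : ℝ in nhds 0, 0 < (frameMetric u ℓ (y + s • ℓ c)).det :=
    (tendsto_line y (ℓ c)).eventually ((contDiffAt_det
      (contDiffAt_frameMetric hu)).continuousAt.eventually_const_lt
        (by simp [frameMetric_eq_one hℓ]))
  have hMd : (frameW u ℓ p y).det * M.det = 1 := by rw [← Matrix.det_mul, hM, Matrix.det_one]
  have hW0 : wLocal u p y = σ * (frameW u ℓ p y).det := by
    rw [hσ, frameMetric_eq_one hℓ]; simp
  -- Multiplication by the constant matrix `M` makes the pairing matrix equal to 1 at `s = 0`, so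
  -- `hasDerivAt_log_det` applies to it as well as to the metric.
  have hWe : (fun s : ℝ => wLocal u p (y + s • ℓ c)) =ᶠ[nhds 0] fun s => wLocal u p y *
      Real.exp (Real.log (X s).det -
        1 / 2 * Real.log (frameMetric u ℓ (y + s • ℓ c)).det) := by
    filter_upwards [hXpos, hgpos] with s h1 h2
    rw [Real.exp_sub, Real.exp_log h1, one_div, mul_comm (2⁻¹ : ℝ), Real.exp_mul,
      Real.exp_log h2, ← one_div, ← Real.sqrt_eq_rpow, hσ, hW0, hX, Matrix.det_mul]
    calc _ = σ * ((frameW u ℓ p (y + s • ℓ c)).det / √(frameMetric u ℓ (y + s • ℓ c)).det) *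
          ((frameW u ℓ p y).det * M.det) := by rw [hMd, mul_one]
      _ = _ := by ring
  have hd1 : ∀ᶠ s : ℝ in nhds 0, HasDerivAt (fun s : ℝ => wLocal u p (y + s • ℓ c))
      (wLocal u p (y + s • ℓ c) * (lX s - 1 / 2 * lg s)) s := by
    filter_upwards [hWe.eventuallyEq_nhds, hlX1, hlg1] with s h1 h2 h3
    have h4 := ((h2.sub (h3.const_mul (1 / 2))).exp.const_mul (wLocal u p y)).congr_of_eventuallyEq h1
    refine h4.congr_deriv ?_
    have h5 : wLocal u p (y + s • ℓ c) = _ := h1.self_of_nhds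
    rw [h5]
    simp only [Pi.sub_apply]
    ring
  have hd2 : HasDerivAt (fun s : ℝ => wLocal u p (y + s • ℓ c) * (lX s - 1 / 2 * lg s)) _ 0 :=
    hd1.self_of_nhds.mul (hlX2.sub (hlg2.const_mul (1 / 2)))
  obtain ⟨r1, r2⟩ := dd_of_line (contDiffAt_wLocal hu (det_metric_pos hℓ) p) hd1 hd2
  have hqα : ∀ b, q b = dualNormal u ℓ p M y b + dd (ℓ b) u y := fun b => by
    rw [dualNormal, hq]; simp
  have hl0 : lX 0 - 1 / 2 * lg 0 =
      ∑ a, inner ℝ (frameB u ℓ y c a) (dualNormal u ℓ p M y a) := by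
    rw [hlX0, hlg0, Matrix.trace, Matrix.trace, Finset.mul_sum, ← Finset.sum_sub_distrib]
    refine Finset.sum_congr rfl fun a _ => ?_
    simp only [Matrix.diag_apply, Matrix.of_apply, zero_smul, add_zero]
    rw [inner_frameB_dualNormal hℓ hM, hqα, inner_add_right, real_inner_comm (dd (ℓ a) u y)]
    ring
  refine ⟨by rw [r1, ← hl0]; simp, ?_⟩
  rw [r2]
  simp only [zero_smul, add_zero, hl0]
  rw [mul_assoc, ← sq, ← mul_add]
  congr 2
  simp only [Matrix.trace, Matrix.diag_apply, Matrix.mul_apply, Matrix.of_apply, hqα,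
    inner_add_right, inner_frameB_dualNormal hℓ hM]
  have hn : ∀ a, inner ℝ (dd (ℓ c) (dd (ℓ a) u) y) (dd (ℓ c) (dd (ℓ a) u) y) =
      ∑ b, inner ℝ (dd (ℓ c) (dd (ℓ a) u) y) (dd (ℓ b) u y) ^ 2 + ‖frameB u ℓ y c a‖ ^ 2 :=
    fun a => by rw [real_inner_self_eq_norm_sq, norm_sq_eq_frame hℓ]; rfl
  have hc1 : ∀ a b, inner ℝ (dd (ℓ a) u y) (dd (ℓ c) (dd (ℓ b) u) y) =
      inner ℝ (dd (ℓ c) (dd (ℓ b) u) y) (dd (ℓ a) u y) := fun a b => real_inner_comm _ _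
  have hc2 : ∀ a b, inner ℝ (dd (ℓ a) u y) (dd (ℓ c) (dd (ℓ c) (dd (ℓ b) u)) y) =
      inner ℝ (dd (ℓ c) (dd (ℓ c) (dd (ℓ b) u)) y) (dd (ℓ a) u y) := fun a b => real_inner_comm _ _
  simp only [hn, hc1, hc2]
  exact jet_algebra (fun a => inner ℝ (dd (ℓ c) (dd (ℓ c) (dd (ℓ a) u)) y) (dualNormal u ℓ p M y a))
    (fun a => inner ℝ (dd (ℓ c) (dd (ℓ c) (dd (ℓ a) u)) y) (dd (ℓ a) u y))
    (fun a => ‖frameB u ℓ y c a‖ ^ 2)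
    (fun a b => inner ℝ (dd (ℓ c) (dd (ℓ a) u) y) (dd (ℓ b) u y))
    (fun a b => inner ℝ (dd (ℓ c) (dd (ℓ a) u) y) (dualNormal u ℓ p M y b))

/-- With `hT`, the content of `parallel_frame`, the third derivatives in `Δw` reduce to the
first-order Christoffel term, which the Laplacian subtracts. This is the only use of parallel mean
curvature in the formula for `Δw`. -/
theorem laplacian_algebra (Γ K : Fin n → Fin n → Fin n → ℝ) (hΓ : ∀ a b c, Γ a b c = Γ b a c)
    (hK : ∀ a b c, K a b c = K b a c) (T : Fin n → Fin n → ℝ)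
    (hT : ∀ a, ∑ c, T c a = ∑ c, ∑ d, (Γ a c d + Γ a d c) * K c d a +
      ∑ c, ∑ b, Γ c c b * K a b a) :
    ∑ c, (∑ a, T c a - 2 * ∑ a, ∑ b, Γ c a b * K c b a) =
      ∑ c, ∑ b, Γ c c b * ∑ a, K b a a := by
  rw [Finset.sum_sub_distrib, Finset.sum_comm]
  simp only [hT, Finset.sum_add_distrib, add_mul]
  have h1 : ∀ a, ∑ c, ∑ d, Γ a d c * K c d a = ∑ c, ∑ d, Γ a c d * K c d a := by
    intro a
    rw [Finset.sum_comm]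
    exact Finset.sum_congr rfl fun _ _ => Finset.sum_congr rfl fun _ _ => by rw [hK]
  have h2 : ∑ c, 2 * ∑ a, ∑ b, Γ c a b * K c b a = 2 * ∑ a, ∑ c, ∑ d, Γ a c d * K c d a := by
    rw [← Finset.mul_sum, Finset.sum_comm]
    congr 1
    refine Finset.sum_congr rfl fun a _ => Finset.sum_congr rfl fun c _ =>
      Finset.sum_congr rfl fun d _ => ?_
    rw [hΓ]
  have h3 : ∑ a, ∑ c, ∑ b, Γ c c b * K a b a = ∑ c, ∑ b, Γ c c b * ∑ a, K b a a := by
    rw [Finset.sum_comm]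
    refine Finset.sum_congr rfl fun c _ => ?_
    rw [Finset.sum_comm]
    refine Finset.sum_congr rfl fun b _ => ?_
    rw [Finset.mul_sum]
    exact Finset.sum_congr rfl fun a _ => by rw [hK]
  rw [h2, h3]
  simp only [h1]
  ring

/-- The Laplacian of `w` on a submanifold with parallel mean curvature. -/
theorem localLaplacian_wLocal (hu : ContDiffAt ℝ ∞ u y)
    (hℓ : Orthonormal ℝ fun a => dd (ℓ a) u y) (hM : frameW u ℓ p y * M = 1)
    (hpar : ∀ i, normalPart u y (pd i (meanCurvature u) y) = 0) :
    localLaplacian u (wLocal u p) y = wLocal u p y *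
      (∑ c, (∑ a, inner ℝ (frameB u ℓ y c a) (dualNormal u ℓ p M y a)) ^ 2 -
        ∑ a, ∑ b, ‖frameB u ℓ y a b‖ ^ 2 -
        crossTrace (frameB u ℓ y) (dualNormal u ℓ p M y)) := by
  rw [localLaplacian_frame hℓ hu (contDiffAt_wLocal hu (det_metric_pos hℓ) p)]
  simp only [fun c => (wLocal_jet hu hℓ hM c).1, fun c => (wLocal_jet hu hℓ hM c).2]
  have hB : ∀ a b c, inner ℝ (frameB u ℓ y a b) (dualNormal u ℓ p M y c) =
      inner ℝ (frameB u ℓ y b a) (dualNormal u ℓ p M y c) := fun a b c => by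
    rw [frameB_comm hu]
  -- Commuting partial derivatives plays the role of the Codazzi equation.
  have hcomm : ∀ a c, dd (ℓ c) (dd (ℓ c) (dd (ℓ a) u)) y = dd (ℓ a) (dd (ℓ c) (dd (ℓ c) u)) y := by
    intro a c
    have e : dd (ℓ c) (dd (ℓ a) u) =ᶠ[nhds y] dd (ℓ a) (dd (ℓ c) u) := by
      filter_upwards [eventually_contDiffAt hu 2] with z hz
      exact dd_comm hz _ _
    rw [(dd_congr e (ℓ c)).self_of_nhds, dd_comm (contDiffAt_two (contDiffAt_dd hu _))]
  have key := laplacian_algebra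
    (fun a b c => inner ℝ (dd (ℓ a) (dd (ℓ b) u) y) (dd (ℓ c) u y))
    (fun a b c => inner ℝ (frameB u ℓ y a b) (dualNormal u ℓ p M y c))
    (fun a b c => by simp only [dd_comm (contDiffAt_two hu) (ℓ a)]) hB
    (fun c a => inner ℝ (dd (ℓ c) (dd (ℓ c) (dd (ℓ a) u)) y) (dualNormal u ℓ p M y a))
    (fun a => by
      simp only [hcomm]
      rw [parallel_frame hℓ hu hpar (fun b => inner_dualNormal hℓ hM b a)]
      simp only [inner_frameB_dualNormal hℓ hM]
      congr 1
      refine Finset.sum_congr rfl fun c _ => Finset.sum_congr rfl fun d _ => ?_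
      rw [real_inner_comm (dd (ℓ c) u y)])
  simp only [Finset.sum_sub_distrib, ← Finset.mul_sum] at key
  simp only [crossTrace, Finset.sum_sub_distrib, Finset.sum_add_distrib, ← Finset.mul_sum,
    mul_left_comm _ (wLocal u p y)]
  rw [← mul_sub]
  congr 1
  linarith

end

end

end GaussImage

/-! ### Adapted frames, gradient and Laplacian estimates, and the exponential of the angle. -/

namespace GaussImage

section

variable {n m : ℕ} {u : Model n → Ambient n m} {ℓ : Fin n → Model n} {y : Model n}

theorem exists_frame (h : LinearIndependent ℝ fun i => pd i u y) :
    ∃ ℓ : Fin n → Model n, Orthonormal ℝ fun a => dd (ℓ a) u y := by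
  have h1 : ∀ a, ∃ v : Model n, dd v u y =
      InnerProductSpace.gramSchmidtNormed ℝ (fun i => pd i u y) a := by
    intro a
    have : InnerProductSpace.gramSchmidtNormed ℝ (fun i => pd i u y) a ∈
        Submodule.span ℝ (Set.range fun i => pd i u y) := by
      rw [← InnerProductSpace.span_gramSchmidt,
        ← InnerProductSpace.span_gramSchmidtNormed_range]
      exact Submodule.subset_span ⟨a, rfl⟩
    obtain ⟨c, hc⟩ := (Submodule.mem_span_range_iff_exists_fun ℝ).1 this
    refine ⟨WithLp.toLp 2 c, ?_⟩
    rw [dd_eq_sum_pd, ← hc]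
  choose ℓ hℓ using h1
  refine ⟨ℓ, ?_⟩
  simp only [hℓ]
  exact InnerProductSpace.gramSchmidtNormed_orthonormal h

/-- Half of a singular value decomposition: rotating the tangent frame alone suffices, since the
Gram matrix of the dual basis of the plane `p` is `(X Xᵀ)⁻¹`. -/
theorem exists_frame_diagonal (hℓ : Orthonormal ℝ fun a => dd (ℓ a) u y)
    (p : Fin n → Ambient n m) : ∃ ℓ' : Fin n → Model n, (Orthonormal ℝ fun a => dd (ℓ' a) u y) ∧
      ∃ d, frameW u ℓ' p y * (frameW u ℓ' p y).transpose = Matrix.diagonal d := by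
  set X := frameW u ℓ p y with hX
  have hA : (X * X.transpose).IsHermitian := by
    simpa using Matrix.isHermitian_mul_conjTranspose_self X
  obtain ⟨U, hU⟩ : ∃ U : Matrix (Fin n) (Fin n) ℝ, U = hA.eigenvectorUnitary := ⟨_, rfl⟩
  have hUU : U.transpose * U = 1 := by
    have := Unitary.coe_star_mul_self hA.eigenvectorUnitary
    rw [← hU, Matrix.star_eq_conjTranspose, Matrix.conjTranspose_eq_transpose_of_trivial] at this
    exact this
  obtain ⟨D, hD⟩ : ∃ D : Fin n → ℝ, D = hA.eigenvalues := ⟨_, rfl⟩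
  have hs : X * X.transpose = U * Matrix.diagonal D * U.transpose := by
    rw [hD]
    have := hA.spectral_theorem
    rw [Unitary.conjStarAlgAut_apply, ← hU, Matrix.star_eq_conjTranspose,
      Matrix.conjTranspose_eq_transpose_of_trivial] at this
    exact this
  refine ⟨fun a => ∑ b, U b a • ℓ b, ?_, D, ?_⟩
  · have hd : ∀ a, dd (∑ b, U b a • ℓ b) u y = ∑ b, U b a • dd (ℓ b) u y := fun a => by
      simp [dd]
    rw [orthonormal_iff_ite]
    intro a b
    rw [hd, hd, hℓ.inner_sum, ← Matrix.one_apply, ← hUU, Matrix.mul_apply]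
    rfl
  · have : frameW u (fun a => ∑ b, U b a • ℓ b) p y = U.transpose * X := by
      ext a c
      simp [hX, frameW, wMatrix, Matrix.mul_apply, dd, sum_inner, real_inner_smul_left]
    rw [this, Matrix.transpose_mul, Matrix.transpose_transpose,
      show U.transpose * X * (X.transpose * U) = U.transpose * (X * X.transpose) * U by
        simp only [mul_assoc], hs]
    calc _ = (U.transpose * U) * Matrix.diagonal D * (U.transpose * U) := by
          simp only [mul_assoc]
      _ = _ := by rw [hUU, one_mul, mul_one]

/-- A frame adapted to the plane with orthonormal basis `p`. -/
theorem exists_adapted_frame (h : LinearIndependent ℝ fun i => pd i u y)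
    {p : Fin n → Ambient n m} (hp : Orthonormal ℝ p) (hW : wLocal u p y ≠ 0) :
    ∃ (ℓ : Fin n → Model n) (M : Matrix (Fin n) (Fin n) ℝ),
      (Orthonormal ℝ fun a => dd (ℓ a) u y) ∧ frameW u ℓ p y * M = 1 ∧
      (Pairwise fun a b => inner ℝ (dualNormal u ℓ p M y a) (dualNormal u ℓ p M y b) = 0) ∧
      (∏ a, (1 + ‖dualNormal u ℓ p M y a‖ ^ 2)) * wLocal u p y ^ 2 = 1 := by
  obtain ⟨ℓ₀, hℓ₀⟩ := exists_frame h
  obtain ⟨ℓ, hℓ, d, hd⟩ := exists_frame_diagonal hℓ₀ p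
  obtain ⟨σ, hσ2, hσ⟩ := exists_sign_wLocal (det_frameMatrix_ne_zero hℓ) u p
  set X := frameW u ℓ p y with hX
  have hW2 : wLocal u p y = σ * X.det := by
    rw [hσ, frameMetric_eq_one hℓ]; simp [hX]
  have hX0 : X.det ≠ 0 := fun h0 => hW (by rw [hW2, h0, mul_zero])
  have hM : X * X⁻¹ = 1 := Matrix.mul_nonsing_inv _ (isUnit_iff_ne_zero.2 hX0)
  have hM' : X⁻¹ * X = 1 := Matrix.nonsing_inv_mul _ (isUnit_iff_ne_zero.2 hX0)
  set M := X⁻¹ with hMdef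
  -- Each dual basis vector is `e_a + v_a` with `v_a` normal, so its Gram matrix `MᵀM` is `1` plus
  -- that of the `v_a`. Diagonality gives orthogonality, and the determinant gives `∏ (1 + |v_a|²) =
  -- w⁻²`.
  have hG : ∀ a b, inner ℝ (dualNormal u ℓ p M y a) (dualNormal u ℓ p M y b) +
      (1 : Matrix (Fin n) (Fin n) ℝ) a b = (M.transpose * M) a b := by
    intro a b
    have h1 : (M.transpose * M) a b = inner ℝ (∑ c, M c a • p c) (∑ c, M c b • p c) := by
      rw [hp.inner_sum, Matrix.mul_apply]
      rfl
    have h2 : ∀ a, ∑ c, M c a • p c = dualNormal u ℓ p M y a + dd (ℓ a) u y := fun a => by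
      rw [dualNormal]; simp
    rw [h1, h2, h2, inner_add_left, inner_add_right, inner_add_right,
      inner_dualNormal hℓ hM, real_inner_comm (dd (ℓ b) u y) (dualNormal u ℓ p M y a), inner_dualNormal hℓ hM,
      orthonormal_iff_ite.1 hℓ, Matrix.one_apply]
    ring
  have hMX : M.transpose * M * (X * X.transpose) = 1 := by
    rw [mul_assoc, ← mul_assoc M, hM', one_mul, ← Matrix.transpose_mul, hM, Matrix.transpose_one]
  rw [hd] at hMX
  have hent : ∀ a b, (M.transpose * M) a b * d b = (1 : Matrix (Fin n) (Fin n) ℝ) a b := by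
    intro a b
    rw [← hMX, Matrix.mul_diagonal]
  have hd0 : ∀ b, d b ≠ 0 := fun b h0 => by
    have := hent b b
    rw [h0, mul_zero, Matrix.one_apply_eq] at this
    exact zero_ne_one this
  have hoff : ∀ a b, a ≠ b → (M.transpose * M) a b = 0 := fun a b hab => by
    have := hent a b
    rw [Matrix.one_apply_ne hab] at this
    exact (mul_eq_zero.1 this).resolve_right (hd0 b)
  refine ⟨ℓ, M, hℓ, hM, fun a b hab => ?_, ?_⟩
  · have := hG a b
    rwa [hoff a b hab, Matrix.one_apply_ne hab, add_zero] at this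
  · have hdiag : M.transpose * M = Matrix.diagonal fun a => 1 + ‖dualNormal u ℓ p M y a‖ ^ 2 := by
      ext a b
      by_cases hab : a = b
      · subst hab
        rw [← hG, real_inner_self_eq_norm_sq, Matrix.one_apply_eq, Matrix.diagonal_apply_eq,
          add_comm]
      · rw [hoff a b hab, Matrix.diagonal_apply_ne _ hab]
    rw [← Matrix.det_diagonal, ← hdiag, hW2, mul_pow, hσ2, one_mul, Matrix.det_mul,
      Matrix.det_transpose]
    have : M.det * X.det = 1 := by rw [← Matrix.det_mul, hM', Matrix.det_one]
    calc _ = (M.det * X.det) ^ 2 := by ring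
      _ = 1 := by rw [this, one_pow]

/-- `|∇φ|²` for the metric induced by `u`. -/
noncomputable def gradNormSq (u : Model n → Ambient n m) (φ : Model n → ℝ) (y : Model n) : ℝ :=
  ∑ i, ∑ j, invMetric u y i j * (pd i φ y * pd j φ y)

theorem gradNormSq_frame (hℓ : Orthonormal ℝ fun a => dd (ℓ a) u y) (φ : Model n → ℝ) :
    gradNormSq u φ y = ∑ a, dd (ℓ a) φ y ^ 2 := by
  obtain ⟨B, hB⟩ : ∃ B : Model n →ₗ[ℝ] Model n →ₗ[ℝ] ℝ, ∀ v w, B v w = dd v φ y * dd w φ y :=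
    ⟨LinearMap.mk₂ ℝ (fun v w : Model n => dd v φ y * dd w φ y)
      (by intros; simp [dd, add_mul]) (by intros; simp [dd, mul_assoc])
      (by intros; simp [dd, mul_add]) (by intros; simp [dd, mul_left_comm]), fun _ _ => rfl⟩
  have := sum_invMetric (det_frameMetric_ne_zero hℓ) B
  rw [frameMetric_eq_one hℓ, inv_one] at this
  simp only [hB] at this
  refine Eq.trans this ?_
  simp [Matrix.one_apply, sq]

/-- From `∂_c w = w ∑ ⟨B_ca, v_a⟩`, Cauchy–Schwarz leaves the factor `w² ∑ |v_a|²`, which is at most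
`w² ∏ (1 + |v_a|²) = 1`. -/
theorem gradNormSq_wLocal_le (hu : ContDiffAt ℝ ∞ u y)
    (h : LinearIndependent ℝ fun i => pd i u y) {p : Fin n → Ambient n m} (hp : Orthonormal ℝ p)
    (hW : wLocal u p y ≠ 0) : gradNormSq u (wLocal u p) y ≤ secondFFNormSq u y := by
  obtain ⟨ℓ, M, hℓ, hM, -, hprod⟩ := exists_adapted_frame h hp hW
  rw [gradNormSq_frame hℓ, secondFFNormSq_frame hℓ hu]
  refine Finset.sum_le_sum fun c _ => ?_
  rw [(wLocal_jet hu hℓ hM c).1]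
  have h1 : |∑ a, inner ℝ (frameB u ℓ y c a) (dualNormal u ℓ p M y a)| ≤
      ∑ a, ‖frameB u ℓ y c a‖ * ‖dualNormal u ℓ p M y a‖ :=
    (Finset.abs_sum_le_sum_abs _ _).trans (Finset.sum_le_sum fun a _ => abs_real_inner_le_norm _ _)
  have h2 := Finset.sum_mul_sq_le_sq_mul_sq Finset.univ (fun a => ‖frameB u ℓ y c a‖)
    (fun a => ‖dualNormal u ℓ p M y a‖)
  have h3 : (∑ a, inner ℝ (frameB u ℓ y c a) (dualNormal u ℓ p M y a)) ^ 2 ≤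
      (∑ a, ‖frameB u ℓ y c a‖ ^ 2) * ∑ a, ‖dualNormal u ℓ p M y a‖ ^ 2 := by
    refine le_trans ?_ h2
    rw [← sq_abs]
    exact pow_le_pow_left₀ (abs_nonneg _) h1 2
  have h4 := one_add_sum_le_prod Finset.univ (fun a => ‖dualNormal u ℓ p M y a‖ ^ 2)
    fun a _ => sq_nonneg _
  have h5 : (∑ a, ‖dualNormal u ℓ p M y a‖ ^ 2) * wLocal u p y ^ 2 ≤ 1 := by
    rw [← hprod]
    gcongr
    linarith
  have h6 : 0 ≤ ∑ a, ‖frameB u ℓ y c a‖ ^ 2 := Finset.sum_nonneg fun _ _ => sq_nonneg _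
  calc _ = wLocal u p y ^ 2 *
        (∑ a, inner ℝ (frameB u ℓ y c a) (dualNormal u ℓ p M y a)) ^ 2 := by rw [mul_pow]
    _ ≤ wLocal u p y ^ 2 *
        ((∑ a, ‖frameB u ℓ y c a‖ ^ 2) * ∑ a, ‖dualNormal u ℓ p M y a‖ ^ 2) := by gcongr
    _ = (∑ a, ‖frameB u ℓ y c a‖ ^ 2) *
        ((∑ a, ‖dualNormal u ℓ p M y a‖ ^ 2) * wLocal u p y ^ 2) := by ring
    _ ≤ _ := mul_le_of_le_one_right h6 h5

/-- The common conclusion of both cases; the sum multiplied by `C` is `|∇ log w|²`. -/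
theorem localLaplacian_wLocal_le_of_crossTrace (hu : ContDiffAt ℝ ∞ u y)
    {ℓ : Fin n → Model n} {M : Matrix (Fin n) (Fin n) ℝ} {p : Fin n → Ambient n m}
    (hℓ : Orthonormal ℝ fun a => dd (ℓ a) u y) (hM : frameW u ℓ p y * M = 1)
    (hpar : ∀ i, normalPart u y (pd i (meanCurvature u) y) = 0) (hW : 0 < wLocal u p y) {κ C : ℝ}
    (hC : κ * ∑ i, ∑ j, ‖frameB u ℓ y i j‖ ^ 2 ≤ ∑ i, ∑ j, ‖frameB u ℓ y i j‖ ^ 2 +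
      crossTrace (frameB u ℓ y) (dualNormal u ℓ p M y) +
      C * ∑ i, (∑ j, inner ℝ (frameB u ℓ y i j) (dualNormal u ℓ p M y j)) ^ 2) :
    localLaplacian u (wLocal u p) y ≤ -(κ * wLocal u p y) * secondFFNormSq u y +
      (C + 1) / wLocal u p y * gradNormSq u (wLocal u p) y := by
  rw [localLaplacian_wLocal hu hℓ hM hpar, gradNormSq_frame hℓ, secondFFNormSq_frame hℓ hu]
  simp only [fun c => (wLocal_jet hu hℓ hM c).1, mul_pow, ← Finset.mul_sum]
  have : (C + 1) / wLocal u p y * (wLocal u p y ^ 2 *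
      ∑ c, (∑ a, inner ℝ (frameB u ℓ y c a) (dualNormal u ℓ p M y a)) ^ 2) =
      wLocal u p y * ((C + 1) *
        ∑ c, (∑ a, inner ℝ (frameB u ℓ y c a) (dualNormal u ℓ p M y a)) ^ 2) := by
    field_simp
  rw [this]
  nlinarith [mul_le_mul_of_nonneg_left hC hW.le]

theorem exists_localLaplacian_wLocal_bound (n m : ℕ) {R : ℝ} (hR : R < 9) :
    ∃ κ C : ℝ, 0 < κ ∧ 0 ≤ C ∧ ∀ (u : Model n → Ambient n m) (y : Model n)
      (p : Fin n → Ambient n m), ContDiffAt ℝ ∞ u y → (LinearIndependent ℝ fun i => pd i u y) →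
      Orthonormal ℝ p → (∀ i, normalPart u y (pd i (meanCurvature u) y) = 0) →
      0 < wLocal u p y → 1 ≤ R * wLocal u p y ^ 2 →
      localLaplacian u (wLocal u p) y ≤ -(κ * wLocal u p y) * secondFFNormSq u y +
        (C + 1) / wLocal u p y * gradNormSq u (wLocal u p) y := by
  obtain ⟨κ, C, hκ, hC, key⟩ := exists_crossTrace_bound n hR
  refine ⟨κ, C, hκ, hC, fun u y p hu hli hp hpar hW hWR => ?_⟩
  obtain ⟨ℓ, M, hℓ, hM, horth, hprod⟩ := exists_adapted_frame hli hp hW.ne'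
  refine localLaplacian_wLocal_le_of_crossTrace hu hℓ hM hpar hW
    (key _ _ horth ?_ (frameB_comm hu))
  have hW2 : 0 < wLocal u p y ^ 2 := by positivity
  exact le_of_mul_le_mul_right (hprod.trans_le hWR) hW2

theorem localLaplacian_wLocal_le_of_rank (hu : ContDiffAt ℝ ∞ u y)
    (hli : LinearIndependent ℝ fun i => pd i u y) {p : Fin n → Ambient n m} (hp : Orthonormal ℝ p)
    (hpar : ∀ i, normalPart u y (pd i (meanCurvature u) y) = 0) (hH : meanCurvature u y = 0)
    (hr : ∀ ℓ : Fin n → Model n, (Orthonormal ℝ fun a => dd (ℓ a) u y) →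
      Module.finrank ℝ (LinearMap.range (contractLeft (frameB u ℓ y))) ≤ 2)
    (hW : 0 < wLocal u p y) :
    localLaplacian u (wLocal u p) y ≤ -(1 * wLocal u p y) * secondFFNormSq u y +
      (0 + 1) / wLocal u p y * gradNormSq u (wLocal u p) y := by
  obtain ⟨ℓ, M, hℓ, hM, -, -⟩ := exists_adapted_frame hli hp hW.ne'
  refine localLaplacian_wLocal_le_of_crossTrace hu hℓ hM hpar hW ?_
  have := crossTrace_nonneg_of_rank_le_two (frameB_comm hu)
    ((meanCurvature_frame hℓ (contDiffAt_two hu)).symm.trans hH) (hr ℓ hℓ)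
    (dualNormal u ℓ p M y)
  linarith

/-- The Laplacian of `exp (k T)`, where `T` is defined by `x₁ cos T + x₂ sin T = c`. -/
theorem localLaplacian_exp_angle (hu : ContDiffAt ℝ ∞ u y)
    (hli : LinearIndependent ℝ fun i => pd i u y) {x₁ x₂ T W V : Model n → ℝ}
    (h1 : ContDiffAt ℝ ∞ x₁ y) (h2 : ContDiffAt ℝ ∞ x₂ y) (hT : ContDiffAt ℝ ∞ T y) {c : ℝ}
    (hc : 0 ≤ c) (hid : ∀ᶠ z in nhds y, x₁ z * Real.cos (T z) + x₂ z * Real.sin (T z) = c)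
    (hW : W = fun z => Real.cos (T y) * x₁ z + Real.sin (T y) * x₂ z)
    (hV : V = fun z => -Real.sin (T y) * x₁ z + Real.cos (T y) * x₂ z)
    {s k κ Λ : ℝ} (hs : 0 < s) (hsV : s ≤ V y) (hV1 : V y ≤ 1) (hκ : 0 < κ) (hΛ : 0 ≤ Λ)
    (hLW : localLaplacian u W y ≤ -κ * secondFFNormSq u y + Λ * gradNormSq u W y)
    (hgV : gradNormSq u V y ≤ secondFFNormSq u y) (hk : 0 ≤ k) (hks : Λ + 2 / κ ≤ k * s) :
    k * Real.exp (k * T y) * (κ / 2) * secondFFNormSq u y ≤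
      localLaplacian u (fun z => Real.exp (k * T z)) y := by
  obtain ⟨ℓ, hℓ⟩ := exists_frame hli
  have cW : ContDiffAt ℝ ∞ W y := by
    rw [hW]; exact (contDiffAt_const.mul h1).add (contDiffAt_const.mul h2)
  have cV : ContDiffAt ℝ ∞ V y := by
    rw [hV]; exact (contDiffAt_const.mul h1).add (contDiffAt_const.mul h2)
  have cf : ContDiffAt ℝ ∞ (fun z => Real.exp (k * T z)) y := (contDiffAt_const.mul hT).exp
  have hx : ∀ (φ : Model n → ℝ), ContDiffAt ℝ ∞ φ y → ∀ a, ∀ᶠ s : ℝ in nhds 0,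
      HasDerivAt (fun s : ℝ => φ (y + s • ℓ a)) (dd (ℓ a) φ (y + s • ℓ a)) s :=
    fun φ hφ a => eventually_hasDerivAt_line hφ
  have hx2 : ∀ (φ : Model n → ℝ), ContDiffAt ℝ ∞ φ y → ∀ a,
      HasDerivAt (fun s : ℝ => dd (ℓ a) φ (y + s • ℓ a)) (dd (ℓ a) (dd (ℓ a) φ) y) 0 :=
    fun φ hφ a => hasDerivAt_line_zero (differentiableAt_of_top (contDiffAt_dd hφ _))
  have hW' : ∀ a, dd (ℓ a) W y = Real.cos (T y) * dd (ℓ a) x₁ y + Real.sin (T y) * dd (ℓ a) x₂ y ∧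
      dd (ℓ a) (dd (ℓ a) W) y = Real.cos (T y) * dd (ℓ a) (dd (ℓ a) x₁) y +
        Real.sin (T y) * dd (ℓ a) (dd (ℓ a) x₂) y := by
    intro a
    have := dd_of_line (v := ℓ a) cW (l := fun s => Real.cos (T y) * dd (ℓ a) x₁ (y + s • ℓ a) +
      Real.sin (T y) * dd (ℓ a) x₂ (y + s • ℓ a)) (by
        filter_upwards [hx x₁ h1 a, hx x₂ h2 a] with s e1 e2
        rw [hW]
        exact (e1.const_mul _).add (e2.const_mul _))
      (((hx2 x₁ h1 a).const_mul _).add ((hx2 x₂ h2 a).const_mul _))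
    simpa using this
  have hV' : ∀ a, dd (ℓ a) V y =
      -Real.sin (T y) * dd (ℓ a) x₁ y + Real.cos (T y) * dd (ℓ a) x₂ y := by
    intro a
    have := dd_of_line (v := ℓ a) cV (l := fun s => -Real.sin (T y) * dd (ℓ a) x₁ (y + s • ℓ a) +
      Real.cos (T y) * dd (ℓ a) x₂ (y + s • ℓ a)) (by
        filter_upwards [hx x₁ h1 a, hx x₂ h2 a] with s e1 e2
        rw [hV]
        exact (e1.const_mul _).add (e2.const_mul _))
      (((hx2 x₁ h1 a).const_mul _).add ((hx2 x₂ h2 a).const_mul _))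
    simpa using this.1
  have hf' : ∀ a, dd (ℓ a) (fun z => Real.exp (k * T z)) y =
      k * Real.exp (k * T y) * dd (ℓ a) T y ∧
      dd (ℓ a) (dd (ℓ a) fun z => Real.exp (k * T z)) y =
        k * Real.exp (k * T y) * (dd (ℓ a) (dd (ℓ a) T) y + k * dd (ℓ a) T y ^ 2) := by
    intro a
    have := dd_of_line (v := ℓ a) cf
      (l := fun s => Real.exp (k * T (y + s • ℓ a)) * (k * dd (ℓ a) T (y + s • ℓ a))) (by
        filter_upwards [hx T hT a] with s e1
        exact (e1.const_mul k).exp)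
      ((((hx T hT a).self_of_nhds.const_mul k).exp).mul ((hx2 T hT a).const_mul k))
    simp only [zero_smul, add_zero] at this
    exact ⟨by rw [this.1]; ring, by rw [this.2]; ring⟩
  -- The first and second derivatives of the identity `x₁ cos T + x₂ sin T = c`.
  have hc' : ∀ a, dd (ℓ a) W y = -V y * dd (ℓ a) T y ∧
      V y * dd (ℓ a) (dd (ℓ a) T) y = -dd (ℓ a) (dd (ℓ a) W) y -
        2 * (dd (ℓ a) V y * dd (ℓ a) T y) + c * dd (ℓ a) T y ^ 2 := by
    intro a
    have hev : (fun _ : ℝ => c) =ᶠ[nhds 0] fun s => x₁ (y + s • ℓ a) * Real.cos (T (y + s • ℓ a)) +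
        x₂ (y + s • ℓ a) * Real.sin (T (y + s • ℓ a)) := by
      filter_upwards [(tendsto_line y (ℓ a)).eventually hid] with s e
      exact e.symm
    have := dd_of_line (f := fun _ : Model n => c) (y := y) (v := ℓ a) contDiffAt_const
      (l := fun s => (dd (ℓ a) x₁ (y + s • ℓ a) * Real.cos (T (y + s • ℓ a)) +
        x₁ (y + s • ℓ a) * (-Real.sin (T (y + s • ℓ a)) * dd (ℓ a) T (y + s • ℓ a))) +
        (dd (ℓ a) x₂ (y + s • ℓ a) * Real.sin (T (y + s • ℓ a)) +
        x₂ (y + s • ℓ a) * (Real.cos (T (y + s • ℓ a)) * dd (ℓ a) T (y + s • ℓ a)))) (by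
        filter_upwards [hx x₁ h1 a, hx x₂ h2 a, hx T hT a, hev.eventuallyEq_nhds] with s e1 e2 e3 e4
        exact ((e1.mul e3.cos).add (e2.mul e3.sin)).congr_of_eventuallyEq e4)
      ((((hx2 x₁ h1 a).mul (hx T hT a).self_of_nhds.cos).add ((hx x₁ h1 a).self_of_nhds.mul
        ((hx T hT a).self_of_nhds.sin.neg.mul (hx2 T hT a)))).add
        (((hx2 x₂ h2 a).mul (hx T hT a).self_of_nhds.sin).add ((hx x₂ h2 a).self_of_nhds.mul
        ((hx T hT a).self_of_nhds.cos.mul (hx2 T hT a)))))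
    have z1 : ∀ z, dd (ℓ a) (fun _ : Model n => c) z = 0 := fun z => by simp [dd]
    have z2 : dd (ℓ a) (dd (ℓ a) fun _ : Model n => c) y = 0 := by
      rw [show dd (ℓ a) (fun _ : Model n => c) = fun _ => 0 from funext z1]; simp [dd]
    rw [z1, z2] at this
    simp only [zero_smul, add_zero] at this
    have hid0 := hid.self_of_nhds
    constructor
    · rw [(hW' a).1, hV]
      linarith [this.1]
    · have hVy : V y = -Real.sin (T y) * x₁ y + Real.cos (T y) * x₂ y := by rw [hV]
      rw [(hW' a).2, hV' a, hVy, ← hid0]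
      simp only [Pi.mul_apply, Pi.neg_apply, zero_smul, add_zero] at this
      linarith [this.2]
  have hLf : localLaplacian u (fun z => Real.exp (k * T z)) y =
      k * Real.exp (k * T y) * (localLaplacian u T y + k * gradNormSq u T y) := by
    rw [localLaplacian_frame hℓ hu cf, localLaplacian_frame hℓ hu hT, gradNormSq_frame hℓ,
      Finset.mul_sum, ← Finset.sum_add_distrib, Finset.mul_sum]
    refine Finset.sum_congr rfl fun a _ => ?_
    rw [(hf' a).2]
    simp only [fun b => (hf' b).1]
    have : ∀ F : Fin n → ℝ, ∑ b, F b * (k * Real.exp (k * T y) * dd (ℓ b) T y) =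
        k * Real.exp (k * T y) * ∑ b, F b * dd (ℓ b) T y := by
      intro F
      rw [Finset.mul_sum]
      exact Finset.sum_congr rfl fun b _ => by ring
    rw [this]
    ring
  have hLT : V y * localLaplacian u T y = -localLaplacian u W y -
      2 * ∑ a, dd (ℓ a) V y * dd (ℓ a) T y + c * gradNormSq u T y := by
    rw [localLaplacian_frame hℓ hu cW, localLaplacian_frame hℓ hu hT, gradNormSq_frame hℓ,
      Finset.mul_sum, Finset.mul_sum, Finset.mul_sum, ← Finset.sum_neg_distrib,
      ← Finset.sum_sub_distrib, ← Finset.sum_add_distrib]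
    refine Finset.sum_congr rfl fun a _ => ?_
    simp only [fun b => (hc' b).1]
    rw [mul_sub, (hc' a).2]
    have : ∀ F : Fin n → ℝ, ∑ b, F b * (-V y * dd (ℓ b) T y) =
        -(V y * ∑ b, F b * dd (ℓ b) T y) := by
      intro F
      rw [Finset.mul_sum, ← Finset.sum_neg_distrib]
      exact Finset.sum_congr rfl fun b _ => by ring
    rw [this]
    ring
  have hgW : gradNormSq u W y = V y ^ 2 * gradNormSq u T y := by
    rw [gradNormSq_frame hℓ, gradNormSq_frame hℓ, Finset.mul_sum]
    refine Finset.sum_congr rfl fun a _ => ?_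
    rw [(hc' a).1]; ring
  -- Young's inequality with weight `κ/2`: half of the good term `κ|B|²` absorbs `|∇V|² ≤ |B|²`.
  have hcr : 2 * ∑ a, dd (ℓ a) V y * dd (ℓ a) T y ≤
      κ / 2 * gradNormSq u V y + 2 / κ * gradNormSq u T y := by
    rw [gradNormSq_frame hℓ, gradNormSq_frame hℓ, Finset.mul_sum, Finset.mul_sum, Finset.mul_sum,
      ← Finset.sum_add_distrib]
    refine Finset.sum_le_sum fun a _ => ?_
    have e : κ / 2 * dd (ℓ a) V y ^ 2 + 2 / κ * dd (ℓ a) T y ^ 2 -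
        2 * (dd (ℓ a) V y * dd (ℓ a) T y) =
        κ / 2 * (dd (ℓ a) V y - 2 / κ * dd (ℓ a) T y) ^ 2 := by
      field_simp
      ring
    have : 0 ≤ κ / 2 * (dd (ℓ a) V y - 2 / κ * dd (ℓ a) T y) ^ 2 := by positivity
    linarith
  have hG0 : 0 ≤ gradNormSq u T y := by
    rw [gradNormSq_frame hℓ]; exact Finset.sum_nonneg fun _ _ => sq_nonneg _
  have hB0 : 0 ≤ secondFFNormSq u y := by
    rw [secondFFNormSq_frame hℓ hu]
    exact Finset.sum_nonneg fun _ _ => Finset.sum_nonneg fun _ _ => sq_nonneg _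
  obtain ⟨Z, hZ⟩ : ∃ Z, Z = localLaplacian u T y + k * gradNormSq u T y := ⟨_, rfl⟩
  have hV0 : 0 < V y := hs.trans_le hsV
  have hVZ : κ / 2 * secondFFNormSq u y ≤ V y * Z := by
    rw [hZ, mul_add, hLT]
    rw [hgW] at hLW
    have e1 : Λ * (V y ^ 2 * gradNormSq u T y) ≤ Λ * (1 * gradNormSq u T y) := by
      gcongr
      exact pow_le_one₀ hV0.le hV1
    have e2 : (Λ + 2 / κ) * gradNormSq u T y ≤ k * V y * gradNormSq u T y := by
      gcongr
      exact hks.trans (by gcongr)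
    have e3 : κ / 2 * gradNormSq u V y ≤ κ / 2 * secondFFNormSq u y := by gcongr
    have e4 : 0 ≤ c * gradNormSq u T y := by positivity
    linarith
  -- The sign of `Z` is needed before `V ≤ 1` can be used to drop the factor `V`.
  have hZ0 : 0 ≤ Z := by
    by_contra! hneg
    have : V y * Z < 0 := mul_neg_of_pos_of_neg hV0 hneg
    have : 0 ≤ κ / 2 * secondFFNormSq u y := by positivity
    linarith
  have hZ1 : κ / 2 * secondFFNormSq u y ≤ Z := hVZ.trans (mul_le_of_le_one_left hZ0 hV1)
  rw [hLf, ← hZ, mul_assoc _ (κ / 2)]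
  gcongr

end

end GaussImage

/-! ### Gram–Schmidt and invariance under changes of parameters. -/

namespace GaussImage

section

variable {n m : ℕ} {u : Model n → Ambient n m} {ℓ : Fin n → Model n} {y : Model n}

theorem sum_inner_smul_of_mem_span {V : Type*} [NormedAddCommGroup V] [InnerProductSpace ℝ V]
    {g : Fin n → V} (hg : Orthonormal ℝ g) {x : V} (hx : x ∈ Submodule.span ℝ (Set.range g)) :
    ∑ j, inner ℝ (g j) x • g j = x := by
  obtain ⟨c, rfl⟩ := (Submodule.mem_span_range_iff_exists_fun ℝ).1 hx
  simp only [hg.inner_right_fintype]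

/-- Gram–Schmidt divides `det ⟨v_i, p_j⟩` by the volume of `v`. -/
theorem det_wMatrix_gramSchmidt {v : Fin n → Ambient n m} (hv : LinearIndependent ℝ v)
    (p : Fin n → Ambient n m) :
    (wMatrix (InnerProductSpace.gramSchmidtNormed ℝ v) p).det =
      (wMatrix v p).det / √(wMatrix v v).det := by
  set g := InnerProductSpace.gramSchmidtNormed ℝ v with hg
  have ho : Orthonormal ℝ g := InnerProductSpace.gramSchmidtNormed_orthonormal hv
  have hs : Submodule.span ℝ (Set.range g) = Submodule.span ℝ (Set.range v) :=
    (InnerProductSpace.span_gramSchmidtNormed_range v).trans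
      (InnerProductSpace.span_gramSchmidt ℝ v)
  obtain ⟨T, hT⟩ : ∃ T : Matrix (Fin n) (Fin n) ℝ, ∀ i j, T i j = inner ℝ (g j) (v i) :=
    ⟨Matrix.of fun i j => _, fun _ _ => rfl⟩
  have hvT : ∀ i, v i = ∑ j, T i j • g j := fun i => by
    simp only [hT]
    exact (sum_inner_smul_of_mem_span ho (hs ▸ Submodule.subset_span ⟨i, rfl⟩)).symm
  have hgs : ∀ i x, inner ℝ (g i) x =
      ‖InnerProductSpace.gramSchmidt ℝ v i‖⁻¹ * inner ℝ (InnerProductSpace.gramSchmidt ℝ v i) x :=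
    fun i x => by
      rw [hg, InnerProductSpace.gramSchmidtNormed, real_inner_smul_left]; simp
  -- The matrix from `g` to `v` is triangular with the positive lengths of the Gram–Schmidt vectors
  -- on the diagonal, so its determinant is the positive root of the Gram determinant.
  have hdet : 0 < T.det := by
    have htri : T.IsLowerTriangular := by
      intro i j hij
      have hij' : i < j := hij
      rw [hT, hgs, InnerProductSpace.gramSchmidt_inv_triangular ℝ v hij', mul_zero]
    rw [Matrix.det_of_isLowerTriangular _ htri]
    refine Finset.prod_pos fun i _ => ?_
    have hne := InnerProductSpace.gramSchmidt_ne_zero (𝕜 := ℝ) i hv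
    have hself : inner ℝ (InnerProductSpace.gramSchmidt ℝ v i) (v i) =
        ‖InnerProductSpace.gramSchmidt ℝ v i‖ ^ 2 := by
      rw [InnerProductSpace.gramSchmidt_def'' ℝ v i, inner_add_right, inner_sum,
        real_inner_self_eq_norm_sq, Finset.sum_eq_zero, add_zero]
      intro j hj
      rw [real_inner_smul_right, InnerProductSpace.gramSchmidt_orthogonal ℝ v
        (Finset.mem_Iio.1 hj).ne', mul_zero]
    rw [hT, hgs, hself]
    have : 0 < ‖InnerProductSpace.gramSchmidt ℝ v i‖ := norm_pos_iff.2 hne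
    positivity
  have h1 : wMatrix v p = T * wMatrix g p := by
    ext i j
    simp only [wMatrix, Matrix.of_apply, Matrix.mul_apply]
    rw [hvT i, sum_inner]
    simp only [real_inner_smul_left]
  have h2 : wMatrix v v = T * T.transpose := by
    ext i j
    simp only [wMatrix, Matrix.of_apply, Matrix.mul_apply, Matrix.transpose_apply]
    rw [hvT i, sum_inner]
    simp only [real_inner_smul_left, ← hT]
  rw [h1, h2, Matrix.det_mul, Matrix.det_mul, Matrix.det_transpose, Real.sqrt_mul_self hdet.le,
    mul_div_cancel_left₀ _ hdet.ne']

theorem metric_eq_wMatrix (u : Model n → Ambient n m) (y : Model n) :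
    metric u y = wMatrix (fun i => pd i u y) fun i => pd i u y := rfl

theorem det_frameMatrix_image (D : Model n →L[ℝ] Model n) :
    (frameMatrix fun i => D (EuclideanSpace.single i 1)).det = D.det := by
  have h := LinearMap.det_toMatrix (EuclideanSpace.basisFun (Fin n) ℝ).toBasis D.toLinearMap
  rw [ContinuousLinearMap.det, ← h, ← Matrix.det_transpose]
  congr 1

/-- `wLocal` is invariant under orientation preserving changes of parameters. -/
theorem wLocal_comp {u' : Model n → Ambient n m} {τ : Model n → Model n} {y' : Model n}
    (h : u' =ᶠ[nhds y'] u ∘ τ) (hu : DifferentiableAt ℝ u (τ y')) (hτ : DifferentiableAt ℝ τ y')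
    (hdet : 0 < (fderiv ℝ τ y').det) (p : Fin n → Ambient n m) :
    wLocal u' p y' = wLocal u p (τ y') := by
  have h1 : (fun i => pd i u' y') =
      fun i => dd (fderiv ℝ τ y' (EuclideanSpace.single i 1)) u (τ y') := by
    funext i
    rw [pd, h.fderiv_eq, fderiv_comp _ hu hτ]
    rfl
  have h2 : (frameMatrix fun i => fderiv ℝ τ y' (EuclideanSpace.single i 1)).det =
      (fderiv ℝ τ y').det := det_frameMatrix_image _
  have h3 : metric u' y' =
      frameMetric u (fun i => fderiv ℝ τ y' (EuclideanSpace.single i 1)) (τ y') := by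
    rw [metric_eq_wMatrix, h1]
    rfl
  rw [wLocal, h3, h1, show wMatrix (fun i => dd (fderiv ℝ τ y' (EuclideanSpace.single i 1)) u
    (τ y')) p = frameW u (fun i => fderiv ℝ τ y' (EuclideanSpace.single i 1)) p (τ y') from rfl,
    frameW_eq, frameMetric_eq, Matrix.det_mul, Matrix.det_mul, Matrix.det_mul,
    Matrix.det_transpose, h2, show (fderiv ℝ τ y').det * (metric u (τ y')).det *
      (fderiv ℝ τ y').det = (fderiv ℝ τ y').det ^ 2 * (metric u (τ y')).det by ring,
    Real.sqrt_mul (sq_nonneg _), Real.sqrt_sq hdet.le, mul_div_mul_left _ _ hdet.ne', wLocal]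

theorem normalPart_fderiv (h : (metric u y).det ≠ 0) (v : Model n) :
    normalPart u y (fderiv ℝ u y v) = 0 := by
  have hv : tangentVector u y (fderiv ℝ u y v) = v := by
    ext k
    rw [tangentVector_apply]
    have h1 : ∀ k, tangentCoeff u y (fderiv ℝ u y v) k = v k := by
      intro k
      have h2 : (metric u y).mulVec v = fun l => inner ℝ (fderiv ℝ u y v) (pd l u y) := by
        funext l
        change _ = inner ℝ (dd v u y) (pd l u y)
        rw [dd_eq_sum_pd, sum_inner]
        simp only [Matrix.mulVec, dotProduct, real_inner_smul_left, metric, Matrix.of_apply]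
        exact Finset.sum_congr rfl fun i _ => by rw [real_inner_comm, mul_comm]
      have h3 := congrFun (congrArg (fun x : Fin n → ℝ => (metric u y)⁻¹.mulVec x) h2) k
      dsimp only at h3
      rw [Matrix.mulVec_mulVec, Matrix.nonsing_inv_mul _ (isUnit_iff_ne_zero.2 h),
        Matrix.one_mulVec] at h3
      exact h3.symm
    simp [h1, Pi.single_apply]
  rw [normalPart_eq, hv, sub_self]

/-- The mean curvature vector is invariant under changes of parameters. -/
theorem meanCurvature_comp {u' : Model n → Ambient n m} {τ : Model n → Model n} {y' : Model n}
    (h : u' =ᶠ[nhds y'] u ∘ τ) (hu : ContDiffAt ℝ ∞ u (τ y')) (hτ : ContDiffAt ℝ ∞ τ y')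
    (hli : LinearIndependent ℝ fun i => pd i u' y') :
    meanCurvature u' y' = meanCurvature u (τ y') := by
  have hu' : ContDiffAt ℝ ∞ u' y' := (hu.comp y' hτ).congr_of_eventuallyEq h
  obtain ⟨ℓ', hℓ'⟩ := exists_frame hli
  have h1 : ∀ v, dd v u' =ᶠ[nhds y'] fun z => fderiv ℝ u (τ z) (dd v τ z) := by
    intro v
    have hd := hτ.continuousAt.eventually (eventually_contDiffAt hu 1)
    filter_upwards [h.eventuallyEq_nhds, hd, eventually_contDiffAt hτ 1] with z hz hz1 hz2
    rw [dd, hz.fderiv_eq, fderiv_comp _ (hz1.differentiableAt (by simp))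
      (hz2.differentiableAt (by simp))]
    rfl
  set ℓ : Fin n → Model n := fun a => fderiv ℝ τ y' (ℓ' a) with hℓd
  have h2 : ∀ a, dd (ℓ' a) u' y' = dd (ℓ a) u (τ y') := fun a => (h1 (ℓ' a)).self_of_nhds
  have hℓ : Orthonormal ℝ fun a => dd (ℓ a) u (τ y') := by
    simpa only [← h2] using hℓ'
  have h3 : ∀ v, normalPart u' y' v = normalPart u (τ y') v := fun v => by
    simp only [normalPart_frame hℓ, normalPart_frame hℓ', h2]
  rw [meanCurvature_frame hℓ' (contDiffAt_two hu'), meanCurvature_frame hℓ (contDiffAt_two hu)]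
  refine Finset.sum_congr rfl fun a _ => ?_
  rw [frameB, frameB, h3]
  -- The second derivative of the change of parameters contributes only a tangential vector, removed
  -- by `normalPart_fderiv`.
  have h4 : dd (ℓ' a) (dd (ℓ' a) u') y' =
      dd (ℓ a) (dd (ℓ a) u) (τ y') + fderiv ℝ u (τ y') (dd (ℓ' a) (dd (ℓ' a) τ) y') := by
    rw [(dd_congr (h1 (ℓ' a)) (ℓ' a)).self_of_nhds, dd_dd_eq (contDiffAt_two hu)]
    have hD : DifferentiableAt ℝ (fderiv ℝ u) (τ y') :=
      (hu.fderiv_right (m := ∞) (by simp)).differentiableAt (by simp)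
    have e1 : DifferentiableAt ℝ (fun z => fderiv ℝ u (τ z)) y' :=
      hD.comp y' (differentiableAt_of_top hτ)
    have e2 : DifferentiableAt ℝ (dd (ℓ' a) τ) y' :=
      differentiableAt_of_top (contDiffAt_dd hτ _)
    rw [dd, fderiv_clm_apply e1 e2]
    have e3 : fderiv ℝ (fun z => fderiv ℝ u (τ z)) y' =
        (fderiv ℝ (fderiv ℝ u) (τ y')).comp (fderiv ℝ τ y') :=
      fderiv_comp y' hD (differentiableAt_of_top hτ)
    rw [e3]
    simp only [_root_.add_apply, ContinuousLinearMap.comp_apply,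
      ContinuousLinearMap.flip_apply]
    rw [add_comm]
    rfl
  rw [h4, ← normalPartLin_apply, map_add, normalPartLin_apply, normalPartLin_apply,
    normalPart_fderiv (det_metric_pos hℓ).ne', add_zero]

end

end GaussImage

/-! ### The rank of the second fundamental form and the rank of the Gauss map. -/

namespace GaussImage

section

variable {n m : ℕ} {u : Model n → Ambient n m} {ℓ : Fin n → Model n} {y : Model n}

/-- The differential of `w` on the Gauss image, in terms of the second fundamental form. -/
theorem exists_dd_wLocal (hu : ContDiffAt ℝ ∞ u y) (hℓ : Orthonormal ℝ fun a => dd (ℓ a) u y)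
    (p : Fin n → Ambient n m) : ∃ σ : ℝ, σ ^ 2 = 1 ∧ ∀ v, dd v (wLocal u p) y =
      σ * ∑ a, (wMatrix (Function.update (fun a => dd (ℓ a) u y) a
        (normalPart u y (dd v (dd (ℓ a) u) y))) p).det := by
  obtain ⟨σ, hσ1, hσ⟩ := exists_sign_wLocal (det_frameMatrix_ne_zero hℓ) u p
  refine ⟨σ, hσ1, fun v => ?_⟩
  have hf : ∀ a, HasDerivAt (fun s : ℝ => dd (ℓ a) u (y + s • v)) (dd v (dd (ℓ a) u) y) 0 :=
    fun a => hasDerivAt_line_zero (differentiableAt_of_top (contDiffAt_dd hu _))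
  have hX := hasDerivAt_det (X := fun s : ℝ => frameW u ℓ p (y + s • v)) (s := 0)
    (X' := Matrix.of fun a b => inner ℝ (dd v (dd (ℓ a) u) y) (p b))
    (fun a b => by
      simpa [frameW, wMatrix] using (hf a).inner ℝ (hasDerivAt_const (0 : ℝ) (p b)))
  have hg := hasDerivAt_det (X := fun s : ℝ => frameMetric u ℓ (y + s • v)) (s := 0)
    (X' := Matrix.of fun a b => inner ℝ (dd (ℓ a) u y) (dd v (dd (ℓ b) u) y) +
      inner ℝ (dd v (dd (ℓ a) u) y) (dd (ℓ b) u y))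
    (fun a b => by simpa [frameMetric] using (hf a).inner ℝ (hf b))
  have hg1 : (frameMetric u ℓ (y + (0 : ℝ) • v)) = 1 := by simpa using frameMetric_eq_one hℓ
  have hg2 : ∑ a, ((frameMetric u ℓ (y + (0 : ℝ) • v)).updateRow a ((Matrix.of fun a b =>
      inner ℝ (dd (ℓ a) u y) (dd v (dd (ℓ b) u) y) +
      inner ℝ (dd v (dd (ℓ a) u) y) (dd (ℓ b) u y)) a)).det =
      2 * ∑ a, inner ℝ (dd v (dd (ℓ a) u) y) (dd (ℓ a) u y) := by
    rw [sum_det_updateRow, hg1, Matrix.adjugate_one, mul_one, Matrix.trace, Finset.mul_sum]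
    refine Finset.sum_congr rfl fun a _ => ?_
    simp only [Matrix.diag_apply, Matrix.of_apply, real_inner_comm (dd (ℓ a) u y)]
    ring
  rw [hg2] at hg
  have hq := (hX.div (hg.sqrt (by simp [frameMetric_eq_one hℓ])) (by simp [frameMetric_eq_one hℓ])).const_mul σ
  have hd := hasDerivAt_line_zero (v := v) (differentiableAt_of_top
    (contDiffAt_wLocal hu (det_metric_pos hℓ) p))
  have he : (fun s : ℝ => wLocal u p (y + s • v)) = fun s => σ *
      ((frameW u ℓ p (y + s • v)).det / √(frameMetric u ℓ (y + s • v)).det) :=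
    funext fun s => hσ _
  rw [he] at hd
  rw [hd.unique hq]
  congr 1
  simp only [zero_smul, add_zero, frameMetric_eq_one hℓ, Matrix.det_one, Real.sqrt_one]
  -- Only the tangential component along `e_a` itself survives in row `a`; summed over `a`, these
  -- contributions cancel against the derivative of the volume factor.
  have hrow : ∀ a, ((frameW u ℓ p y).updateRow a ((Matrix.of fun a b =>
      inner ℝ (dd v (dd (ℓ a) u) y) (p b)) a)).det =
      (wMatrix (Function.update (fun a => dd (ℓ a) u y) a
        (normalPart u y (dd v (dd (ℓ a) u) y))) p).det +
      inner ℝ (dd v (dd (ℓ a) u) y) (dd (ℓ a) u y) * (frameW u ℓ p y).det := by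
    intro a
    have e1 : ((Matrix.of fun a b => inner ℝ (dd v (dd (ℓ a) u) y) (p b)) a : Fin n → ℝ) =
        (fun b => inner ℝ (normalPart u y (dd v (dd (ℓ a) u) y)) (p b)) +
        ∑ c, inner ℝ (dd v (dd (ℓ a) u) y) (dd (ℓ c) u y) • (frameW u ℓ p y) c := by
      funext b
      simp only [Matrix.of_apply, Pi.add_apply, Finset.sum_apply, Pi.smul_apply, smul_eq_mul]
      rw [normalPart_frame hℓ, inner_sub_left, sum_inner]
      simp only [real_inner_smul_left]
      rw [sub_add_eq_add_sub, eq_comm, sub_eq_iff_eq_add]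
      rfl
    rw [e1, Matrix.det_updateRow_add, Matrix.det_updateRow_sum, smul_eq_mul]
    congr 2
    ext i j
    by_cases hi : i = a
    · subst hi; simp [wMatrix]
    · simp [wMatrix, frameW, hi]
  rw [Finset.sum_congr rfl fun a _ => hrow a, Finset.sum_add_distrib, ← Finset.sum_mul]
  ring

/-- `q ↦ det ⟨r_i, q_j⟩` as an alternating map. -/
noncomputable def wForm (r : Fin n → Ambient n m) : Ambient n m [⋀^Fin n]→ₗ[ℝ] ℝ :=
  Matrix.detRowAlternating.compLinearMap (LinearMap.pi fun i => (innerSL ℝ (r i)).toLinearMap)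

theorem wForm_apply (r q : Fin n → Ambient n m) : wForm r q = (wMatrix r q).det := by
  rw [← Matrix.det_transpose]
  rfl

/-- Sorting turns any injective choice of coordinate vectors into an increasing one at the cost of a
sign. Thus the Plücker coordinates determine the whole alternating form. -/
theorem alternating_eq_zero_of_coord {f : Ambient n m [⋀^Fin n]→ₗ[ℝ] ℝ}
    (h : ∀ I : Fin n ↪o Fin (n + m), (f fun i => EuclideanSpace.single (I i) 1) = 0) : f = 0 := by
  refine (EuclideanSpace.basisFun (Fin (n + m)) ℝ).toBasis.ext_alternating fun v hv => ?_
  have hs : StrictMono (v ∘ Tuple.sort v) :=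
    (Tuple.monotone_sort v).strictMono_of_injective (hv.comp (Tuple.sort v).injective)
  have h1 := h (OrderEmbedding.ofStrictMono _ hs)
  have h2 := f.map_perm (fun i => EuclideanSpace.single (v i) (1 : ℝ)) (Tuple.sort v)
  have h3 : f ((fun i => EuclideanSpace.single (v i) (1 : ℝ)) ∘ Tuple.sort v) = 0 := h1
  rw [h3] at h2
  have h4 := (smul_eq_zero_iff_eq _).1 h2.symm
  simpa using h4

theorem det_wMatrix_update_update {e b : Fin n → Ambient n m} (he : Orthonormal ℝ e)
    (hb : ∀ a c, inner ℝ (b a) (e c) = 0) (a k : Fin n) :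
    (wMatrix (Function.update e a (b a)) (Function.update e k (b k))).det =
      if a = k then ‖b k‖ ^ 2 else 0 := by
  have hb' : ∀ a c, inner ℝ (e c) (b a) = 0 := fun a c => by rw [real_inner_comm, hb]
  split_ifs with hak
  · subst hak
    have : wMatrix (Function.update e a (b a)) (Function.update e a (b a)) =
        Matrix.diagonal (Function.update 1 a (‖b a‖ ^ 2)) := by
      ext i j
      by_cases hi : i = a <;> by_cases hj : j = a
      · subst hi; subst hj; simp [wMatrix]
      · subst hi; simp [wMatrix, hj, Ne.symm hj, hb]
      · subst hj; simp [wMatrix, hi, hb']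
      · by_cases hij : i = j
        · subst hij; simp [wMatrix, hi, he.1]
        · simp [wMatrix, hi, hj, hij, he.2 hij]
    rw [this, Matrix.det_diagonal, Finset.prod_update_of_mem (Finset.mem_univ _)]
    simp
  · refine Matrix.det_eq_zero_of_row_eq_zero k fun j => ?_
    by_cases hj : j = k
    · subst hj; simp [wMatrix, Ne.symm hak, hb']
    · simp [wMatrix, Ne.symm hak, hj, he.2 (Ne.symm hj)]

theorem sum_wForm_apply (r : Fin n → Fin n → Ambient n m) (q : Fin n → Ambient n m) :
    (∑ a, wForm (r a)) q = ∑ a, (wMatrix (r a) q).det := by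
  induction (Finset.univ : Finset (Fin n)) using Finset.induction_on with
  | empty => simp
  | insert a s h ih => simp [h, ih, wForm_apply]

/-- The differential of the Gauss map is the form `∑_a e_1 ∧ ⋯ ∧ b_a ∧ ⋯ ∧ e_n` with `b_a` normal.
Its summands are mutually orthogonal, so pairing it with the `k`-th summand isolates `|b_k|²`. -/
theorem normalPart_eq_zero_of_dd_wLocal (hu : ContDiffAt ℝ ∞ u y)
    (hℓ : Orthonormal ℝ fun a => dd (ℓ a) u y) {v : Model n}
    (h : ∀ I : Fin n ↪o Fin (n + m),
      dd v (wLocal u fun i => EuclideanSpace.single (I i) 1) y = 0) (k : Fin n) :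
    normalPart u y (dd v (dd (ℓ k) u) y) = 0 := by
  set b : Fin n → Ambient n m := fun a => normalPart u y (dd v (dd (ℓ a) u) y) with hb
  set e : Fin n → Ambient n m := fun a => dd (ℓ a) u y with he
  have h0 : ∑ a, wForm (Function.update e a (b a)) = 0 := by
    refine alternating_eq_zero_of_coord fun I => ?_
    obtain ⟨σ, hσ, hd⟩ := exists_dd_wLocal hu hℓ fun i => EuclideanSpace.single (I i) 1
    have h1 := hd v
    rw [h I] at h1
    have hσ0 : σ ≠ 0 := by rintro rfl; norm_num at hσ
    have h2 := (mul_eq_zero.1 h1.symm).resolve_left hσ0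
    rw [sum_wForm_apply]
    exact h2
  have h1 := congrArg (fun f : Ambient n m [⋀^Fin n]→ₗ[ℝ] ℝ => f (Function.update e k (b k))) h0
  simp only [sum_wForm_apply, AlternatingMap.zero_apply] at h1
  rw [Finset.sum_congr rfl fun a _ => det_wMatrix_update_update (b := b) hℓ
    (fun a c => inner_normalPart_frame hℓ _ c) a k] at h1
  simpa using h1

/-- The rank of the second fundamental form is at most that of the Gauss map. -/
theorem finrank_range_contractLeft_le (hu : ContDiffAt ℝ ∞ u y)
    (hℓ : Orthonormal ℝ fun a => dd (ℓ a) u y) :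
    Module.finrank ℝ (LinearMap.range (contractLeft (frameB u ℓ y))) ≤
      Module.finrank ℝ (LinearMap.range (fderiv ℝ (fun z => fun I : Fin n ↪o Fin (n + m) =>
        wLocal u (fun i => EuclideanSpace.single (I i) 1) z) y).toLinearMap) := by
  set G := fun z => fun I : Fin n ↪o Fin (n + m) =>
        wLocal u (fun i => EuclideanSpace.single (I i) 1) z with hG
  set L : EuclideanSpace ℝ (Fin n) →ₗ[ℝ] Model n :=
    ∑ a, (LinearMap.toSpanSingleton ℝ (Model n) (ℓ a)) ∘ₗ
      (EuclideanSpace.proj (𝕜 := ℝ) a).toLinearMap with hL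
  have hLa : ∀ x, L x = ∑ a, x a • ℓ a := fun x => by simp [hL]
  have hGd : ∀ v I, fderiv ℝ G y v I =
      dd v (wLocal u fun i => EuclideanSpace.single (I i) 1) y := by
    intro v I
    have hd : ∀ I : Fin n ↪o Fin (n + m), DifferentiableAt ℝ
        (fun z => wLocal u (fun i => EuclideanSpace.single (I i) 1) z) y := fun I =>
      differentiableAt_of_top (contDiffAt_wLocal hu (det_metric_pos hℓ) _)
    have := fderiv_pi hd
    rw [hG, this]
    rfl
  -- Both maps have the same domain, so by rank–nullity an inclusion of kernels bounds the ranks the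
  -- other way.
  have hker : LinearMap.ker ((fderiv ℝ G y).toLinearMap ∘ₗ L) ≤
      LinearMap.ker (contractLeft (frameB u ℓ y)) := by
    intro x hx
    rw [LinearMap.mem_ker] at hx ⊢
    funext b
    have h1 := normalPart_eq_zero_of_dd_wLocal hu hℓ (v := L x)
      (fun I => by rw [← hGd]; exact congrFun hx I) b
    change ∑ a, x a • frameB u ℓ y a b = 0
    rw [← h1, hLa]
    simp only [frameB, ← normalPartLin_apply, ← map_smul, ← map_sum]
    congr 1
    simp [dd]
  have e1 := LinearMap.finrank_range_add_finrank_ker (contractLeft (frameB u ℓ y))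
  have e2 := LinearMap.finrank_range_add_finrank_ker ((fderiv ℝ G y).toLinearMap ∘ₗ L)
  have e3 := Submodule.finrank_mono hker
  have e4 : Module.finrank ℝ (LinearMap.range ((fderiv ℝ G y).toLinearMap ∘ₗ L)) ≤
      Module.finrank ℝ (LinearMap.range (fderiv ℝ G y).toLinearMap) :=
    Submodule.finrank_mono (LinearMap.range_comp_le_range _ _)
  omega

end

end GaussImage

/-! ### Passage from charts to the manifold. -/

namespace GaussImage

section

variable {n m : ℕ} {M : Type*} [TopologicalSpace M] [ChartedSpace (Model n) M]

theorem contMDiff_of_inChart {G : Type*} [NormedAddCommGroup G] [NormedSpace ℝ G] {f : M → G}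
    (hc : ∀ x, ContDiffAt ℝ ∞ (inChart f x) (extChartAt (𝓡 n) x x)) :
    ContMDiff (𝓡 n) 𝓘(ℝ, G) ∞ f := by
  intro x
  rw [contMDiffAt_iff_source, ModelWithCorners.range_eq_univ, contMDiffWithinAt_univ,
    contMDiffAt_iff_contDiffAt]
  exact hc x

theorem mfderiv_eq_fderiv_inChart {G : Type*} [NormedAddCommGroup G] [NormedSpace ℝ G]
    {f : M → G} (hf : ContMDiff (𝓡 n) 𝓘(ℝ, G) ∞ f) (x : M) :
    mfderiv (𝓡 n) 𝓘(ℝ, G) f x = fderiv ℝ (inChart f x) (extChartAt (𝓡 n) x x) := by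
  rw [((hf.mdifferentiable (by simp)) x).mfderiv]
  simp [inChart, writtenInExtChartAt, Function.comp_def, fderivWithin_univ]
  rfl

/-- The change of coordinates from the preferred chart at `z` to that at `x`. -/
noncomputable def coordChange (x z : M) : Model n → Model n :=
  extChartAt (𝓡 n) x ∘ (extChartAt (𝓡 n) z).symm

theorem coordChange_apply (x z : M) :
    coordChange x z (extChartAt (𝓡 n) z z) = extChartAt (𝓡 n) x z := by
  simp [coordChange]

theorem inChart_eventuallyEq_comp {G : Type*} (F : M → G) {x z : M}
    (hz : z ∈ (extChartAt (𝓡 n) x).source) :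
    inChart F z =ᶠ[nhds (extChartAt (𝓡 n) z z)] inChart F x ∘ coordChange x z := by
  have h : ∀ᶠ y in nhds (extChartAt (𝓡 n) z z),
      (extChartAt (𝓡 n) z).symm y ∈ (extChartAt (𝓡 n) x).source :=
    (continuousAt_extChartAt_symm z).eventually
      ((isOpen_extChartAt_source x).mem_nhds (by simpa using hz))
  filter_upwards [h] with y hy
  simp only [inChart, coordChange, Function.comp_apply]
  rw [(extChartAt (𝓡 n) x).left_inv hy]

theorem det_coordChange_pos [OrientedAtlas n M] {x z : M}
    (hz : z ∈ (extChartAt (𝓡 n) x).source) :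
    0 < (fderiv ℝ (coordChange x z) (extChartAt (𝓡 n) z z)).det := by
  refine OrientedAtlas.det_pos (chartAt (Model n) z) (chart_mem_atlas _ z) (chartAt (Model n) x)
    (chart_mem_atlas _ x) (extChartAt (𝓡 n) z z) ?_
  rw [OpenPartialHomeomorph.trans_source]
  refine ⟨by simp, ?_⟩
  rw [extChartAt_source] at hz
  simpa using hz

theorem w_gaussMap_self {F : M → Ambient n m} (hF : SmoothImmersion F) (z : M) (p : Frame n m) :
    w (gaussMap hF z) (.mk p) = wLocal (inChart F z) p.1 (extChartAt (𝓡 n) z z) :=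
  det_wMatrix_gramSchmidt (hF.linearIndependent z) p.1

variable [IsManifold (𝓡 n) ∞ M]

theorem SmoothImmersion.contDiffAt_inChart {F : M → Ambient n m} (hF : SmoothImmersion F) (x : M)
    {y : Model n} (hy : y ∈ (extChartAt (𝓡 n) x).target) : ContDiffAt ℝ ∞ (inChart F x) y := by
  have h : ContMDiffOn 𝓘(ℝ, Model n) 𝓘(ℝ, Ambient n m) ∞ (inChart F x)
      (extChartAt (𝓡 n) x).target := hF.contMDiff.comp_contMDiffOn (contMDiffOn_extChartAt_symm x)
  exact (contMDiffOn_iff_contDiffOn.1 h).contDiffAt ((isOpen_extChartAt_target x).mem_nhds hy)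

theorem contDiffAt_coordChange {x z : M} (hz : z ∈ (extChartAt (𝓡 n) x).source) :
    ContDiffAt ℝ ∞ (coordChange x z) (extChartAt (𝓡 n) z z) := by
  have h := contDiffWithinAt_ext_coord_change (I := 𝓡 n) (n := ∞) x z
    (y := extChartAt (𝓡 n) z z) (by
      rw [PartialEquiv.trans_source]
      refine ⟨mem_extChartAt_target z, ?_⟩
      simpa using hz)
  rwa [ModelWithCorners.range_eq_univ, contDiffWithinAt_univ] at h

variable {F : M → Ambient n m} (hF : SmoothImmersion F)
include hF

/-- The Gauss map at `z` is defined through the preferred chart at `z`. Orientation of the atlas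
lets `wLocal` of the single chart at `x` represent `w` throughout its domain, so it can be
differentiated there. -/
theorem w_gaussMap [OrientedAtlas n M] {x z : M} (hz : z ∈ (extChartAt (𝓡 n) x).source)
    (p : Frame n m) :
    w (gaussMap hF z) (.mk p) = wLocal (inChart F x) p.1 (extChartAt (𝓡 n) x z) := by
  rw [w_gaussMap_self, wLocal_comp (inChart_eventuallyEq_comp F hz) (differentiableAt_of_top
    (hF.contDiffAt_inChart x (by
      rw [coordChange_apply]; exact (extChartAt (𝓡 n) x).map_source hz)))
    (differentiableAt_of_top (contDiffAt_coordChange hz)) (det_coordChange_pos hz),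
    coordChange_apply]

theorem inChart_w_gaussMap [OrientedAtlas n M] (x : M) (p : Frame n m) :
    Set.EqOn (inChart (fun z => w (gaussMap hF z) (.mk p)) x) (wLocal (inChart F x) p.1)
      (extChartAt (𝓡 n) x).target := by
  intro y hy
  simp only [inChart, Function.comp_apply]
  rw [w_gaussMap hF ((extChartAt (𝓡 n) x).map_target hy), (extChartAt (𝓡 n) x).right_inv hy]
  rfl

theorem contDiffAt_wLocal_inChart (x : M) (p : Fin n → Ambient n m) :
    ContDiffAt ℝ ∞ (wLocal (inChart F x) p) (extChartAt (𝓡 n) x x) := by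
  obtain ⟨ℓ, hℓ⟩ := exists_frame (hF.linearIndependent x)
  exact contDiffAt_wLocal (hF.contDiffAt_inChart x (mem_extChartAt_target x)) (det_metric_pos hℓ) p

/-- Minimality is stated only at the base point of each preferred chart. Invariance of the mean
curvature spreads it over the chart at `x`, as needed to differentiate it. -/
theorem IsMinimal.meanCurvature_eq_zero (hm : IsMinimal F) {x : M} {y : Model n}
    (hy : y ∈ (extChartAt (𝓡 n) x).target) : meanCurvature (inChart F x) y = 0 := by
  obtain ⟨z, hz, rfl⟩ : ∃ z ∈ (extChartAt (𝓡 n) x).source, extChartAt (𝓡 n) x z = y :=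
    ⟨_, (extChartAt (𝓡 n) x).map_target hy, (extChartAt (𝓡 n) x).right_inv hy⟩
  rw [← coordChange_apply, ← meanCurvature_comp (inChart_eventuallyEq_comp F hz)
    (hF.contDiffAt_inChart x (by rwa [coordChange_apply])) (contDiffAt_coordChange hz)
    (hF.linearIndependent z)]
  exact hm z

theorem IsMinimal.hasParallelMeanCurvature (hm : IsMinimal F) : HasParallelMeanCurvature F := by
  intro x i
  have h : meanCurvature (inChart F x) =ᶠ[nhds (extChartAt (𝓡 n) x x)] fun _ => 0 := by
    filter_upwards [extChartAt_target_mem_nhds (I := 𝓡 n) x] with y hy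
    exact hm.meanCurvature_eq_zero hF hy
  rw [pd_eq_dd, (dd_congr h _).self_of_nhds, ← normalPartLin_apply, dd]
  simp

theorem finrank_contractLeft_le_gaussRank [OrientedAtlas n M] (x : M) {ℓ : Fin n → Model n}
    (hℓ : Orthonormal ℝ fun a => dd (ℓ a) (inChart F x) (extChartAt (𝓡 n) x x)) :
    Module.finrank ℝ (LinearMap.range
      (contractLeft (frameB (inChart F x) ℓ (extChartAt (𝓡 n) x x)))) ≤ gaussRank hF x := by
  have he : ∀ x : M, inChart (fun z => plucker (gaussMap hF z)) x
      =ᶠ[nhds (extChartAt (𝓡 n) x x)] fun z I =>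
        wLocal (inChart F x) (fun i => EuclideanSpace.single (I i) 1) z := by
    intro x
    filter_upwards [extChartAt_target_mem_nhds (I := 𝓡 n) x] with y hy
    funext I
    exact inChart_w_gaussMap hF x _ hy
  have hc : ContMDiff (𝓡 n) 𝓘(ℝ, (Fin n ↪o Fin (n + m)) → ℝ) ∞
      fun z => plucker (gaussMap hF z) :=
    contMDiff_of_inChart fun x => ContDiffAt.congr_of_eventuallyEq
      (contDiffAt_pi.2 fun I => contDiffAt_wLocal_inChart hF x _) (he x)
  rw [gaussRank, mfderiv_eq_fderiv_inChart hc, (he x).fderiv_eq]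
  exact finrank_range_contractLeft_le (hF.contDiffAt_inChart x (mem_extChartAt_target x)) hℓ

end

end GaussImage

/-! ### S-orthogonal planes and the circle of planes they span. -/

namespace GaussImage

section

variable {n m : ℕ}

theorem wMatrix_mul_transpose {e f : Frame n m}
    (hmem : ∀ i, f.1 i ∈ Submodule.span ℝ (Set.range e.1)) :
    wMatrix f.1 e.1 * (wMatrix f.1 e.1).transpose = 1 := by
  ext i j
  have h : inner ℝ (f.1 i) (f.1 j) = ∑ k, inner ℝ (f.1 i) (e.1 k) * inner ℝ (f.1 j) (e.1 k) := by
    conv_lhs => rw [← sum_inner_smul_of_mem_span e.2 (hmem j), inner_sum]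
    refine Finset.sum_congr rfl fun k _ => ?_
    rw [real_inner_smul_right, real_inner_comm (f.1 j), mul_comm]
  rw [orthonormal_iff_ite.1 f.2] at h
  rw [Matrix.one_apply, h]
  rfl

/-- The transition matrix is orthogonal, so its determinant is `±1`, and positivity makes it a
rotation. -/
theorem mk_eq_mk_of_det_pos {e f : Frame n m}
    (hmem : ∀ i, f.1 i ∈ Submodule.span ℝ (Set.range e.1)) (hdet : 0 < (wMatrix f.1 e.1).det) :
    OrientedGrassmannian.mk e = OrientedGrassmannian.mk f := by
  have hA := wMatrix_mul_transpose hmem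
  have hd : (wMatrix f.1 e.1).det * (wMatrix f.1 e.1).det = 1 := by
    conv_lhs => enter [2]; rw [← Matrix.det_transpose]
    rw [← Matrix.det_mul, hA, Matrix.det_one]
  refine Quotient.sound ⟨wMatrix f.1 e.1, Matrix.mem_specialUnitaryGroup_iff.2
    ⟨Matrix.mem_unitaryGroup_iff.2 ?_, by nlinarith⟩, fun i => ?_⟩
  · rw [Matrix.star_eq_conjTranspose, Matrix.conjTranspose_eq_transpose_of_trivial, hA]
  · refine (sum_inner_smul_of_mem_span e.2 (hmem i)).symm.trans
      (Finset.sum_congr rfl fun k _ => ?_)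
    exact congrArg (· • e.1 k) (real_inner_comm _ _)

/-- An orthonormal `N`-tuple in an oriented `(N+1)`-plane extends to an oriented orthonormal
basis. -/
theorem exists_frame_vecCons {N : ℕ} (e : Frame (N + 1) m) {s : Fin N → Ambient (N + 1) m}
    (hs : Orthonormal ℝ s) (hmem : ∀ i, s i ∈ Submodule.span ℝ (Set.range e.1)) :
    ∃ v, ∃ h : Orthonormal ℝ (Matrix.vecCons v s : Fin (N + 1) → Ambient (N + 1) m),
      OrientedGrassmannian.mk e = OrientedGrassmannian.mk ⟨_, h⟩ := by
  have hle : Submodule.span ℝ (Set.range s) ≤ Submodule.span ℝ (Set.range e.1) := by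
    rw [Submodule.span_le]
    rintro _ ⟨i, rfl⟩
    exact hmem i
  have hdim := Submodule.finrank_add_inf_finrank_orthogonal hle
  rw [finrank_span_eq_card hs.linearIndependent, finrank_span_eq_card e.2.linearIndependent,
    Fintype.card_fin, Fintype.card_fin] at hdim
  have hne : (Submodule.span ℝ (Set.range s))ᗮ ⊓ Submodule.span ℝ (Set.range e.1) ≠ ⊥ := by
    intro h0
    rw [h0, finrank_bot] at hdim
    omega
  obtain ⟨x, ⟨hx1, hx2⟩, hx0⟩ := Submodule.exists_mem_ne_zero_of_ne_bot hne
  have key : ∀ v ∈ Submodule.span ℝ (Set.range e.1), v ∈ (Submodule.span ℝ (Set.range s))ᗮ →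
      ‖v‖ = 1 → ∃ h : Orthonormal ℝ (Matrix.vecCons v s : Fin (N + 1) → Ambient (N + 1) m),
        ∀ i, Matrix.vecCons v s i ∈ Submodule.span ℝ (Set.range e.1) := by
    intro v hv1 hv2 hv3
    refine ⟨orthonormal_vecCons_iff.2 ⟨hv3, fun i => ?_, hs⟩, fun i => ?_⟩
    · rw [real_inner_comm]
      exact (Submodule.mem_orthogonal _ _).1 hv2 _ (Submodule.subset_span ⟨i, rfl⟩)
    · refine Fin.cases ?_ (fun i => ?_) i
      · simpa using hv1
      · simpa using hmem i
  have hn : ‖‖x‖⁻¹ • x‖ = 1 := by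
    rw [norm_smul, norm_inv, norm_norm, inv_mul_cancel₀ (norm_ne_zero_iff.2 hx0)]
  set v := ‖x‖⁻¹ • x with hv
  have hv1 := Submodule.smul_mem _ ‖x‖⁻¹ hx1
  have hv2 := Submodule.smul_mem _ ‖x‖⁻¹ hx2
  obtain ⟨h1, h1'⟩ := key v hv2 hv1 hn
  obtain ⟨h2, h2'⟩ := key (-v) (Submodule.neg_mem _ hv2) (Submodule.neg_mem _ hv1)
    (by rw [norm_neg, hn])
  have hneg : (wMatrix (Matrix.vecCons (-v) s) e.1).det =
      -(wMatrix (Matrix.vecCons v s) e.1).det := by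
    have : wMatrix (Matrix.vecCons (-v) s) e.1 = (wMatrix (Matrix.vecCons v s) e.1).updateRow 0
        ((-1 : ℝ) • wMatrix (Matrix.vecCons v s) e.1 0) := by
      ext i j
      refine Fin.cases ?_ (fun i => ?_) i
      · simp [wMatrix]
      · simp [wMatrix]
    rw [this, Matrix.det_updateRow_smul, Matrix.updateRow_eq_self, neg_one_mul]
  have hdet : (wMatrix (Matrix.vecCons v s) e.1).det ≠ 0 := by
    intro h0
    have h3 := congrArg Matrix.det (wMatrix_mul_transpose (e := e) (f := ⟨_, h1⟩) h1')
    rw [Matrix.det_mul, Matrix.det_one, h0, zero_mul] at h3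
    exact zero_ne_one h3
  -- The unit vector completing `s` is unique up to sign; the sign is chosen to match the
  -- orientation.
  rcases lt_or_gt_of_ne hdet with h | h
  · exact ⟨-v, h2, mk_eq_mk_of_det_pos h2' (by rw [hneg]; linarith)⟩
  · exact ⟨v, h1, mk_eq_mk_of_det_pos h1' h⟩

theorem det_wMatrix_vecCons {N : ℕ} {v v' : Ambient (N + 1) m} {s : Fin N → Ambient (N + 1) m}
    (h : Orthonormal ℝ (Matrix.vecCons v s)) (h' : Orthonormal ℝ (Matrix.vecCons v' s)) :
    (wMatrix (Matrix.vecCons v s) (Matrix.vecCons v' s)).det = inner ℝ v v' := by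
  obtain ⟨-, hv, hs⟩ := orthonormal_vecCons_iff.1 h
  obtain ⟨-, hv', -⟩ := orthonormal_vecCons_iff.1 h'
  have : wMatrix (Matrix.vecCons v s) (Matrix.vecCons v' s) =
      Matrix.diagonal (Matrix.vecCons (inner ℝ v v') fun _ => 1) := by
    ext i j
    refine Fin.cases ?_ (fun i => ?_) i <;> refine Fin.cases ?_ (fun j => ?_) j
    · simp [wMatrix]
    · rw [Matrix.diagonal_apply_ne _ (Fin.succ_ne_zero j).symm]
      simp [wMatrix, hv]
    · simp [wMatrix, real_inner_comm v', hv']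
    · simp [wMatrix, orthonormal_iff_ite.1 hs, Matrix.diagonal_apply]
  rw [this, Matrix.det_diagonal, Fin.prod_univ_succ]
  simp

/-- S-orthogonal planes have oriented orthonormal bases that differ in one vector only. -/
theorem SOrthogonal.exists_frames {P Q : OrientedGrassmannian n m} (h : SOrthogonal P Q) :
    ∃ (p q : Frame n m) (k : Fin n), P = .mk p ∧ Q = .mk q ∧
      q.1 = Function.update p.1 k (q.1 k) ∧ inner ℝ (p.1 k) (q.1 k) = 0 := by
  obtain ⟨hdim, hw⟩ := h
  obtain _ | N := n
  · omega
  obtain ⟨e, rfl⟩ := Quotient.exists_rep P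
  obtain ⟨f, rfl⟩ := Quotient.exists_rep Q
  have hdim' : Module.finrank ℝ ↥(Submodule.span ℝ (Set.range e.1) ⊓
      Submodule.span ℝ (Set.range f.1)) = N := Nat.succ_injective hdim
  set S := Submodule.span ℝ (Set.range e.1) ⊓ Submodule.span ℝ (Set.range f.1) with hS
  set b := (stdOrthonormalBasis ℝ S).reindex (finCongr hdim') with hb
  have hs : Orthonormal ℝ fun i => (b i : Ambient (N + 1) m) :=
    b.orthonormal.comp_linearIsometry S.subtypeₗᵢ
  obtain ⟨v, hv, hve⟩ := exists_frame_vecCons e hs fun i => (b i).2.1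
  obtain ⟨v', hv', hve'⟩ := exists_frame_vecCons f hs fun i => (b i).2.2
  refine ⟨⟨_, hv⟩, ⟨_, hv'⟩, 0, hve, hve', ?_, ?_⟩
  · funext i
    refine Fin.cases ?_ (fun i => ?_) i <;> simp
  · have : w (OrientedGrassmannian.mk e) (OrientedGrassmannian.mk f) = 0 := hw
    rw [hve, hve'] at this
    simpa using (det_wMatrix_vecCons hv hv').symm.trans this

theorem continuous_w_mk (p : Frame n m) :
    Continuous fun S : OrientedGrassmannian n m => w S (.mk p) := by
  have h : Continuous fun e : Frame n m => (wMatrix e.1 p.1).det := by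
    refine Continuous.matrix_det (continuous_matrix fun i j => ?_)
    have hi : Continuous fun e : Frame n m => e.1 i :=
      (continuous_apply i).comp continuous_subtype_val
    exact hi.inner continuous_const
  exact h.quotient_lift _

/-- A compact subset of `𝕎_c` stays away from the disk of radius `c`. -/
theorem exists_radius {p q : Frame n m} {K : Set (OrientedGrassmannian n m)} (hK : IsCompact K)
    {c : ℝ} (hKc : K ⊆ regionW (.mk p) (.mk q) c) :
    ∃ r, c < r ∧ ∀ S ∈ K, r ^ 2 ≤ w S (.mk p) ^ 2 + w S (.mk q) ^ 2 := by
  rcases K.eq_empty_or_nonempty with rfl | hne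
  · exact ⟨c + 1, by linarith, by simp⟩
  have hcont : Continuous fun S => w S (.mk p) ^ 2 + w S (.mk q) ^ 2 :=
    ((continuous_w_mk p).pow 2).add ((continuous_w_mk q).pow 2)
  obtain ⟨S, hS, hmin⟩ := hK.exists_isMinOn hne hcont.continuousOn
  have hSc : c ^ 2 < w S (.mk p) ^ 2 + w S (.mk q) ^ 2 := by
    by_contra! h
    exact (hKc hS).2 (Or.inl h)
  refine ⟨√(w S (.mk p) ^ 2 + w S (.mk q) ^ 2), Real.lt_sqrt_of_sq_lt hSc, fun S' hS' => ?_⟩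
  rw [Real.sq_sqrt (by positivity)]
  exact hmin hS'

theorem wMatrix_update (v p : Fin n → Ambient n m) (k : Fin n) (x : Ambient n m) :
    wMatrix v (Function.update p k x) = (wMatrix v p).updateCol k fun i => inner ℝ (v i) x := by
  ext i j
  by_cases hj : j = k
  · subst hj; simp [wMatrix]
  · simp [wMatrix, hj]

/-- Linearity of the determinant in one column. It turns rotation of one basis vector into rotation
of the linear functional on the S-map. -/
theorem wLocal_update (u : Model n → Ambient n m) (p : Fin n → Ambient n m) (k : Fin n)
    (a b : Ambient n m) (α β : ℝ) (y : Model n) :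
    wLocal u (Function.update p k (α • a + β • b)) y =
      α * wLocal u (Function.update p k a) y + β * wLocal u (Function.update p k b) y := by
  simp only [wLocal, wMatrix_update, inner_add_right, real_inner_smul_right]
  rw [show (fun i => α * inner ℝ (pd i u y) a + β * inner ℝ (pd i u y) b) =
    (α • fun i => inner ℝ (pd i u y) a) + β • fun i => inner ℝ (pd i u y) b from rfl,
    Matrix.det_updateCol_add, Matrix.det_updateCol_smul, Matrix.det_updateCol_smul]
  ring

theorem orthonormal_update {p : Fin n → Ambient n m} (hp : Orthonormal ℝ p) {k : Fin n}
    {b : Ambient n m} (hq : Orthonormal ℝ (Function.update p k b)) (hb : inner ℝ (p k) b = 0)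
    {α β : ℝ} (h : α ^ 2 + β ^ 2 = 1) :
    Orthonormal ℝ (Function.update p k (α • p k + β • b)) := by
  have hb1 : ‖b‖ = 1 := by simpa using hq.1 k
  have hi : ∀ i, i ≠ k → inner ℝ (p i) (α • p k + β • b) = 0 := by
    intro i hi
    have h1 := hq.2 hi
    simp only [Function.update_of_ne hi, Function.update_self] at h1
    rw [inner_add_right, real_inner_smul_right, real_inner_smul_right, hp.2 hi, h1]
    ring
  refine ⟨fun i => ?_, fun i j hij => ?_⟩
  · by_cases hik : i = k
    · subst hik
      rw [Function.update_self, ← sq_eq_sq₀ (norm_nonneg _) zero_le_one, norm_add_sq_real,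
        norm_smul, norm_smul, hp.1, hb1, real_inner_smul_left, real_inner_smul_right, hb]
      simpa using h
    · rw [Function.update_of_ne hik, hp.1]
  · by_cases hik : i = k
    · subst hik
      rw [Function.update_self, Function.update_of_ne hij.symm, real_inner_comm, hi j hij.symm]
    · by_cases hjk : j = k
      · subst hjk
        rw [Function.update_self, Function.update_of_ne hik, hi i hik]
      · simpa [Function.update_of_ne hik, Function.update_of_ne hjk] using hp.2 hij

end

/-! ### The angle of the tangent line to a circle. -/

section

/-- The angle `T` with `x₁ cos T + x₂ sin T = c`. -/
noncomputable def tangentAngle (c x₁ x₂ : ℝ) : ℝ :=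
  (Complex.log ⟨x₁, x₂⟩).im - Real.arccos (c / √(x₁ ^ 2 + x₂ ^ 2))

variable {c x₁ x₂ : ℝ}

theorem tangentAngle_mem : -(2 * Real.pi) ≤ tangentAngle c x₁ x₂ ∧
    tangentAngle c x₁ x₂ ≤ Real.pi := by
  have h1 := Complex.neg_pi_lt_arg ⟨x₁, x₂⟩
  have h2 := Complex.arg_le_pi ⟨x₁, x₂⟩
  have h3 := Real.arccos_nonneg (c / √(x₁ ^ 2 + x₂ ^ 2))
  have h4 := Real.arccos_le_pi (c / √(x₁ ^ 2 + x₂ ^ 2))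
  rw [tangentAngle, Complex.log_im]
  constructor <;> linarith

/-- In polar coordinates the equation is `r cos (arg - T) = c`. Subtracting the arccosine selects,
of the two tangent lines, the one on which the conjugate functional `r sin (arg - T)` is positive.
-/
theorem tangentAngle_spec (hc : 0 ≤ c) (h : c ^ 2 < x₁ ^ 2 + x₂ ^ 2) :
    x₁ * Real.cos (tangentAngle c x₁ x₂) + x₂ * Real.sin (tangentAngle c x₁ x₂) = c ∧
    -Real.sin (tangentAngle c x₁ x₂) * x₁ + Real.cos (tangentAngle c x₁ x₂) * x₂ =
      √(x₁ ^ 2 + x₂ ^ 2 - c ^ 2) := by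
  have hr : 0 < √(x₁ ^ 2 + x₂ ^ 2) := Real.sqrt_pos.2 (by nlinarith [sq_nonneg c])
  have hr2 : √(x₁ ^ 2 + x₂ ^ 2) ^ 2 = x₁ ^ 2 + x₂ ^ 2 := Real.sq_sqrt (by positivity)
  have hn : ‖(⟨x₁, x₂⟩ : ℂ)‖ = √(x₁ ^ 2 + x₂ ^ 2) := by
    rw [Complex.norm_def, Complex.normSq_mk]
    ring_nf
  have e1 := Complex.norm_mul_cos_arg ⟨x₁, x₂⟩
  have e2 := Complex.norm_mul_sin_arg ⟨x₁, x₂⟩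
  rw [hn] at e1 e2
  dsimp only at e1 e2
  have hcr : c ≤ √(x₁ ^ 2 + x₂ ^ 2) := Real.le_sqrt_of_sq_le h.le
  have e3 : Real.cos (Real.arccos (c / √(x₁ ^ 2 + x₂ ^ 2))) = c / √(x₁ ^ 2 + x₂ ^ 2) :=
    Real.cos_arccos (by linarith [div_nonneg hc hr.le]) ((div_le_one hr).2 hcr)
  have e4 : √(x₁ ^ 2 + x₂ ^ 2) * Real.sin (Real.arccos (c / √(x₁ ^ 2 + x₂ ^ 2))) =
      √(x₁ ^ 2 + x₂ ^ 2 - c ^ 2) := by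
    rw [Real.sin_arccos, div_pow, hr2, ← Real.sqrt_mul (by positivity)]
    congr 1
    have : x₁ ^ 2 + x₂ ^ 2 ≠ 0 := by rw [← hr2]; positivity
    field_simp
  have e5 : √(x₁ ^ 2 + x₂ ^ 2) * Real.cos (Real.arccos (c / √(x₁ ^ 2 + x₂ ^ 2))) = c := by
    rw [e3]; field_simp
  rw [tangentAngle, Complex.log_im, Real.cos_sub, Real.sin_sub]
  set θ := Complex.arg ⟨x₁, x₂⟩
  set α := Real.arccos (c / √(x₁ ^ 2 + x₂ ^ 2))
  have e6 := Real.sin_sq_add_cos_sq θ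
  constructor
  · rw [← e5]
    set r := √(x₁ ^ 2 + x₂ ^ 2)
    rw [← e1, ← e2]
    linear_combination (r * Real.cos α) * e6
  · rw [← e4]
    set r := √(x₁ ^ 2 + x₂ ^ 2)
    rw [← e1, ← e2]
    linear_combination (r * Real.sin α) * e6

/-- The slit keeps the argument smooth, and the strict inequality with `c ^ 2` keeps the arccosine
away from its singular value at 1. -/
theorem contDiffAt_tangentAngle {E : Type*} [NormedAddCommGroup E] [NormedSpace ℝ E]
    {f g : E → ℝ} {y : E} (hf : ContDiffAt ℝ ∞ f y) (hg : ContDiffAt ℝ ∞ g y) (hc : 0 ≤ c)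
    (h : c ^ 2 < f y ^ 2 + g y ^ 2) (hs : ¬(f y ≤ 0 ∧ g y = 0)) :
    ContDiffAt ℝ ∞ (fun z => tangentAngle c (f z) (g z)) y := by
  have hpos : 0 < f y ^ 2 + g y ^ 2 := by nlinarith [sq_nonneg c]
  have hlt : c < √(f y ^ 2 + g y ^ 2) := Real.lt_sqrt_of_sq_lt h
  have hr : 0 < √(f y ^ 2 + g y ^ 2) := Real.sqrt_pos.2 hpos
  have hz : ContDiffAt ℝ ∞ (fun z => (⟨f z, g z⟩ : ℂ)) y :=
    (Complex.equivRealProdCLM.symm.contDiff.contDiffAt).comp y (hf.prodMk hg)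
  have hslit : (⟨f y, g y⟩ : ℂ) ∈ Complex.slitPlane := by
    rw [Complex.mem_slitPlane_iff]
    by_contra! h0
    exact hs h0
  have hlog : ContDiffAt ℝ ∞ (fun z => (Complex.log ⟨f z, g z⟩).im) y :=
    (Complex.imCLM.contDiff.contDiffAt (x := Complex.log ⟨f y, g y⟩)).comp y
      (ContDiffAt.comp (g := Complex.log) y
        ((Complex.contDiffAt_log (n := ∞) hslit).restrict_scalars ℝ) hz)
  have harc : ContDiffAt ℝ ∞ (fun z => Real.arccos (c / √(f z ^ 2 + g z ^ 2))) y := by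
    have hq : ContDiffAt ℝ ∞ (fun z => c / √(f z ^ 2 + g z ^ 2)) y :=
      contDiffAt_const.div (((hf.pow 2).add (hg.pow 2)).sqrt hpos.ne') hr.ne'
    refine ContDiffAt.comp (g := Real.arccos) y (Real.contDiffAt_arccos ?_ ?_) hq
    · have := div_nonneg hc hr.le
      linarith
    · exact ((div_lt_one hr).2 hlt).ne
  exact hlog.sub harc

end

end GaussImage

/-! ### Construction of the subharmonic function. -/

namespace GaussImage

section

variable {n m : ℕ}

theorem localLaplacian_congr {u : Model n → Ambient n m} {φ φ' : Model n → ℝ} {y : Model n}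
    (h : φ =ᶠ[nhds y] φ') : localLaplacian u φ y = localLaplacian u φ' y := by
  simp only [localLaplacian, pd_eq_dd, (dd_congr h _).self_of_nhds,
    (dd_congr (dd_congr h _) _).self_of_nhds]

theorem secondFFNormSq_nonneg {u : Model n → Ambient n m} {y : Model n}
    (hu : ContDiffAt ℝ ∞ u y) (hli : LinearIndependent ℝ fun i => pd i u y) :
    0 ≤ secondFFNormSq u y := by
  obtain ⟨ℓ, hℓ⟩ := exists_frame hli
  rw [secondFFNormSq_frame hℓ hu]
  positivity

/-- The function `exp (k T)` on the region `r² ≤ x₁² + x₂² ≤ 1` of the slit plane, where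
`x₁ = w(·, p)` and `x₂ = w(·, q)`. -/
theorem localLaplacian_exp_tangentAngle {p q : Fin n → Ambient n m} (hp : Orthonormal ℝ p)
    (hq : Orthonormal ℝ q) {j : Fin n} (hpq : q = Function.update p j (q j))
    (horth : inner ℝ (p j) (q j) = 0) {c r κ Λ k : ℝ} (hc : 0 < c) (hcr : c < r) (hκ : 0 < κ)
    (hΛ : 0 ≤ Λ) (hk : 0 ≤ k) (hks : Λ + 2 / κ ≤ k * √(r ^ 2 - c ^ 2))
    {u : Model n → Ambient n m} {y : Model n} (hu : ContDiffAt ℝ ∞ u y)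
    (hli : LinearIndependent ℝ fun i => pd i u y)
    (hloc : ∀ p' : Fin n → Ambient n m, Orthonormal ℝ p' → wLocal u p' y = c →
      localLaplacian u (wLocal u p') y ≤
        -κ * secondFFNormSq u y + Λ * gradNormSq u (wLocal u p') y)
    (hr : r ^ 2 ≤ wLocal u p y ^ 2 + wLocal u q y ^ 2)
    (h1 : wLocal u p y ^ 2 + wLocal u q y ^ 2 ≤ 1)
    (hslit : ¬(wLocal u p y ≤ 0 ∧ wLocal u q y = 0)) :
    ContDiffAt ℝ ∞
      (fun z => Real.exp (k * tangentAngle c (wLocal u p z) (wLocal u q z))) y ∧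
    k * Real.exp (-(k * (2 * Real.pi))) * (κ / 2) * secondFFNormSq u y ≤ localLaplacian u
      (fun z => Real.exp (k * tangentAngle c (wLocal u p z) (wLocal u q z))) y := by
  obtain ⟨ℓ, hℓ⟩ := exists_frame hli
  have hw : ∀ p', ContDiffAt ℝ ∞ (wLocal u p') y := contDiffAt_wLocal hu (det_metric_pos hℓ)
  have hcr2 : c ^ 2 < r ^ 2 := by nlinarith
  have hc2 : c ^ 2 < wLocal u p y ^ 2 + wLocal u q y ^ 2 := hcr2.trans_le hr
  set T : Model n → ℝ := fun z => tangentAngle c (wLocal u p z) (wLocal u q z) with hTd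
  have hT : ContDiffAt ℝ ∞ T y := contDiffAt_tangentAngle (hw p) (hw q) hc.le hc2 hslit
  refine ⟨(contDiffAt_const.mul hT).exp, ?_⟩
  have hup : ∀ α β : ℝ, wLocal u (Function.update p j (α • p j + β • q j)) =
      fun z => α * wLocal u p z + β * wLocal u q z := by
    intro α β
    funext z
    rw [wLocal_update, Function.update_eq_self, ← hpq]
  obtain ⟨s1, s2⟩ := tangentAngle_spec hc.le hc2
  have hs : 0 < √(r ^ 2 - c ^ 2) := Real.sqrt_pos.2 (by linarith)
  have hsV : √(r ^ 2 - c ^ 2) ≤ √(wLocal u p y ^ 2 + wLocal u q y ^ 2 - c ^ 2) :=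
    Real.sqrt_le_sqrt (by linarith)
  have hV1 : √(wLocal u p y ^ 2 + wLocal u q y ^ 2 - c ^ 2) ≤ 1 :=
    Real.sqrt_le_one.2 (by nlinarith [sq_nonneg c])
  have hid : ∀ᶠ z in nhds y,
      wLocal u p z * Real.cos (T z) + wLocal u q z * Real.sin (T z) = c := by
    have hcont : ContinuousAt (fun z => wLocal u p z ^ 2 + wLocal u q z ^ 2) y :=
      ((hw p).continuousAt.pow 2).add ((hw q).continuousAt.pow 2)
    filter_upwards [hcont.eventually_const_lt hc2] with z hz
    exact (tangentAngle_spec hc.le hz).1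
  have hq' := hq
  rw [hpq] at hq'
  have e1 := orthonormal_update hp hq' horth (Real.cos_sq_add_sin_sq (T y))
  have e2 := orthonormal_update hp hq' horth (α := -Real.sin (T y)) (β := Real.cos (T y))
    (by rw [neg_sq, Real.sin_sq_add_cos_sq])
  have hVy : wLocal u (Function.update p j (-Real.sin (T y) • p j + Real.cos (T y) • q j)) y =
      √(wLocal u p y ^ 2 + wLocal u q y ^ 2 - c ^ 2) := by
    rw [hup]; exact s2
  -- The frozen plane rotated by the angle `T y` satisfies `w = c` at `y` exactly, so `hloc` is
  -- applied on that level only; the gradient bound is applied to the plane a quarter turn further.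
  have key := localLaplacian_exp_angle hu hli (hw p) (hw q) hT hc.le hid (hup _ _) (hup _ _) hs
    (by rw [hVy]; exact hsV) (by rw [hVy]; exact hV1) hκ hΛ
    (hloc _ e1 (by rw [hup, ← s1]; ring))
    (gradNormSq_wLocal_le hu hli e2 (by rw [hVy]; exact (hs.trans_le hsV).ne')) hk hks
  refine le_trans (mul_le_mul_of_nonneg_right ?_ (secondFFNormSq_nonneg hu hli)) key
  have hexp : Real.exp (-(k * (2 * Real.pi))) ≤ Real.exp (k * T y) :=
    Real.exp_le_exp.2 (by nlinarith [(tangentAngle_mem (c := c) (x₁ := wLocal u p y)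
      (x₂ := wLocal u q y)).1])
  have hκ2 : 0 ≤ κ / 2 := by positivity
  exact mul_le_mul_of_nonneg_right (mul_le_mul_of_nonneg_left hexp hk) hκ2

/-- A local estimate for `Δ w` on `{w = c'}`, `c' > c`, gives strongly subharmonic functions on
the submanifolds with Gauss image in a compact subset of `𝕎_c`. -/
theorem exists_subharmonic {P Q : OrientedGrassmannian n m} (hPQ : SOrthogonal P Q)
    {K : Set (OrientedGrassmannian n m)} (hK : IsCompact K) {c : ℝ} (hc : 0 ≤ c)
    (hKc : K ⊆ regionW P Q c) (good : (Model n → Ambient n m) → Model n → Prop)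
    (hloc : ∀ c', c < c' → ∃ κ Λ : ℝ, 0 < κ ∧ 0 ≤ Λ ∧ ∀ (u : Model n → Ambient n m)
      (y : Model n) (p : Fin n → Ambient n m), ContDiffAt ℝ ∞ u y →
      (LinearIndependent ℝ fun i => pd i u y) → good u y → Orthonormal ℝ p → wLocal u p y = c' →
      localLaplacian u (wLocal u p) y ≤
        -κ * secondFFNormSq u y + Λ * gradNormSq u (wLocal u p) y) :
    ∃ K₀ C : ℝ, 0 < K₀ ∧
      ∀ (M : Type u) [TopologicalSpace M] [ChartedSpace (Model n) M]
        [IsManifold (𝓡 n) ∞ M] [OrientedAtlas n M]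
        (F : M → Ambient n m) (hF : SmoothImmersion F),
        (∀ x, good (inChart F x) (extChartAt (𝓡 n) x x)) → (∀ x, gaussMap hF x ∈ K) →
        ∃ f : M → ℝ, ContMDiff (𝓡 n) 𝓘(ℝ, ℝ) ∞ f ∧ (∀ x, 0 < f x ∧ f x ≤ C) ∧
          ∀ x, K₀ * normSqB F x ≤ laplaceBeltrami F f x := by
  obtain ⟨p, q, j, rfl, rfl, hpq, horth⟩ := hPQ.exists_frames
  obtain ⟨r, hr, hKr⟩ := exists_radius hK hKc
  -- The gap above `c` makes the Laplacian estimate available; the gap below `r` keeps `V ≥ √(r² -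
  -- c'²) > 0`.
  obtain ⟨c', hcc', hc'r⟩ := exists_between hr
  have hc' : 0 < c' := hc.trans_lt hcc'
  obtain ⟨κ, Λ, hκ, hΛ, hloc⟩ := hloc c' hcc'
  have hs : 0 < √(r ^ 2 - c' ^ 2) := Real.sqrt_pos.2 (by nlinarith)
  obtain ⟨k, hk⟩ : ∃ k, k = (Λ + 2 / κ) / √(r ^ 2 - c' ^ 2) := ⟨_, rfl⟩
  have hk0 : 0 < k := by rw [hk]; positivity
  have hks : Λ + 2 / κ ≤ k * √(r ^ 2 - c' ^ 2) := by rw [hk, div_mul_cancel₀ _ hs.ne']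
  refine ⟨k * Real.exp (-(k * (2 * Real.pi))) * (κ / 2), Real.exp (k * Real.pi), by positivity,
    fun M _ _ _ _ F hF hgood hFK => ?_⟩
  set f : M → ℝ := fun x => Real.exp (k * tangentAngle c'
    (w (gaussMap hF x) (.mk p)) (w (gaussMap hF x) (.mk q))) with hf
  have hfe : ∀ x, inChart f x =ᶠ[nhds (extChartAt (𝓡 n) x x)] fun z => Real.exp (k *
      tangentAngle c' (wLocal (inChart F x) p.1 z) (wLocal (inChart F x) q.1 z)) := by
    intro x
    filter_upwards [extChartAt_target_mem_nhds (I := 𝓡 n) x] with z hz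
    rw [← inChart_w_gaussMap hF x p hz, ← inChart_w_gaussMap hF x q hz]
    rfl
  have key : ∀ x, _ := fun x => localLaplacian_exp_tangentAngle p.2 q.2 hpq horth hc' hc'r hκ hΛ
    hk0.le hks (hF.contDiffAt_inChart x (mem_extChartAt_target x)) (hF.linearIndependent x)
    (fun p' hp' hw => hloc _ _ p' (hF.contDiffAt_inChart x (mem_extChartAt_target x))
      (hF.linearIndependent x) (hgood x) hp' hw)
    (by rw [← w_gaussMap_self hF, ← w_gaussMap_self hF]; exact hKr _ (hFK x))
    (by
      rw [← w_gaussMap_self hF, ← w_gaussMap_self hF]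
      have h : w (gaussMap hF x) (.mk p) ^ 2 + w (gaussMap hF x) (.mk q) ^ 2 ≤ (1 : ℝ) ^ 2 :=
        (hKc (hFK x)).1
      simpa using h)
    (by
      rw [← w_gaussMap_self hF, ← w_gaussMap_self hF]
      exact fun h => (hKc (hFK x)).2 (Or.inr h))
  refine ⟨f, contMDiff_of_inChart fun x => (key x).1.congr_of_eventuallyEq (hfe x),
    fun x => ⟨Real.exp_pos _, Real.exp_le_exp.2 ?_⟩, fun x => ?_⟩
  · exact mul_le_mul_of_nonneg_left tangentAngle_mem.2 hk0.le
  · rw [laplaceBeltrami, localLaplacian_congr (hfe x)]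
    exact (key x).2

end

end GaussImage

theorem mainTheorem5 (n m : ℕ) (P Q : OrientedGrassmannian n m) (hPQ : SOrthogonal P Q)
    (K : Set (OrientedGrassmannian n m)) (hK : IsCompact K) :
    (K ⊆ regionW P Q (1 / 3) →
      ∃ K₀ C : ℝ, 0 < K₀ ∧
        ∀ (M : Type u) [TopologicalSpace M] [ChartedSpace (Model n) M]
          [IsManifold (𝓡 n) ∞ M] [OrientedAtlas n M]
          (F : M → Ambient n m) (hF : SmoothImmersion F),
          HasParallelMeanCurvature F → (∀ x, gaussMap hF x ∈ K) →
          ∃ f : M → ℝ, ContMDiff (𝓡 n) 𝓘(ℝ, ℝ) ∞ f ∧ (∀ x, 0 < f x ∧ f x ≤ C) ∧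
            ∀ x, K₀ * normSqB F x ≤ laplaceBeltrami F f x) ∧
    (K ⊆ regionW P Q 0 →
      ∃ K₀ C : ℝ, 0 < K₀ ∧
        ∀ (M : Type u) [TopologicalSpace M] [ChartedSpace (Model n) M]
          [IsManifold (𝓡 n) ∞ M] [OrientedAtlas n M]
          (F : M → Ambient n m) (hF : SmoothImmersion F),
          IsMinimal F → (∀ x, gaussRank hF x ≤ 2) → (∀ x, gaussMap hF x ∈ K) →
          ∃ f : M → ℝ, ContMDiff (𝓡 n) 𝓘(ℝ, ℝ) ∞ f ∧ (∀ x, 0 < f x ∧ f x ≤ C) ∧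
            ∀ x, K₀ * normSqB F x ≤ laplaceBeltrami F f x) := by
  refine ⟨fun hKc => ?_, fun hKc => ?_⟩
  · obtain ⟨K₀, C, hK₀, h⟩ := exists_subharmonic.{u} hPQ hK (by norm_num) hKc
      (fun u y => ∀ i, normalPart u y (pd i (meanCurvature u) y) = 0) fun c hc => by
        have hc0 : 0 < c := lt_trans (by norm_num) hc
        -- On the level `w = c` the product `∏ (1 + λ²)` equals `1 / c ^ 2`, which is below 9
        -- exactly because `c > 1/3`.
        obtain ⟨κ, C, hκ, hC, h⟩ := exists_localLaplacian_wLocal_bound n m (R := 1 / c ^ 2)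
          (by rw [div_lt_iff₀ (by positivity)]; nlinarith)
        refine ⟨κ * c, (C + 1) / c, by positivity, by positivity,
          fun u y p hu hli hg hp hw => ?_⟩
        have := h u y p hu hli hp hg (by rw [hw]; exact hc0)
          (by rw [hw, one_div_mul_cancel (by positivity)])
        rwa [hw] at this
    exact ⟨K₀, C, hK₀, fun M _ _ _ _ F hF hpar hFK => h M F hF hpar hFK⟩
  · obtain ⟨K₀, C, hK₀, h⟩ := exists_subharmonic.{u} hPQ hK le_rfl hKc
      (fun u y => (∀ i, normalPart u y (pd i (meanCurvature u) y) = 0) ∧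
        meanCurvature u y = 0 ∧ ∀ ℓ : Fin n → Model n, (Orthonormal ℝ fun a => dd (ℓ a) u y) →
          Module.finrank ℝ (LinearMap.range (contractLeft (frameB u ℓ y))) ≤ 2) fun c hc => by
        -- The constants `κ = 1` and `C = 0` of the rank-two estimate, valid on every positive
        -- level.
        refine ⟨1 * c, (0 + 1) / c, by positivity, by positivity,
          fun u y p hu hli hg hp hw => ?_⟩
        have := localLaplacian_wLocal_le_of_rank hu hli hp hg.1 hg.2.1 hg.2.2
          (by rw [hw]; exact hc)
        rwa [hw] at this
    exact ⟨K₀, C, hK₀, fun M _ _ _ _ F hF hm hr hFK => h M F hF (fun x =>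
      ⟨hm.hasParallelMeanCurvature hF x, hm x,
        fun ℓ hℓ => (finrank_contractLeft_le_gaussRank hF x hℓ).trans (hr x)⟩) hFK⟩
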